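/- Let $A$ be a UHF algebra with unique tracial state $\tau$, and identify $K_0(A)$ with $\tau(K_0(A))\subset\mathbb R$. For a prime $p$ let $\zeta(p)=\sup\{k\ge 0 : [1]\text{ is divisible by }p^k\text{ in }K_0(A)\}$, let $\mathcal P(A)$ be the set of primes $p$ with $1\le\zeta(p)<\infty$, and put $\theta(p)=p^{\zeta(p)}$ for $p\in\mathcal P(A)$. For a unital $C^*$-subalgebra $B\subset A$ let $U(B)$ be its unitary group. Let $\alpha,\beta$ be actions of $\mathbb Z^2$ on $A$, and write $\alpha_1=\alpha_{(1,0)}$, $\alpha_2=\alpha_{(0,1)}$, and likewise for $\beta$. The relative invariant $[\beta,\alpha]\in\prod_{p\in\mathcal P(A)}\mathbb Z/\theta(p)\mathbb Z$ is defined as follows. Choose $0<\delta_0<1/8$ such that for every unital finite dimensional $C^*$-subalgebra $B\subset A$ and every $w\in U(A)$ with $\|[w,a]\|<\delta_0$ for all $a\in U(B)$ there is a piecewise smooth path $h:[0,1]\to U(A)$ from $1$ to $w$ with $\|[h(t),a]\|<1/8$ for all $t\in[0,1]$ and $a\in U(B)$. Let $p\in\mathcal P(A)$. Choose a unital subalgebra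 $A_0\subset A$ isomorphic to $M_{\theta(p)}(\mathbb C)$; a finite dimensional $C^*$-subalgebra $A_1\subset A$ such that for every $w\in U(A_0)$ each of $w$, $\beta_1^{-1}(w)$, $\beta_2^{-1}(w)$ is at distance less than $\delta_0/7$ from some element of $U(A_1)$; and unitaries $u_1,u_2\in A$ such that, for $i=1,2$, $$\|\beta_i(a)-u_i\alpha_i(a)u_i^*\|<\delta_0/7\quad\text{for all } a\in\beta_1^{-1}(U(A_1))\cup\beta_2^{-1}(U(A_1))\cup\beta_1^{-1}\beta_2^{-1}(U(A_1)).$$ Put $x=u_1\alpha_1(u_2)(u_2\alpha_2(u_1))^*$ and choose a piecewise smooth path $h:[0,1]\to U(A)$ with $h(0)=1$, $h(1)=x$ and $\|[h(t),a]\|<1/2$ for all $t\in[0,1]$ and $a\in U(A_0)$. Then $$[\beta,\alpha](p)=\frac1{2\pi\sqrt{-1}}\int_0^1\tau(\dot h(t)h(t)^*)\,dt+K_0(A\cap A_0')\in K_0(A)/K_0(A\cap A_0')\cong\mathbb Z/\theta(p)\mathbb Z,$$ where the isomorphism sends the class of $1/\theta(p)$ to $1$. Let $\alpha,\beta,\gamma$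 be actions of $\mathbb Z^2$ on $A$. Then the relative invariants $[\gamma,\alpha]$, $[\gamma,\beta]$, $[\beta,\alpha]$ are well defined (the choices above can be made, and the result does not depend on them), and $$[\gamma,\alpha]=[\gamma,\beta]+[\beta,\alpha].$$ -/

import Mathlib

open scoped ContDiff ComplexOrder

noncomputable section

namespace ZTwoUHF

variable {A : Type*} [CStarAlgebra A]

/-- A unital C⋆-subalgebra is a full matrix algebra of size `n`. -/
def IsMatrixSubalgebra (n : ℕ) (B : StarSubalgebra ℂ A) : Prop :=
  Nonempty (B ≃⋆ₐ[ℂ] Matrix (Fin n) (Fin n) ℂ)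

variable (A) in
/-- A UHF algebra: a unital C⋆-algebra containing an increasing sequence of unital full matrix
subalgebras with dense union. (Full matrix algebras themselves are included.) -/
def IsUHF : Prop :=
  ∃ (n : ℕ → ℕ) (B : ℕ → StarSubalgebra ℂ A),
    Monotone B ∧ (∀ k, 0 < n k ∧ IsMatrixSubalgebra (n k) (B k)) ∧
      Dense (⋃ k, (B k : Set A))

/-- Tracial states. -/
structure IsTracialState (τ : A →ₗ[ℂ] ℂ) : Prop where
  map_one : τ 1 = 1
  nonneg : ∀ a, 0 ≤ τ (star a * a)
  trace : ∀ a b, τ (a * b) = τ (b * a)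

variable (A) in
/-- The tracial state of `A`, for an algebra with exactly one tracial state (such as a UHF
algebra). -/
def tr : A →ₗ[ℂ] ℂ := Classical.epsilon IsTracialState

/-- For a unital C⋆-subalgebra `B ⊆ A`: the subgroup of `ℝ` generated by the values of the trace
on projections in matrix algebras over `B`, i.e. the image in `ℝ` of the `K₀`-group of `B`.
For `B = A` and for `B = A ∩ A₀'` (with `A` UHF and `A₀` a full matrix subalgebra) the trace is
injective on `K₀`, and `K₀` is identified with this subgroup. -/
def K₀ (B : StarSubalgebra ℂ A) : AddSubgroup ℝ :=
  AddSubgroup.closure {r : ℝ | ∃ (n : ℕ) (e : Matrix (Fin n) (Fin n) A),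
    IsStarProjection e ∧ (∀ i j, e i j ∈ B) ∧ (r : ℂ) = ∑ i, tr A (e i i)}

variable (A) in
/-- `ζ(p)`: the supremum of all `k` such that `[1]` (whose trace is `1`) is divisible by `p ^ k`
in `K₀(A)`. -/
def ζ (p : ℕ) : ℕ∞ :=
  sSup {k : ℕ∞ | ∃ j : ℕ, k = j ∧ ∃ x ∈ K₀ (⊤ : StarSubalgebra ℂ A), (p : ℝ) ^ j * x = 1}

variable (A) in
/-- `𝒫(A)`: the primes `p` with `1 ≤ ζ(p) < ∞`. -/
def primeSet : Set ℕ := {p | p.Prime ∧ 1 ≤ ζ A p ∧ ζ A p < ⊤}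

variable (A) in
/-- `θ(p) = p ^ ζ(p)`, for `p ∈ 𝒫(A)`. -/
def θ (p : ℕ) : ℕ := p ^ (ζ A p).toNat

variable (A) in
/-- Actions of `ℤ²` on `A` by ⋆-automorphisms. -/
abbrev Action : Type _ := Multiplicative (ℤ × ℤ) →* (A ≃⋆ₐ[ℂ] A)

/-- The generators `α₁ = α_(1,0)` (index `0`) and `α₂ = α_(0,1)` (index `1`) of an action. -/
def gen (α : Action A) (i : Fin 2) : A ≃⋆ₐ[ℂ] A :=
  α (Multiplicative.ofAdd (if i = 0 then (1, 0) else (0, 1)))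

/-- The unitary group of a unital C⋆-subalgebra `B`, as a subset of `A`. -/
def U (B : StarSubalgebra ℂ A) : Set A := {a | a ∈ unitary A ∧ a ∈ B}

/-- `h` restricts to a piecewise smooth path `[0,1] → U(A)`. Only the values on `[0,1]`
matter. -/
structure IsUnitaryPath (h : ℝ → A) : Prop where
  unitary_mem : ∀ t ∈ Set.Icc (0 : ℝ) 1, h t ∈ unitary A
  continuousOn : ContinuousOn h (Set.Icc 0 1)
  piecewise : ∃ (n : ℕ) (t : Fin (n + 1) → ℝ), StrictMono t ∧ t 0 = 0 ∧ t (Fin.last n) = 1 ∧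
    ∀ i : Fin n, ContDiffOn ℝ ∞ h (Set.Icc (t i.castSucc) (t i.succ))

/-- `(2πi)⁻¹ ∫₀¹ τ(h'(t) h(t)⋆) dt`, which is a real number for a piecewise smooth path of
unitaries `h`. -/
def winding (h : ℝ → A) : ℝ :=
  ((2 * Real.pi * Complex.I)⁻¹ * ∫ t in (0 : ℝ)..1, tr A (deriv h t * star (h t))).re

variable (A) in
/-- The property required of the constant `δ₀`. -/
def IsGoodConstant (δ₀ : ℝ) : Prop :=
  0 < δ₀ ∧ δ₀ < 1 / 8 ∧
    ∀ B : StarSubalgebra ℂ A, FiniteDimensional ℂ B →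
      ∀ w ∈ unitary A, (∀ a ∈ U B, ‖w * a - a * w‖ < δ₀) →
        ∃ h : ℝ → A, IsUnitaryPath h ∧ h 0 = 1 ∧ h 1 = w ∧
          ∀ t ∈ Set.Icc (0 : ℝ) 1, ∀ a ∈ U B, ‖h t * a - a * h t‖ < 1 / 8

/-- The choices `δ₀, A₀, A₁, u₁, u₂, h` from which `[β, α](p)` is computed, where `q = θ(p)`. -/
structure Choice (β α : Action A) (q : ℕ) where
  /-- the constant `δ₀` -/
  δ₀ : ℝ
  good : IsGoodConstant A δ₀
  /-- the full matrix subalgebra `A₀ ≅ M_q` -/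
  A₀ : StarSubalgebra ℂ A
  isMatrix : IsMatrixSubalgebra q A₀
  /-- the finite dimensional subalgebra `A₁` -/
  A₁ : StarSubalgebra ℂ A
  finiteDim : FiniteDimensional ℂ A₁
  approx : ∀ w ∈ U A₀, ∃ a ∈ U A₁, ∃ b ∈ U A₁, ∃ c ∈ U A₁,
    ‖w - a‖ < δ₀ / 7 ∧ ‖(gen β 0).symm w - b‖ < δ₀ / 7 ∧ ‖(gen β 1).symm w - c‖ < δ₀ / 7
  /-- the unitaries `u₁` (index `0`) and `u₂` (index `1`) -/
  u : Fin 2 → unitary A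
  inner_approx : ∀ i : Fin 2,
    ∀ a ∈ (gen β 0).symm '' U A₁ ∪ (gen β 1).symm '' U A₁ ∪
        (fun b => (gen β 0).symm ((gen β 1).symm b)) '' U A₁,
      ‖gen β i a - u i * gen α i a * star (u i : A)‖ < δ₀ / 7
  /-- the path `h` -/
  h : ℝ → A
  isPath : IsUnitaryPath h
  h_zero : h 0 = 1
  /-- the path ends at `x = u₁ α₁(u₂) (u₂ α₂(u₁))⋆` -/
  h_one : h 1 = u 0 * gen α 0 (u 1) * star (u 1 * gen α 1 (u 0) : A)
  h_comm : ∀ t ∈ Set.Icc (0 : ℝ) 1, ∀ a ∈ U A₀, ‖h t * a - a * h t‖ < 1 / 2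

/-- `(2πi)⁻¹ ∫₀¹ τ(h'(t) h(t)⋆) dt` lies in `K₀(A)` and `c : ℤ/q` corresponds to its class in
`K₀(A) / K₀(A ∩ A₀')` under the isomorphism `K₀(A) / K₀(A ∩ A₀') ≅ ℤ/q` that sends the class of
`1/q` (the class of a minimal projection of `A₀`) to `1`. -/
def Choice.Represents {β α : Action A} {q : ℕ} (D : Choice β α q) (c : ZMod q) : Prop :=
  winding D.h ∈ K₀ (⊤ : StarSubalgebra ℂ A) ∧
    ∃ j : ℤ, (j : ZMod q) = c ∧
      winding D.h - j / q ∈ K₀ (StarSubalgebra.centralizer ℂ (D.A₀ : Set A))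

/-- The relative invariant `[β, α] ∈ ∏_{p ∈ 𝒫(A)} ℤ/θ(p)`: its `p`-component is the class
computed from some choice of `δ₀, A₀, A₁, u₁, u₂, h`. -/
def relInvariant (β α : Action A) (p : primeSet A) : ZMod (θ A p) :=
  Classical.epsilon fun c => ∃ D : Choice β α (θ A p), D.Represents c

/-- `[β, α]` is well defined: for every `p ∈ 𝒫(A)` the required choices can be made, and every
choice gives the same class `[β, α](p)`. -/
def WellDefined (β α : Action A) : Prop :=
  ∀ p : primeSet A, Nonempty (Choice β α (θ A p)) ∧
    ∀ (D : Choice β α (θ A p)) (c : ZMod (θ A p)), D.Represents c ↔ c = relInvariant β α p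

end ZTwoUHF

end

/-! The winding number of a path of invertibles is the integral of the trace of its logarithmic
derivative. It is additive under pointwise products because the trace is tracial, invariant under
automorphisms because the tracial state is unique, and unchanged by small perturbations that keep a
loop closed (`wind_eq_of_close`). Two integrality facts carry the proof. A loop in A is close to a
polynomial loop in a matrix subalgebra, where its winding is a multiple of that of the determinant;
hence windings of loops lie in K₀(A) (`wind_of_dense`, `MatrixTower.wind_mem_K₀`). If the loop has
commutators bounded by some r < 1 with the unitaries of A₀ ≅ M_q, averaging over U(A₀) gives a
nearby loop of invertibles in A ∩ A₀'; cutting down by a minimal projection of A₀ divides the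
winding by q, so the winding lies in q K₀(A), which is K₀(A ∩ A₀')
(`MatrixTower.wind_mem_K₀_centralizer`, `MatrixTower.mem_K₀_centralizer`).

Choices exist because automorphisms are inner on each matrix stage. The unitaries u_i so obtained
have an obstruction x that almost commutes with a prescribed finite dimensional subalgebra, since α
and β each consist of commuting automorphisms. Such an x is joined to 1 through almost commuting
unitaries (`exists_smooth_path`): average it into the commutant, approximate by an algebraic
element, use its finite spectrum to connect its polar part to 1 inside the commutant, and treat the
small remainder by an exponential.

To compare a choice with unitaries w_i and a finer pair u_i, join u_i w_i⋆ to 1 by paths Z_i that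
almost commute with A₁. `transport` then moves the obstruction of w to that of u. Each Z_i enters
once directly and once inversely, up to automorphisms and conjugations, so the transport has winding
zero and only the two chosen paths contribute (`Choice.winding_sub_mem`).

For the cocycle identity, take v_i comparing γ with β, fix paths V_i from 1 to v_i, and only then
take u_i comparing β with α, accurately on a compact set depending on the V_i. The products v_i u_i
compare γ with α. A path to their obstruction is the path for v, times the inverse of the transport
of 1 along V with respect to β, times the transport of the path for u along V with respect to α. Its
winding is the sum of the two windings. It almost commutes with A₀ because the last two factors
nearly combine to a conjugate of the path for u (`winding_cocycle`).

The identity holds for arbitrary choices, so independence of the choices follows by inserting a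
choice for the pair (α, α). The identification of the quotient with ℤ/q, for q = θ(p), is Bézout's
identity for the denominators of K₀(A). -/

noncomputable section

namespace ZTwoUHF

open MeasureTheory Set intervalIntegral

/-! ### Winding numbers of paths of invertibles -/

section Paths

variable {R : Type*} [NormedRing R] [NormedAlgebra ℂ R]

/-- A path on `[0,1]` that is differentiable off a countable set, with integrable derivative. -/
structure IsPath (h : ℝ → R) : Prop where
  continuousOn : ContinuousOn h (Icc 0 1)
  differentiable : ∃ F : Set ℝ, F.Countable ∧ ∀ t ∈ Ioo (0 : ℝ) 1 \ F, DifferentiableAt ℝ h t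
  integrable : IntervalIntegrable (deriv h) volume 0 1

/-- `∫₀¹ t(h' h⁻¹)`. -/
def wind (t : R →L[ℂ] ℂ) (h : ℝ → R) : ℂ :=
  ∫ s in (0 : ℝ)..1, t (deriv h s * Ring.inverse (h s))

theorem ae_Ioo_diff {F : Set ℝ} (hF : F.Countable) {P : ℝ → Prop}
    (h : ∀ s ∈ Ioo (0 : ℝ) 1 \ F, P s) : ∀ᵐ s ∂volume, s ∈ uIoc (0 : ℝ) 1 → P s := by
  have h1 : ∀ᵐ s ∂(volume : Measure ℝ), s ∉ F := hF.ae_notMem _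
  have h2 : ∀ᵐ s ∂(volume : Measure ℝ), s ∉ ({1} : Set ℝ) := (countable_singleton _).ae_notMem _
  filter_upwards [h1, h2] with s h1 h2 hs
  rw [uIoc_of_le zero_le_one] at hs
  exact h s ⟨⟨hs.1, lt_of_le_of_ne hs.2 h2⟩, h1⟩

theorem IsPath.congr_integrable {f g : ℝ → R} {F : Set ℝ} (hF : F.Countable)
    (hf : IntervalIntegrable f volume 0 1) (h : ∀ s ∈ Ioo (0 : ℝ) 1 \ F, f s = g s) :
    IntervalIntegrable g volume 0 1 := by
  refine hf.congr_ae ?_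
  rw [Filter.EventuallyEq, ae_restrict_iff' measurableSet_uIoc]
  exact ae_Ioo_diff hF h

theorem IsPath.of_contDiff {h : ℝ → R} (hh : ContDiff ℝ 1 h) : IsPath h where
  continuousOn := hh.continuous.continuousOn
  differentiable := ⟨∅, countable_empty, fun t _ => hh.differentiable one_ne_zero t⟩
  integrable := (hh.continuous_deriv le_rfl).intervalIntegrable _ _

theorem isPath_const (a : R) : IsPath fun _ => a := .of_contDiff contDiff_const

theorem IsPath.mul {h k : ℝ → R} (hh : IsPath h) (hk : IsPath k) :
    IsPath fun s => h s * k s := by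
  obtain ⟨F, hF, hdF⟩ := hh.differentiable
  obtain ⟨G, hG, hdG⟩ := hk.differentiable
  refine ⟨hh.continuousOn.mul hk.continuousOn, ⟨F ∪ G, hF.union hG, fun t ht => ?_⟩, ?_⟩
  · simp only [mem_sdiff, mem_union, not_or] at ht
    exact (hdF t ⟨ht.1, ht.2.1⟩).mul (hdG t ⟨ht.1, ht.2.2⟩)
  · have hi : IntervalIntegrable (fun s => deriv h s * k s + h s * deriv k s) volume 0 1 :=
      (hh.integrable.mul_continuousOn (by simpa using hk.continuousOn)).add
        (hk.integrable.continuousOn_mul (by simpa using hh.continuousOn))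
    refine IsPath.congr_integrable (hF.union hG) hi fun t ht => ?_
    simp only [mem_sdiff, mem_union, not_or] at ht
    exact (((hdF t ⟨ht.1, ht.2.1⟩).hasDerivAt.mul (hdG t ⟨ht.1, ht.2.2⟩).hasDerivAt).deriv).symm

theorem IsPath.clm_comp {S : Type*} [NormedRing S] [NormedAlgebra ℂ S] {h : ℝ → R}
    (hh : IsPath h) (φ : R →L[ℝ] S) : IsPath fun s => φ (h s) := by
  obtain ⟨F, hF, hdF⟩ := hh.differentiable
  refine ⟨φ.continuous.comp_continuousOn hh.continuousOn, ⟨F, hF,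
    fun t ht => φ.differentiableAt.comp t (hdF t ht)⟩, ?_⟩
  have hi : IntervalIntegrable (fun s => φ (deriv h s)) volume 0 1 :=
    ⟨φ.integrable_comp hh.integrable.1, φ.integrable_comp hh.integrable.2⟩
  refine IsPath.congr_integrable hF hi fun t ht => ?_
  exact ((φ.hasFDerivAt.comp_hasDerivAt t (hdF t ht).hasDerivAt).deriv).symm

theorem IsPath.hasDerivAt_clm {h : ℝ → R} {s : ℝ} (hs : DifferentiableAt ℝ h s) {E : Type*}
    [NormedAddCommGroup E] [NormedSpace ℝ E] (φ : R →L[ℝ] E) :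
    deriv (fun s => φ (h s)) s = φ (deriv h s) :=
  (φ.hasFDerivAt.comp_hasDerivAt s hs.hasDerivAt).deriv

theorem IsPath.add {h k : ℝ → R} (hh : IsPath h) (hk : IsPath k) :
    IsPath fun s => h s + k s := by
  obtain ⟨F, hF, hdF⟩ := hh.differentiable
  obtain ⟨G, hG, hdG⟩ := hk.differentiable
  refine ⟨hh.continuousOn.add hk.continuousOn, ⟨F ∪ G, hF.union hG, fun t ht => ?_⟩, ?_⟩
  · simp only [mem_sdiff, mem_union, not_or] at ht
    exact (hdF t ⟨ht.1, ht.2.1⟩).add (hdG t ⟨ht.1, ht.2.2⟩)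
  · refine IsPath.congr_integrable (hF.union hG) (hh.integrable.add hk.integrable) fun t ht => ?_
    simp only [mem_sdiff, mem_union, not_or] at ht
    exact (((hdF t ⟨ht.1, ht.2.1⟩).hasDerivAt.add (hdG t ⟨ht.1, ht.2.2⟩).hasDerivAt).deriv).symm

variable [CompleteSpace R]

theorem continuousOn_ringInverse {X : Type*} [TopologicalSpace X] {h : X → R} {s : Set X}
    (hc : ContinuousOn h s) (hu : ∀ x ∈ s, IsUnit (h x)) :
    ContinuousOn (fun x => Ring.inverse (h x)) s := by
  intro x hx
  obtain ⟨u, hu⟩ := hu x hx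
  have : ContinuousAt Ring.inverse (h x) := by
    rw [← hu]; exact NormedRing.inverse_continuousAt u
  exact this.comp_continuousWithinAt (hc x hx)

theorem hasDerivAt_ringInverse {h : ℝ → R} {s : ℝ} {h' : R} (hd : HasDerivAt h h' s)
    (hu : IsUnit (h s)) : HasDerivAt (fun x => Ring.inverse (h x))
      (-(Ring.inverse (h s) * h' * Ring.inverse (h s))) s := by
  obtain ⟨u, hu⟩ := hu
  have h1 : HasFDerivAt Ring.inverse (-ContinuousLinearMap.mulLeftRight ℝ R ↑u⁻¹ ↑u⁻¹) (h s) := by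
    rw [← hu]; exact hasFDerivAt_ringInverse u
  have := h1.comp_hasDerivAt s hd
  rw [← hu, Ring.inverse_unit]
  exact this

theorem IsPath.inverse {h : ℝ → R} (hh : IsPath h) (hu : ∀ s ∈ Icc (0 : ℝ) 1, IsUnit (h s)) :
    IsPath fun s => Ring.inverse (h s) := by
  obtain ⟨F, hF, hdF⟩ := hh.differentiable
  have hc := continuousOn_ringInverse hh.continuousOn hu
  have hc' : ContinuousOn (fun s => Ring.inverse (h s)) (uIcc 0 1) := by simpa using hc
  have hd : ∀ t ∈ Ioo (0 : ℝ) 1 \ F, HasDerivAt (fun x => Ring.inverse (h x))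
      (-(Ring.inverse (h t) * deriv h t * Ring.inverse (h t))) t := fun t ht =>
    hasDerivAt_ringInverse (hdF t ht).hasDerivAt (hu t (Ioo_subset_Icc_self ht.1))
  refine ⟨hc, ⟨F, hF, fun t ht => (hd t ht).differentiableAt⟩, ?_⟩
  exact IsPath.congr_integrable hF
    ((hh.integrable.continuousOn_mul hc').mul_continuousOn hc').neg fun t ht => (hd t ht).deriv.symm

variable {t : R →L[ℂ] ℂ}

theorem IsPath.wind_integrable {h : ℝ → R} (hh : IsPath h)
    (hu : ∀ s ∈ Icc (0 : ℝ) 1, IsUnit (h s)) (t : R →L[ℂ] ℂ) :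
    IntervalIntegrable (fun s => t (deriv h s * Ring.inverse (h s))) volume 0 1 := by
  have hc : ContinuousOn (fun s => Ring.inverse (h s)) (uIcc 0 1) := by
    simpa using continuousOn_ringInverse hh.continuousOn hu
  have := hh.integrable.mul_continuousOn hc
  exact ⟨t.integrable_comp this.1, t.integrable_comp this.2⟩

theorem wind_congr_ae {h k : ℝ → R} {t : R →L[ℂ] ℂ} {F : Set ℝ} (hF : F.Countable)
    (e : ∀ s ∈ Ioo (0 : ℝ) 1 \ F,
      t (deriv h s * Ring.inverse (h s)) = t (deriv k s * Ring.inverse (k s))) :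
    wind t h = wind t k :=
  integral_congr_ae (ae_Ioo_diff hF e)

theorem wind_congr {h k : ℝ → R} (t : R →L[ℂ] ℂ) (e : ∀ s ∈ Ioo (0 : ℝ) 1, h s = k s) :
    wind t h = wind t k := by
  refine wind_congr_ae countable_empty fun s hs => ?_
  have : h =ᶠ[nhds s] k := by
    filter_upwards [isOpen_Ioo.mem_nhds hs.1] with x hx using e x hx
  rw [this.deriv_eq, this.eq_of_nhds]

theorem wind_const (a : R) : wind t (fun _ => a) = 0 := by simp [wind]

/-- The product rule gives h' h⁻¹ + h (k' k⁻¹) h⁻¹, and the trace property removes the conjugation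
by h. -/
theorem wind_mul (ht : ∀ a b, t (a * b) = t (b * a)) {h k : ℝ → R} (hh : IsPath h)
    (hk : IsPath k) (hu : ∀ s ∈ Icc (0 : ℝ) 1, IsUnit (h s))
    (ku : ∀ s ∈ Icc (0 : ℝ) 1, IsUnit (k s)) :
    wind t (fun s => h s * k s) = wind t h + wind t k := by
  obtain ⟨F, hF, hdF⟩ := hh.differentiable
  obtain ⟨G, hG, hdG⟩ := hk.differentiable
  rw [wind, wind, wind, ← integral_add (hh.wind_integrable hu t) (hk.wind_integrable ku t)]
  refine integral_congr_ae (ae_Ioo_diff (hF.union hG) fun s hs => ?_)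
  simp only [mem_sdiff, mem_union, not_or] at hs
  have hd := ((hdF s ⟨hs.1, hs.2.1⟩).hasDerivAt.fun_mul (hdG s ⟨hs.1, hs.2.2⟩).hasDerivAt).deriv
  have hus := hu s (Ioo_subset_Icc_self hs.1)
  have kus := ku s (Ioo_subset_Icc_self hs.1)
  have hi : Ring.inverse (h s * k s) = Ring.inverse (k s) * Ring.inverse (h s) := by
    obtain ⟨u, hu⟩ := hus
    obtain ⟨v, hv⟩ := kus
    rw [← hu, ← hv, ← Units.val_mul, Ring.inverse_unit, Ring.inverse_unit, Ring.inverse_unit,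
      mul_inv_rev, Units.val_mul]
  rw [hd, hi, add_mul, map_add, mul_assoc, ← mul_assoc (k s), Ring.mul_inverse_cancel _ kus,
    one_mul, ← mul_assoc (h s * _), ht (h s * _ * _), ← mul_assoc, ← mul_assoc,
    Ring.inverse_mul_cancel _ hus, one_mul]

theorem wind_inverse (ht : ∀ a b, t (a * b) = t (b * a)) {h : ℝ → R} (hh : IsPath h)
    (hu : ∀ s ∈ Icc (0 : ℝ) 1, IsUnit (h s)) :
    wind t (fun s => Ring.inverse (h s)) = - wind t h := by
  have h1 := wind_mul ht hh (hh.inverse hu) hu fun s hs => (hu s hs).ringInverse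
  rw [wind_congr t (k := fun _ => 1) fun s hs =>
    Ring.mul_inverse_cancel _ (hu s (Ioo_subset_Icc_self hs)), wind_const] at h1
  exact (neg_eq_of_add_eq_zero_right h1.symm).symm

theorem wind_map {S : Type*} [NormedRing S] [NormedAlgebra ℂ S] [CompleteSpace S]
    (φ : R →ₐ[ℂ] S) (hφ : Continuous φ) (t' : S →L[ℂ] ℂ) (e : ∀ a, t' (φ a) = t a)
    {h : ℝ → R} (hh : IsPath h) (hu : ∀ s ∈ Icc (0 : ℝ) 1, IsUnit (h s)) :
    wind t' (fun s => φ (h s)) = wind t h := by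
  obtain ⟨F, hF, hdF⟩ := hh.differentiable
  refine integral_congr_ae (ae_Ioo_diff hF fun s hs => ?_)
  have hus := hu s (Ioo_subset_Icc_self hs.1)
  let φ' : R →L[ℝ] S := ⟨φ.toLinearMap.restrictScalars ℝ, hφ⟩
  have hd : deriv (fun s => φ (h s)) s = φ (deriv h s) :=
    IsPath.hasDerivAt_clm (hdF s hs) φ'
  have hi : Ring.inverse (φ (h s)) = φ (Ring.inverse (h s)) := by
    obtain ⟨u, hu⟩ := hus
    rw [← hu, Ring.inverse_unit]
    exact Ring.inverse_unit (Units.map φ.toMonoidHom u)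
  simp only [hd, hi, ← map_mul, e]

/-- Expand h⁻¹ as the geometric series in 1 - h. Under a trace, h' (1 - h)ⁿ is up to a factor the
derivative of (1 - h)ⁿ⁺¹, so each term integrates to zero over a loop. This is the integral of d(log
h), with no logarithm needed. -/
theorem wind_eq_zero_of_ball (ht : ∀ a b, t (a * b) = t (b * a)) {h : ℝ → R} (hh : IsPath h)
    (hb : ∀ s ∈ Icc (0 : ℝ) 1, ‖h s - 1‖ < 1) (hl : h 0 = h 1) : wind t h = 0 := by
  obtain ⟨F, hF, hdF⟩ := hh.differentiable
  -- Compactness gives one radius r < 1 for the whole loop, hence a geometric dominating series.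
  obtain ⟨s₀, hs₀, hmax⟩ := isCompact_Icc.exists_isMaxOn (nonempty_Icc.2 zero_le_one)
    (hh.continuousOn.sub continuousOn_const).norm (s := Icc (0 : ℝ) 1) (f := fun s => ‖h s - 1‖)
  set r := ‖h s₀ - 1‖
  have hr : r < 1 := hb s₀ hs₀
  have hr0 : 0 ≤ r := norm_nonneg _
  have hle : ∀ s ∈ Icc (0 : ℝ) 1, ‖1 - h s‖ ≤ r := fun s hs => by
    rw [norm_sub_rev]; exact hmax hs
  have hk : IsPath fun s => 1 - h s := by
    have := (isPath_const (1 : R)).add (hh.clm_comp (-ContinuousLinearMap.id ℝ R))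
    simpa [sub_eq_add_neg] using this
  have hpow : ∀ n : ℕ, ContinuousOn (fun s => (1 - h s) ^ n) (uIcc 0 1) := fun n => by
    rw [uIcc_of_le zero_le_one]; exact hk.continuousOn.pow n
  have hcomp : ∀ n, IntervalIntegrable (fun s => deriv h s * (1 - h s) ^ n) volume 0 1 :=
    fun n => hh.integrable.mul_continuousOn (hpow n)
  have hint : ∀ n : ℕ, ∫ s in (0 : ℝ)..1, t (deriv h s * (1 - h s) ^ n) = 0 := by
    intro n
    have key : ∫ s in (0 : ℝ)..1, -((n + 1 : ℕ) : ℂ) * t (deriv h s * (1 - h s) ^ n)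
        = t ((1 - h 1) ^ (n + 1)) - t ((1 - h 0) ^ (n + 1)) := by
      refine integral_eq_of_hasDerivAt_off_countable (s := F)
        (fun s => t ((1 - h s) ^ (n + 1))) _ hF ?_ ?_ ?_
      · exact t.continuous.comp_continuousOn (hpow (n + 1))
      · intro s hs
        simp only [zero_le_one, min_eq_left, max_eq_right] at hs
        have hd : HasDerivAt (fun s => 1 - h s) (-deriv h s) s := by
          simpa using (hdF s hs).hasDerivAt.const_sub 1
        -- Since h' and h need not commute, the power rule holds only under `t`; the spare factor
        -- with exponent j is what lets the induction rotate h' past the remaining powers.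
        have h2 : ∀ m : ℕ, ∃ d, HasDerivAt (fun s => (1 - h s) ^ m) d s ∧
            ∀ j, t (d * (1 - h s) ^ j) = -(m : ℂ) * t (deriv h s * (1 - h s) ^ (m + j - 1)) := by
          intro m
          induction m with
          | zero => exact ⟨0, by simpa using hasDerivAt_const s (1 : R), by simp⟩
          | succ m ih =>
            obtain ⟨d, hd1, hd2⟩ := ih
            refine ⟨_, by simpa only [pow_succ] using hd1.fun_mul hd, fun j => ?_⟩
            rw [add_mul, map_add, mul_assoc, ← pow_succ', hd2]
            have : t ((1 - h s) ^ m * -deriv h s * (1 - h s) ^ j) =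
                - t (deriv h s * (1 - h s) ^ (m + j)) := by
              rw [mul_assoc, ht, mul_assoc, ← pow_add, neg_mul, map_neg, add_comm]
            rw [this]
            have e1 : m + (j + 1) - 1 = m + j := by omega
            have e2 : m + 1 + j - 1 = m + j := by omega
            rw [e1, e2]; push_cast; ring
        obtain ⟨d, hd1, hd2⟩ := h2 (n + 1)
        have := (t.restrictScalars ℝ).hasFDerivAt.comp_hasDerivAt s hd1
        have h3 := hd2 0
        simp only [pow_zero, mul_one, add_zero, Nat.add_sub_cancel] at h3
        rw [← h3]
        exact this
      · have h4 : IntervalIntegrable (fun s => t (deriv h s * (1 - h s) ^ n)) volume 0 1 :=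
          ⟨t.integrable_comp (hcomp n).1, t.integrable_comp (hcomp n).2⟩
        exact h4.const_mul _
    rw [intervalIntegral.integral_const_mul, hl, sub_self] at key
    exact (mul_eq_zero.1 key).resolve_left (neg_ne_zero.2 (Nat.cast_ne_zero.2 n.succ_ne_zero))
  have hsum : HasSum (fun n : ℕ => ∫ s in (0 : ℝ)..1, t (deriv h s * (1 - h s) ^ n)) (wind t h) := by
    refine intervalIntegral.hasSum_integral_of_dominated_convergence
      (fun n s => ‖t‖ * ‖deriv h s‖ * ‖(1 : R)‖ * r ^ n) ?_ ?_ ?_ ?_ ?_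
    · intro n
      have : IntervalIntegrable (fun s => t (deriv h s * (1 - h s) ^ n)) volume 0 1 :=
        ⟨t.integrable_comp (hcomp n).1, t.integrable_comp (hcomp n).2⟩
      rw [uIoc_of_le zero_le_one]
      exact this.1.aestronglyMeasurable
    · intro n
      refine ae_Ioo_diff countable_empty fun s hs => ?_
      have h1 : ‖(1 - h s) ^ n‖ ≤ ‖(1 : R)‖ * r ^ n := by
        induction n with
        | zero => simp
        | succ n ih =>
          rw [pow_succ, pow_succ, ← mul_assoc]
          exact (norm_mul_le _ _).trans (mul_le_mul ih (hle s (Ioo_subset_Icc_self hs.1))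
            (norm_nonneg _) (by positivity))
      calc _ ≤ ‖t‖ * (‖deriv h s‖ * ‖(1 - h s) ^ n‖) :=
            (t.le_opNorm _).trans (by gcongr; exact norm_mul_le _ _)
        _ ≤ ‖t‖ * (‖deriv h s‖ * (‖(1 : R)‖ * r ^ n)) := by gcongr
        _ = _ := by ring
    · exact Filter.Eventually.of_forall fun s _ =>
        (summable_geometric_of_lt_one hr0 hr).mul_left _
    · simp_rw [tsum_mul_left]
      exact ((hh.integrable.norm.const_mul _).mul_const _).mul_const _
    · refine ae_Ioo_diff countable_empty fun s hs => ?_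
      have hlt := (hle s (Ioo_subset_Icc_self hs.1)).trans_lt hr
      have h1 := NormedRing.inverse_one_sub (1 - h s) hlt
      rw [sub_sub_cancel] at h1
      rw [h1]
      have h2 : HasSum (fun n : ℕ => (1 - h s) ^ n) (↑(Units.oneSub (1 - h s) hlt)⁻¹ : R) :=
        (summable_geometric_of_norm_lt_one hlt).hasSum
      exact (h2.mul_left (deriv h s)).mapL t
  rw [← hsum.tsum_eq]
  simp [hint]

/-- The quotient h k⁻¹ is a loop in the unit ball around 1, so its winding vanishes. -/
theorem wind_eq_of_close (ht : ∀ a b, t (a * b) = t (b * a)) {h k : ℝ → R} (hh : IsPath h)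
    (hk : IsPath k) (hu : ∀ s ∈ Icc (0 : ℝ) 1, IsUnit (h s))
    (ku : ∀ s ∈ Icc (0 : ℝ) 1, IsUnit (k s))
    (hb : ∀ s ∈ Icc (0 : ℝ) 1, ‖h s * Ring.inverse (k s) - 1‖ < 1)
    (hl : h 0 * Ring.inverse (k 0) = h 1 * Ring.inverse (k 1)) : wind t h = wind t k := by
  have h1 := wind_mul ht hh (hk.inverse ku) hu fun s hs => (ku s hs).ringInverse
  rw [wind_inverse ht hk ku, wind_eq_zero_of_ball ht (hh.mul (hk.inverse ku)) hb hl] at h1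
  exact (add_neg_eq_zero.1 h1.symm)

end Paths

end ZTwoUHF

end

noncomputable section

namespace ZTwoUHF

open MeasureTheory Set intervalIntegral

/-! ### Concatenation of paths -/

section Concatenation

variable {R : Type*} [NormedRing R] [NormedAlgebra ℂ R]

/-- Concatenation of paths. -/
def concat (f g : ℝ → R) (s : ℝ) : R := if s ≤ 1 / 2 then f (2 * s) else g (2 * s - 1)

theorem concat_of_le (f g : ℝ → R) {s : ℝ} (hs : s ≤ 1 / 2) : concat f g s = f (2 * s) :=
  if_pos hs

theorem concat_of_ge {f g : ℝ → R} (e : f 1 = g 0) {s : ℝ} (hs : 1 / 2 ≤ s) :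
    concat f g s = g (2 * s - 1) := by
  rcases hs.eq_or_lt with rfl | hs
  · rw [concat_of_le _ _ le_rfl]; norm_num [e]
  · exact if_neg (not_le.2 hs)

theorem concat_cases {f g : ℝ → R} (e : f 1 = g 0) {P : R → Prop}
    (hf : ∀ s ∈ Icc (0 : ℝ) 1, P (f s)) (hg : ∀ s ∈ Icc (0 : ℝ) 1, P (g s)) :
    ∀ s ∈ Icc (0 : ℝ) 1, P (concat f g s) := by
  intro s hs
  rcases le_total s (1 / 2) with h | h
  · rw [concat_of_le _ _ h]; exact hf _ ⟨by linarith [hs.1], by linarith⟩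
  · rw [concat_of_ge e h]; exact hg _ ⟨by linarith, by linarith [hs.2]⟩

theorem concat_eventuallyEq_left (f g : ℝ → R) {s : ℝ} (hs : s < 1 / 2) :
    concat f g =ᶠ[nhds s] fun x => f (2 * x) := by
  filter_upwards [Iio_mem_nhds hs] with x hx using concat_of_le _ _ (le_of_lt hx)

theorem concat_eventuallyEq_right (f g : ℝ → R) {s : ℝ} (hs : 1 / 2 < s) :
    concat f g =ᶠ[nhds s] fun x => g (2 * x - 1) := by
  filter_upwards [Ioi_mem_nhds hs] with x hx using if_neg (not_le.2 hx)

theorem deriv_concat_left (f g : ℝ → R) {s : ℝ} (hs : s < 1 / 2) :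
    deriv (concat f g) s = (2 : ℝ) • deriv f (2 * s) := by
  rw [(concat_eventuallyEq_left f g hs).deriv_eq, deriv_comp_mul_left]

theorem deriv_concat_right (f g : ℝ → R) {s : ℝ} (hs : 1 / 2 < s) :
    deriv (concat f g) s = (2 : ℝ) • deriv g (2 * s - 1) := by
  rw [(concat_eventuallyEq_right f g hs).deriv_eq,
    deriv_comp_mul_left 2 (fun x => g (x - 1)) s, deriv_comp_sub_const]

theorem ae_uIoc_left {P : ℝ → Prop} (h : ∀ s : ℝ, s < 1 / 2 → P s) :
    ∀ᵐ s ∂(volume : Measure ℝ), s ∈ uIoc (0 : ℝ) (1 / 2) → P s := by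
  have h2 : ∀ᵐ s ∂(volume : Measure ℝ), s ∉ ({1 / 2} : Set ℝ) := (countable_singleton _).ae_notMem _
  filter_upwards [h2] with s h2 hs
  rw [uIoc_of_le (by norm_num)] at hs
  exact h s (lt_of_le_of_ne hs.2 h2)

theorem ae_uIoc_right {P : ℝ → Prop} (h : ∀ s : ℝ, 1 / 2 < s → P s) :
    ∀ᵐ s ∂(volume : Measure ℝ), s ∈ uIoc (1 / 2 : ℝ) 1 → P s := by
  refine Filter.Eventually.of_forall fun s hs => ?_
  rw [uIoc_of_le (by norm_num)] at hs
  exact h s hs.1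

theorem intervalIntegrable_comp_left {E : Type*} [NormedAddCommGroup E] {f : ℝ → E}
    (hf : IntervalIntegrable f volume 0 1) :
    IntervalIntegrable (fun s => f (2 * s)) volume 0 (1 / 2) := by
  simpa using hf.comp_mul_left (c := 2)

theorem intervalIntegrable_comp_right {E : Type*} [NormedAddCommGroup E] {f : ℝ → E}
    (hf : IntervalIntegrable f volume 0 1) :
    IntervalIntegrable (fun s => f (2 * s - 1)) volume (1 / 2) 1 := by
  have := (hf.comp_sub_right 1).comp_mul_left (c := 2)
  norm_num at this
  simpa using this

theorem IsPath.concat {f g : ℝ → R} (hf : IsPath f) (hg : IsPath g) (e : f 1 = g 0) :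
    IsPath (concat f g) := by
  obtain ⟨F, hF, hdF⟩ := hf.differentiable
  obtain ⟨G, hG, hdG⟩ := hg.differentiable
  refine ⟨?_, ⟨(fun s => 2 * s) ⁻¹' F ∪ (fun s => 2 * s - 1) ⁻¹' G ∪ {1 / 2}, ?_, ?_⟩, ?_⟩
  · have h1 : ContinuousOn (ZTwoUHF.concat f g) (Icc 0 (1 / 2)) := by
      have : ContinuousOn (fun s => f (2 * s)) (Icc 0 (1 / 2)) :=
        hf.continuousOn.comp (by fun_prop) fun s hs => ⟨by linarith [hs.1], by linarith [hs.2]⟩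
      exact this.congr fun s hs => concat_of_le _ _ hs.2
    have h2 : ContinuousOn (ZTwoUHF.concat f g) (Icc (1 / 2) 1) := by
      have : ContinuousOn (fun s => g (2 * s - 1)) (Icc (1 / 2) 1) :=
        hg.continuousOn.comp (by fun_prop) fun s hs => ⟨by linarith [hs.1], by linarith [hs.2]⟩
      exact this.congr fun s hs => concat_of_ge e hs.1
    have := h1.union_of_isClosed h2 isClosed_Icc isClosed_Icc
    rwa [Icc_union_Icc_eq_Icc (by norm_num) (by norm_num)] at this
  · refine ((hF.preimage fun a b h => ?_).union (hG.preimage fun a b h => ?_)).union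
      (countable_singleton _)
    · simpa using h
    · simpa using h
  · intro s hs
    simp only [mem_sdiff, mem_union, mem_preimage, mem_singleton_iff, not_or] at hs
    obtain ⟨hs1, ⟨hsF, hsG⟩, hs2⟩ := hs
    rcases lt_or_gt_of_ne hs2 with h | h
    · refine ((concat_eventuallyEq_left f g h).differentiableAt_iff).2 ?_
      exact (hdF (2 * s) ⟨⟨by linarith [hs1.1], by linarith⟩, hsF⟩).comp s (by fun_prop)
    · refine ((concat_eventuallyEq_right f g h).differentiableAt_iff).2 ?_
      exact (hdG (2 * s - 1) ⟨⟨by linarith, by linarith [hs1.2]⟩, hsG⟩).comp s (by fun_prop)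
  · have h1 : IntervalIntegrable (deriv (ZTwoUHF.concat f g)) volume 0 (1 / 2) := by
      refine ((intervalIntegrable_comp_left hf.integrable).smul (2 : ℝ)).congr_ae ?_
      rw [Filter.EventuallyEq, ae_restrict_iff' measurableSet_uIoc]
      exact ae_uIoc_left fun s hs => (deriv_concat_left f g hs).symm
    have h2 : IntervalIntegrable (deriv (ZTwoUHF.concat f g)) volume (1 / 2) 1 := by
      refine ((intervalIntegrable_comp_right hg.integrable).smul (2 : ℝ)).congr_ae ?_
      rw [Filter.EventuallyEq, ae_restrict_iff' measurableSet_uIoc]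
      exact ae_uIoc_right fun s hs => (deriv_concat_right f g hs).symm
    exact h1.trans h2

theorem wind_concat [CompleteSpace R] (t : R →L[ℂ] ℂ) {f g : ℝ → R} (hf : IsPath f)
    (hg : IsPath g) (e : f 1 = g 0) (fu : ∀ s ∈ Icc (0 : ℝ) 1, IsUnit (f s))
    (gu : ∀ s ∈ Icc (0 : ℝ) 1, IsUnit (g s)) :
    wind t (concat f g) = wind t f + wind t g := by
  have hi := (hf.concat hg e).wind_integrable (concat_cases e fu gu) t
  have hm : (1 / 2 : ℝ) ∈ uIcc (0 : ℝ) 1 := by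
    rw [uIcc_of_le zero_le_one]; constructor <;> norm_num
  rw [wind, ← integral_add_adjacent_intervals
    (hi.mono_set (uIcc_subset_uIcc_left hm)) (hi.mono_set (uIcc_subset_uIcc_right hm))]
  congr 1
  · have : ∀ᵐ s ∂(volume : Measure ℝ), s ∈ uIoc (0 : ℝ) (1 / 2) →
        t (deriv (concat f g) s * Ring.inverse (concat f g s)) =
        (2 : ℝ) • t (deriv f (2 * s) * Ring.inverse (f (2 * s))) := ae_uIoc_left fun s hs => by
      rw [deriv_concat_left f g hs, concat_of_le _ _ hs.le, smul_mul_assoc]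
      exact (t.restrictScalars ℝ).map_smul 2 _
    rw [integral_congr_ae this, intervalIntegral.integral_smul,
      intervalIntegral.integral_comp_mul_left
        (fun s => t (deriv f s * Ring.inverse (f s))) (two_ne_zero' ℝ), smul_smul]
    norm_num [wind]
  · have : ∀ᵐ s ∂(volume : Measure ℝ), s ∈ uIoc (1 / 2 : ℝ) 1 →
        t (deriv (concat f g) s * Ring.inverse (concat f g s)) =
        (2 : ℝ) • t (deriv g (2 * s - 1) * Ring.inverse (g (2 * s - 1))) :=
      ae_uIoc_right fun s hs => by
        rw [deriv_concat_right f g hs, concat_of_ge e hs.le, smul_mul_assoc]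
        exact (t.restrictScalars ℝ).map_smul 2 _
    rw [integral_congr_ae this, intervalIntegral.integral_smul,
      intervalIntegral.integral_comp_mul_sub
        (fun s => t (deriv g s * Ring.inverse (g s))) (two_ne_zero' ℝ), smul_smul]
    norm_num [wind]

end Concatenation

end ZTwoUHF

end

noncomputable section

namespace ZTwoUHF

open MeasureTheory Set intervalIntegral

/-! ### Integrality of windings of loops -/

section Integrality

open Polynomial in
-- The derivative is identified along each line through 1 by differentiating the polynomial det(1 +
-- X M).
theorem exists_hasFDerivAt_det_one (N : ℕ) : ∃ L : (Fin N → Fin N → ℂ) →L[ℂ] ℂ,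
    HasFDerivAt (𝕜 := ℂ) (fun x : Fin N → Fin N → ℂ => (Matrix.of x).det) L
      (fun i j => (1 : Matrix (Fin N) (Fin N) ℂ) i j) ∧
    ∀ x, L x = (Matrix.of x).trace := by
  have hd : DifferentiableAt ℂ (fun x : Fin N → Fin N → ℂ => (Matrix.of x).det)
      (fun i j => (1 : Matrix (Fin N) (Fin N) ℂ) i j) := by
    simp only [Matrix.det_apply, Matrix.of_apply]
    fun_prop
  refine ⟨_, hd.hasFDerivAt, fun x => ?_⟩
  have h1 : HasDerivAt (fun s : ℂ => (fun i j => (1 : Matrix (Fin N) (Fin N) ℂ) i j) + s • x)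
      x 0 := by
    simpa using ((hasDerivAt_id (0 : ℂ)).smul_const x).const_add
      (fun i j => (1 : Matrix (Fin N) (Fin N) ℂ) i j)
  have h2 := HasFDerivAt.comp_hasDerivAt (𝕜 := ℂ) (x := (0 : ℂ))
    (l := fun x : Fin N → Fin N → ℂ => (Matrix.of x).det) (by simpa using hd.hasFDerivAt) h1
  have h3 : HasDerivAt (fun s : ℂ =>
      ((1 + (X : ℂ[X]) • (Matrix.of x).map C).det).eval s) (Matrix.of x).trace 0 := by
    rw [← Matrix.derivative_det_one_add_X_smul]
    exact Polynomial.hasDerivAt _ _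
  refine h2.unique (h3.congr_of_eventuallyEq (Filter.Eventually.of_forall fun s => ?_))
  simp only [Function.comp]
  rw [← Polynomial.coe_evalRingHom, RingHom.map_det]
  congr 1
  ext i j
  by_cases h : i = j <;> simp [Matrix.one_apply, h] <;> exact mul_comm _ _

/-- Jacobi's formula. -/
theorem hasDerivAt_det {N : ℕ} {M : ℝ → Matrix (Fin N) (Fin N) ℂ} {M' P : Matrix (Fin N) (Fin N) ℂ}
    {s : ℝ} (hM : ∀ i j, HasDerivAt (fun x => M x i j) (M' i j) s) (hP : M s * P = 1) :
    HasDerivAt (fun x => (M x).det) ((M s).det * (P * M').trace) s := by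
  obtain ⟨L, hL, hLt⟩ := exists_hasFDerivAt_det_one N
  have hP' : P * M s = 1 := mul_eq_one_comm.1 hP
  -- Multiplying by P = M(s)⁻¹ makes the path pass through 1 at time s, where the derivative of the
  -- determinant is known.
  have h1 : HasDerivAt (fun x => (fun i j => (P * M x) i j)) (fun i j => (P * M') i j) s := by
    rw [hasDerivAt_pi]; intro i
    rw [hasDerivAt_pi]; intro j
    simp only [Matrix.mul_apply]
    exact HasDerivAt.fun_sum fun k _ => (hM k j).const_mul _
  have h2 := HasFDerivAt.comp_hasDerivAt (𝕜 := ℝ) (x := s)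
    (l := fun x : Fin N → Fin N → ℂ => (Matrix.of x).det) (l' := L.restrictScalars ℝ)
    (by rw [hP']; exact hL.restrictScalars ℝ) h1
  have h3 := h2.const_mul (M s).det
  have e : (fun x => (M x).det) = fun x => (M s).det * (P * M x).det := by
    funext x
    rw [← Matrix.det_mul, ← mul_assoc, hP, one_mul]
  have e2 : (P * M').trace = L (fun i j => (P * M') i j) := (hLt _).symm
  rw [e, e2]
  exact h3

variable {R : Type*} [NormedRing R] [NormedAlgebra ℂ R]

/-- Left multiplication by d is injective on D, hence surjective, so the inverse taken in the
ambient ring lies in D. -/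
theorem exists_inverse_of_finiteDimensional (D : Subalgebra ℂ R) [FiniteDimensional ℂ D] (d : D)
    (hd : IsUnit (d : R)) : ∃ e : D, d * e = 1 ∧ (e : R) = Ring.inverse (d : R) := by
  have hinj : Function.Injective (LinearMap.mulLeft ℂ d) := fun x y h => by
    have h' : (d : R) * x = d * y := congrArg Subtype.val h
    exact Subtype.ext (hd.mul_left_cancel h')
  obtain ⟨e, he⟩ := LinearMap.surjective_of_injective hinj 1
  refine ⟨e, he, ?_⟩
  have he' : (d : R) * e = 1 := congrArg Subtype.val he
  rw [← one_mul (e : R), ← Ring.inverse_mul_cancel _ hd, mul_assoc, he', mul_one]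

variable [CompleteSpace R] {t : R →L[ℂ] ℂ}

/-- By Jacobi's formula the integrand is c times the logarithmic derivative of det(ψ(k)), a closed
curve in ℂ ∖ {0}, whose winding is an integer. -/
theorem wind_of_subalgebra (D : Subalgebra ℂ R) [FiniteDimensional ℂ D] {N : ℕ}
    (ψ : D →ₐ[ℂ] Matrix (Fin N) (Fin N) ℂ) (c : ℂ) (hψ : ∀ d : D, t d = c * (ψ d).trace)
    {k : ℝ → R} (hk : ContDiff ℝ 1 k) (hD : ∀ s, k s ∈ D)
    (ku : ∀ s ∈ Icc (0 : ℝ) 1, IsUnit (k s)) (hl : k 0 = k 1) :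
    ∃ m : ℤ, wind t k = 2 * Real.pi * Complex.I * (c * m) := by
  have hclosed : IsClosed (D : Set R) := (Subalgebra.toSubmodule D).closed_of_finiteDimensional
  have hD' : ∀ s, deriv k s ∈ D := fun s => by
    have h1 := (hk.differentiable one_ne_zero s).hasDerivAt.hasDerivWithinAt (s := univ)
    have := hasDerivAt_iff_tendsto_slope.1 (hk.differentiable one_ne_zero s).hasDerivAt
    refine hclosed.mem_of_tendsto this (Filter.Eventually.of_forall fun x => ?_)
    have h2 : k x - k s ∈ D := D.sub_mem (hD x) (hD s)
    have h3 : slope k s x = (((x - s)⁻¹ : ℝ) : ℂ) • (k x - k s) := by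
      rw [slope_def_module]; exact (Complex.coe_smul _ _).symm
    rw [SetLike.mem_coe, h3]
    exact D.smul_mem h2 _
  choose! e he1 he2 using fun s (hs : s ∈ Icc (0 : ℝ) 1) =>
    exists_inverse_of_finiteDimensional D ⟨k s, hD s⟩ (ku s hs)
  let κ : ℝ → D := fun s => ⟨k s, hD s⟩
  let κ' : ℝ → D := fun s => ⟨deriv k s, hD' s⟩
  have hκ : ∀ s, HasDerivAt κ (κ' s) s := fun s => by
    rw [hasDerivAt_iff_tendsto_slope]
    rw [tendsto_subtype_rng]
    exact hasDerivAt_iff_tendsto_slope.1 (hk.differentiable one_ne_zero s).hasDerivAt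
  let y : ℝ → ℂ := fun s => (ψ (κ s)).det
  let g : ℝ → ℂ := fun s => (ψ (κ' s * e s)).trace
  have hy : ∀ s ∈ Icc (0 : ℝ) 1, HasDerivAt y (y s * g s) s := fun s hs => by
    have h1 : ∀ i j, HasDerivAt (fun x => ψ (κ x) i j) (ψ (κ' s) i j) s := fun i j => by
      let φ : D →ₗ[ℂ] ℂ := (LinearMap.proj j).comp ((LinearMap.proj i).comp ψ.toLinearMap)
      exact ((LinearMap.toContinuousLinearMap φ).restrictScalars ℝ).hasFDerivAt.comp_hasDerivAt s
        (hκ s)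
    have h2 := hasDerivAt_det h1 (P := ψ (e s)) (by rw [← map_mul, he1 s hs, map_one])
    have h3 : g s = (ψ (e s) * ψ (κ' s)).trace := by
      simp only [g, map_mul]; exact Matrix.trace_mul_comm _ _
    rw [h3]; exact h2
  have hwg : wind t k = c * ∫ s in (0 : ℝ)..1, g s := by
    rw [wind, ← intervalIntegral.integral_const_mul]
    refine integral_congr fun s hs => ?_
    rw [uIcc_of_le zero_le_one] at hs
    simp only [g]
    rw [← hψ, ← he2 s hs]; rfl
  have hgc : ContinuousOn g (Icc 0 1) := by
    have h1 : ContinuousOn (fun s => κ' s * e s) (Icc 0 1) := by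
      rw [Topology.IsInducing.subtypeVal.continuousOn_iff]
      refine ((hk.continuous_deriv le_rfl).continuousOn.mul
        (continuousOn_ringInverse hk.continuous.continuousOn ku)).congr fun s hs => ?_
      change deriv k s * (e s : R) = deriv k s * Ring.inverse (k s)
      rw [he2 s hs]
    have h2 : Continuous ((Matrix.traceLinearMap (Fin N) ℂ ℂ).comp ψ.toLinearMap) :=
      LinearMap.continuous_of_finiteDimensional _
    exact h2.comp_continuousOn h1
  have hgi : IntervalIntegrable g volume 0 1 := by
    apply ContinuousOn.intervalIntegrable; rwa [uIcc_of_le zero_le_one]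
  -- This primitive plays the part of log y: exp(-ℓ) y has zero derivative, and y 0 = y 1 ≠ 0 forces
  -- exp(ℓ 1) = 1.
  let ℓ : ℝ → ℂ := fun s => ∫ x in (0 : ℝ)..s, g x
  have hℓ : ∀ s ∈ Ioo (0 : ℝ) 1, HasDerivAt ℓ (g s) s := fun s hs => by
    refine integral_hasDerivAt_right (hgi.mono_set ?_) ?_ ?_
    · rw [uIcc_of_le hs.1.le, uIcc_of_le zero_le_one]; exact Icc_subset_Icc_right hs.2.le
    · exact (hgc.mono Ioo_subset_Icc_self).stronglyMeasurableAtFilter isOpen_Ioo s hs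
    · exact hgc.continuousAt (Icc_mem_nhds hs.1 hs.2)
  have hℓc : ContinuousOn ℓ (uIcc 0 1) := continuousOn_primitive_interval' hgi (by simp)
  have hconst := integral_eq_of_hasDerivAt_off_countable (fun s => Complex.exp (-ℓ s) * y s)
    (fun _ => 0) (a := 0) (b := 1) countable_empty
    ((Complex.continuous_exp.comp_continuousOn hℓc.neg).mul fun s hs =>
      (hy s (by rwa [uIcc_of_le zero_le_one] at hs)).continuousAt.continuousWithinAt)
    (fun s hs => by
      simp only [zero_le_one, min_eq_left, max_eq_right, sdiff_empty] at hs
      have := (hℓ s hs).fun_neg.cexp.fun_mul (hy s (Ioo_subset_Icc_self hs))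
      exact this.congr_deriv (by ring)) (by simp)
  have hy01 : y 0 = y 1 := by simp only [y, κ, hl]
  have hy1 : y 1 ≠ 0 := by
    have h1 := congrArg Matrix.det (congrArg ψ (he1 1 (by simp)))
    rw [map_mul, Matrix.det_mul, map_one, Matrix.det_one] at h1
    exact left_ne_zero_of_mul_eq_one h1
  have hℓ0 : ℓ 0 = 0 := integral_same
  have hexp : Complex.exp (ℓ 1) = 1 := by
    simp only [intervalIntegral.integral_zero, hℓ0, hy01, neg_zero, Complex.exp_zero] at hconst
    have h1 : Complex.exp (-ℓ 1) = 1 := by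
      have : (Complex.exp (-ℓ 1) - 1) * y 1 = 0 := by rw [sub_mul]; exact hconst.symm
      exact sub_eq_zero.1 ((mul_eq_zero.1 this).resolve_right hy1)
    rw [Complex.exp_neg] at h1
    simpa using h1
  obtain ⟨m, hm⟩ := Complex.exp_eq_one_iff.1 hexp
  refine ⟨m, ?_⟩
  rw [hwg]
  change c * ℓ 1 = _
  rw [hm]; ring

open scoped unitInterval in
/-- Winding numbers of loops of units, in an algebra approximated by matrix algebras. -/
theorem wind_of_dense (ht : ∀ a b, t (a * b) = t (b * a)) (D : ℕ → Subalgebra ℂ R)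
    (hmono : Monotone D) (hfin : ∀ n, FiniteDimensional ℂ (D n))
    (hdense : Dense (⋃ n, (D n : Set R))) (N : ℕ → ℕ)
    (ψ : ∀ n, D n →ₐ[ℂ] Matrix (Fin (N n)) (Fin (N n)) ℂ) (c : ℕ → ℂ)
    (hψ : ∀ n, ∀ d : D n, t d = c n * (ψ n d).trace) {h : ℝ → R} (hh : IsPath h)
    (hu : ∀ s ∈ Icc (0 : ℝ) 1, IsUnit (h s)) (hl : h 0 = h 1) :
    ∃ (n : ℕ) (m : ℤ), wind t h = 2 * Real.pi * Complex.I * (c n * m) := by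
  have hic := continuousOn_ringInverse hh.continuousOn hu
  obtain ⟨M, hM⟩ := isCompact_Icc.exists_bound_of_continuousOn hic
  have hM0 : 0 ≤ M := (norm_nonneg _).trans (hM 0 (by simp))
  -- With M bounding the inverses of h, an approximation of h within 2ε has k h⁻¹ within M / (M + 1)
  -- < 1 of 1.
  set ε : ℝ := 1 / (2 * (M + 1)) with hε
  have hε0 : 0 < ε := by positivity
  let f : C(I, R) := ⟨fun x => h x, continuousOn_iff_continuous_domRestrict.1 hh.continuousOn⟩
  have hB := bernsteinApproximation_uniform f
  rw [Metric.tendsto_atTop] at hB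
  obtain ⟨n₀, hn₀⟩ := hB ε hε0
  -- A positive degree makes the nodes j / n run from 0 to 1.
  set n := n₀ + 1
  have hBn := hn₀ n (Nat.le_succ _)
  have happ : ∀ r : R, ∃ d : R, ‖d - r‖ < ε ∧ ∃ m, d ∈ D m := fun r => by
    obtain ⟨d, hd, hdr⟩ := Metric.dense_iff.1 hdense r ε hε0
    rw [mem_iUnion] at hdr
    exact ⟨d, by simpa [dist_eq_norm] using hd, hdr⟩
  choose a ha m hm using happ
  let x : Fin (n + 1) → I := fun j => bernstein.z j
  let K := Finset.univ.sup fun j => m (f (x j))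
  have hK : ∀ j, a (f (x j)) ∈ D K := fun j =>
    hmono (Finset.le_sup (f := fun j => m (f (x j))) (Finset.mem_univ j)) (hm _)
  -- The Bernstein polynomial of h with its sample values replaced by elements of a common D K. It
  -- equals the first and last sample at the endpoints; these are the same element since h 0 = h 1,
  -- so k is again a loop.
  let k : ℝ → R := fun s => ∑ j : Fin (n + 1), (bernsteinPolynomial ℝ n j).eval s • a (f (x j))
  have hkI : ∀ s : I, k s = ∑ j : Fin (n + 1), bernstein n j s • a (f (x j)) := fun s => rfl
  have hkc : ContDiff ℝ 1 k := by
    refine ContDiff.sum fun j _ => ?_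
    have hp : ContDiff ℝ 1 fun s : ℝ => (bernsteinPolynomial ℝ n j).eval s := by
      simpa [Polynomial.coe_aeval_eq_eval] using
        Polynomial.contDiff_aeval (𝕜 := ℝ) (bernsteinPolynomial ℝ n j) 1
    exact hp.smul contDiff_const
  have hclose : ∀ s ∈ Icc (0 : ℝ) 1, ‖k s - h s‖ < 2 * ε := fun s hs => by
    have h1 : ‖bernsteinApproximation n f ⟨s, hs⟩ - f ⟨s, hs⟩‖ < ε := by
      have := (ContinuousMap.dist_lt_iff hε0).1 hBn ⟨s, hs⟩
      rwa [dist_eq_norm] at this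
    have h2 : ‖k s - bernsteinApproximation n f ⟨s, hs⟩‖ ≤ ε := by
      rw [bernsteinApproximation.apply, hkI ⟨s, hs⟩, ← Finset.sum_sub_distrib]
      calc _ ≤ ∑ j : Fin (n + 1), bernstein n j ⟨s, hs⟩ * ε := by
            refine norm_sum_le_of_le _ fun j _ => ?_
            rw [← smul_sub, norm_smul, Real.norm_of_nonneg bernstein_nonneg]
            exact mul_le_mul_of_nonneg_left (ha _).le bernstein_nonneg
        _ = ε := by rw [← Finset.sum_mul, bernstein.probability, one_mul]
    calc _ = ‖(k s - bernsteinApproximation n f ⟨s, hs⟩) +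
          (bernsteinApproximation n f ⟨s, hs⟩ - f ⟨s, hs⟩)‖ := by
            rw [sub_add_sub_cancel]; rfl
      _ < ε + ε := (norm_add_le _ _).trans_lt (add_lt_add_of_le_of_lt h2 h1)
      _ = 2 * ε := by ring
  have hball : ∀ s ∈ Icc (0 : ℝ) 1, ‖k s * Ring.inverse (h s) - 1‖ < 1 := fun s hs => by
    rw [← Ring.mul_inverse_cancel _ (hu s hs), ← sub_mul]
    calc _ ≤ ‖k s - h s‖ * ‖Ring.inverse (h s)‖ := norm_mul_le _ _
      _ ≤ 2 * ε * M := mul_le_mul (hclose s hs).le (hM s hs) (norm_nonneg _) (by positivity)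
      _ = M / (M + 1) := by rw [hε]; field_simp
      _ < 1 := by rw [div_lt_one (by positivity)]; linarith
  have ku : ∀ s ∈ Icc (0 : ℝ) 1, IsUnit (k s) := fun s hs => by
    have h1 : IsUnit (k s * Ring.inverse (h s)) := by
      have := isUnit_one_sub_of_norm_lt_one (x := 1 - k s * Ring.inverse (h s))
        (by rw [norm_sub_rev]; exact hball s hs)
      rwa [sub_sub_cancel] at this
    have h2 := h1.mul (hu s hs)
    rwa [mul_assoc, Ring.inverse_mul_cancel _ (hu s hs), mul_one] at h2
  have hkf : k 0 = a (h 0) ∧ k 1 = a (h 1) := by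
    have h0 := hkI 0
    have h1 := hkI 1
    constructor
    · rw [show k 0 = k (0 : I) by simp, hkI 0]
      simp [Fin.sum_univ_succ, bernstein_apply, x]; rfl
    · rw [show k 1 = k (1 : I) by simp, hkI 1]
      simp [Fin.sum_univ_castSucc, bernstein_apply, x, Nat.sub_eq_zero_iff_le, n]; rfl
  have hkl : k 0 = k 1 := by rw [hkf.1, hkf.2, hl]
  have hkD : ∀ s, k s ∈ D K := fun s => by
    refine Subalgebra.sum_mem _ fun j _ => ?_
    rw [← Complex.coe_smul]
    exact (D K).smul_mem (hK j) _
  have := hfin K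
  obtain ⟨m, hm⟩ := wind_of_subalgebra (D K) (ψ K) (c K) (hψ K) hkc hkD ku hkl
  refine ⟨K, m, ?_⟩
  rw [← hm]
  exact (wind_eq_of_close ht (.of_contDiff hkc) hh ku hu hball (by rw [hkl, hl])).symm

end Integrality

end ZTwoUHF

end

noncomputable section

namespace ZTwoUHF

open Set Filter Topology

/-! ### Tracial functionals on matrix algebras -/

section MatrixTrace

/-- A tracial functional is constant on the diagonal matrix units and kills the off-diagonal ones,
because e_ij = e_ii e_ij while e_ij e_ii = 0. -/
theorem trace_unique {n : ℕ} (f : Matrix (Fin n) (Fin n) ℂ →ₗ[ℂ] ℂ)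
    (hf : ∀ a b, f (a * b) = f (b * a)) (x : Matrix (Fin n) (Fin n) ℂ) :
    n * f x = f 1 * x.trace := by
  have h1 : ∀ i j : Fin n, f (Matrix.single i i 1) = f (Matrix.single j j 1) := fun i j => by
    have := hf (Matrix.single i j 1) (Matrix.single j i 1)
    simpa using this
  have h2 : ∀ i j : Fin n, i ≠ j → f (Matrix.single i j 1) = 0 := fun i j hij => by
    have := hf (Matrix.single i i 1) (Matrix.single i j 1)
    rw [Matrix.single_mul_single_same, Matrix.single_mul_single_of_ne _ _ _ _ hij.symm] at this
    simpa using this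
  have h3 : ∀ j : Fin n, f 1 = n * f (Matrix.single j j 1) := fun j => by
    have : (1 : Matrix (Fin n) (Fin n) ℂ) = ∑ i, Matrix.single i i 1 := by
      rw [Matrix.sum_single_one]
    rw [this, map_sum, Finset.sum_congr rfl fun i _ => h1 i j]
    simp
  conv_lhs => rw [Matrix.matrix_eq_sum_single x]
  simp only [map_sum]
  have h4 : ∀ i j, f (Matrix.single i j (x i j)) = if i = j then x i i * f (Matrix.single i i 1)
      else 0 := fun i j => by
    have : Matrix.single i j (x i j) = x i j • Matrix.single i j (1 : ℂ) := by simp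
    rw [this, map_smul]
    split_ifs with h
    · rw [h]; rfl
    · rw [h2 i j h, smul_zero]
  simp only [h4, Finset.sum_ite_eq, Finset.mem_univ, if_true, Matrix.trace, Finset.mul_sum,
    Matrix.diag_apply]
  refine Finset.sum_congr rfl fun i _ => ?_
  rw [h3 i]; ring

theorem trace_star_mul_self_nonneg {n : ℕ} (x : Matrix (Fin n) (Fin n) ℂ) :
    0 ≤ (star x * x).trace :=
  (Matrix.posSemidef_conjTranspose_mul_self x).trace_nonneg

end MatrixTrace

/-! ### Positive functionals on C⋆-algebras -/

section Positive

variable {B : Type*} [CStarAlgebra B]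

/-- The element ‖a‖ - a is positive, hence of the form c⋆c. -/
theorem apply_selfAdjoint_of_positive (f : B →ₗ[ℂ] ℂ) (h1 : f 1 = 1)
    (hf : ∀ a, 0 ≤ f (star a * a)) (a : B) (ha : IsSelfAdjoint a) :
    (f a).im = 0 ∧ (f a).re ≤ ‖a‖ := by
  let _ := CStarAlgebra.spectralOrder B
  let _ := CStarAlgebra.spectralOrderedRing B
  have hpos : ∀ a : B, 0 ≤ a → 0 ≤ f a := fun a ha => by
    obtain ⟨c, rfl⟩ := CStarAlgebra.nonneg_iff_eq_star_mul_self.1 ha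
    exact hf c
  have hal : ∀ r : ℝ, f (algebraMap ℝ B r) = r := fun r => by
    rw [Algebra.algebraMap_eq_smul_one, ← Complex.coe_smul, map_smul, h1, smul_eq_mul, mul_one]
  have h2 := hpos _ (sub_nonneg.2 ha.le_algebraMap_norm_self)
  rw [map_sub, hal, Complex.nonneg_iff] at h2
  simp only [Complex.sub_re, Complex.ofReal_re, Complex.sub_im, Complex.ofReal_im] at h2
  exact ⟨by linarith [h2.2], by linarith [h2.1]⟩

theorem map_star_of_positive (f : B →ₗ[ℂ] ℂ) (h1 : f 1 = 1) (hf : ∀ a, 0 ≤ f (star a * a)) (a : B) :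
    f (star a) = star (f a) := by
  have hr : ∀ x : selfAdjoint B, f x = ((f x).re : ℂ) := fun x =>
    Complex.ext rfl (apply_selfAdjoint_of_positive f h1 hf x x.2).1
  rw [← realPart_add_I_smul_imaginaryPart a]
  simp only [map_add, map_smul, star_add, star_smul, smul_eq_mul, selfAdjoint.star_val_eq]
  rw [hr (realPart a), hr (imaginaryPart a)]
  simp

/-- Multiplying a by a phase makes f a real and nonnegative; then only the self-adjoint real part of
a contributes. -/
theorem norm_le_of_positive (f : B →ₗ[ℂ] ℂ) (h1 : f 1 = 1) (hf : ∀ a, 0 ≤ f (star a * a)) (a : B) :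
    ‖f a‖ ≤ ‖a‖ := by
  have hsa := apply_selfAdjoint_of_positive f h1 hf
  obtain ⟨c, hc, hca⟩ : ∃ c : ℂ, ‖c‖ = 1 ∧ c * f a = ‖f a‖ := by
    by_cases h0 : f a = 0
    · exact ⟨1, by simp, by simp [h0]⟩
    · refine ⟨‖f a‖ / f a, ?_, by field_simp⟩
      rw [norm_div, Complex.norm_real, norm_norm, div_self (norm_ne_zero_iff.2 h0)]
  set x := c • a
  have hx : f x = ‖f a‖ := by rw [map_smul, smul_eq_mul, hca]
  have hxa : ‖x‖ = ‖a‖ := by rw [norm_smul, hc, one_mul]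
  have hd := realPart_add_I_smul_imaginaryPart x
  have h3 := congrArg (fun y => (f y).re) hd
  simp only [map_add, map_smul, hx, Complex.add_re, smul_eq_mul, Complex.mul_re, Complex.I_re,
    Complex.I_im, zero_mul, one_mul, zero_sub, Complex.ofReal_re] at h3
  rw [(hsa _ (imaginaryPart x).2).1, neg_zero, add_zero] at h3
  calc ‖f a‖ ≤ ‖((realPart x : selfAdjoint B) : B)‖ := h3 ▸ (hsa _ (realPart x).2).2
    _ ≤ ‖x‖ := realPart.norm_le x
    _ = ‖a‖ := hxa

end Positive

/-! ### Existence and uniqueness of the tracial state -/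

section UHF

variable {A : Type*} [CStarAlgebra A]

variable (A) in
/-- An increasing sequence of full matrix subalgebras with dense union. -/
structure MatrixTower where
  /-- the sizes -/
  n : ℕ → ℕ
  /-- the matrix subalgebras -/
  B : ℕ → StarSubalgebra ℂ A
  mono : Monotone B
  pos : ∀ k, 0 < n k
  /-- the isomorphisms with matrix algebras -/
  e : ∀ k, B k ≃⋆ₐ[ℂ] Matrix (Fin (n k)) (Fin (n k)) ℂ
  dense : Dense (⋃ k, (B k : Set A))

theorem IsUHF.nonempty_tower (hA : IsUHF A) : Nonempty (MatrixTower A) := by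
  obtain ⟨n, B, hm, h, hd⟩ := hA
  exact ⟨⟨n, B, hm, fun k => (h k).1, fun k => (h k).2.some, hd⟩⟩

theorem finiteDimensional_of_matrix {q : ℕ} {M : StarSubalgebra ℂ A}
    (e : M ≃⋆ₐ[ℂ] Matrix (Fin q) (Fin q) ℂ) : FiniteDimensional ℂ M :=
  Module.Finite.equiv (e.toAlgEquiv.symm.toLinearEquiv)

theorem isClosed_of_finiteDimensional (M : StarSubalgebra ℂ A) [FiniteDimensional ℂ M] :
    IsClosed (M : Set A) :=
  (Subalgebra.toSubmodule M.toSubalgebra).closed_of_finiteDimensional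

/-- The normalized trace of a full matrix subalgebra. -/
def matrixTrace {q : ℕ} {M : StarSubalgebra ℂ A} (e : M ≃⋆ₐ[ℂ] Matrix (Fin q) (Fin q) ℂ) :
    M →ₗ[ℂ] ℂ :=
  (q : ℂ)⁻¹ • (Matrix.traceLinearMap (Fin q) ℂ ℂ).comp e.toAlgEquiv.toLinearMap

theorem matrixTrace_apply {q : ℕ} {M : StarSubalgebra ℂ A}
    (e : M ≃⋆ₐ[ℂ] Matrix (Fin q) (Fin q) ℂ) (a : M) :
    matrixTrace e a = (q : ℂ)⁻¹ * (e a).trace := rfl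

theorem norm_matrixTrace_le {q : ℕ} (hq : 0 < q) {M : StarSubalgebra ℂ A}
    (e : M ≃⋆ₐ[ℂ] Matrix (Fin q) (Fin q) ℂ) (a : M) : ‖matrixTrace e a‖ ≤ ‖a‖ := by
  have := finiteDimensional_of_matrix e
  have : IsClosed (M : Set A) := isClosed_of_finiteDimensional M
  refine norm_le_of_positive (B := M) (matrixTrace e) ?_ (fun a => ?_) a
  · have : (q : ℂ) ≠ 0 := by exact_mod_cast hq.ne'
    simp [matrixTrace_apply, this]
  · rw [matrixTrace_apply, map_mul, map_star]
    exact mul_nonneg (by simp) (trace_star_mul_self_nonneg _)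

namespace MatrixTower

variable (T : MatrixTower A)

include T

/-- Because `tr` is an arbitrary choice among tracial states, one must first exist. The normalized
traces of the stages are extended to A by Hahn–Banach with norm at most 1, and an ultrafilter limit
is taken. -/
theorem exists_isTracialState : ∃ τ : A →ₗ[ℂ] ℂ, IsTracialState τ := by
  have hex : ∀ k, ∃ g : StrongDual ℂ A, (∀ x : T.B k, g x = matrixTrace (T.e k) x) ∧ ‖g‖ ≤ 1 := by
    intro k
    let f : StrongDual ℂ (Subalgebra.toSubmodule (T.B k).toSubalgebra) :=
      LinearMap.mkContinuous (matrixTrace (T.e k)) 1 fun x => by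
        rw [one_mul]; exact norm_matrixTrace_le (T.pos k) (T.e k) x
    obtain ⟨g, hg, hgn⟩ := exists_extension_norm_eq _ f
    exact ⟨g, hg, hgn ▸ LinearMap.mkContinuous_norm_le _ zero_le_one _⟩
  choose g hg hgn using hex
  let uf : Ultrafilter ℕ := hyperfilter ℕ
  have huf : (uf : Filter ℕ) ≤ atTop := by
    rw [← Nat.cofinite_eq_atTop]; exact hyperfilter_le_cofinite
  have hlim : ∀ a : A, ∃ z : ℂ, Tendsto (fun k => g k a) uf (𝓝 z) ∧ ‖z‖ ≤ ‖a‖ := fun a => by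
    have hb : ∀ k, g k a ∈ Metric.closedBall (0 : ℂ) ‖a‖ := fun k => by
      rw [mem_closedBall_zero_iff]
      exact ((g k).le_opNorm a).trans (mul_le_of_le_one_left (norm_nonneg _) (hgn k))
    obtain ⟨z, hz, hzl⟩ := (isCompact_closedBall (0 : ℂ) ‖a‖).ultrafilter_le_nhds
      (uf.map fun k => g k a) (by
        rw [le_principal_iff, Ultrafilter.coe_map]; exact Filter.mem_map.2 (univ_mem' hb))
    exact ⟨z, hzl, by simpa using hz⟩
  choose τ hτ hτn using hlim
  let τ' : A →ₗ[ℂ] ℂ :=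
    { toFun := τ
      map_add' := fun a b => tendsto_nhds_unique (hτ (a + b)) (by
        simpa using (hτ a).add (hτ b))
      map_smul' := fun c a => tendsto_nhds_unique (hτ (c • a)) (by
        simpa using (hτ a).const_mul c) }
  have hc : Continuous τ' := (τ'.mkContinuous 1 fun a => by rw [one_mul]; exact hτn a).continuous
  -- The extensions are not tracial on A, but on a fixed stage they are eventually the matrix
  -- traces. This yields positivity and the trace property on the dense union.
  have hev : ∀ j (a : A), a ∈ T.B j → ∀ᶠ k in (uf : Filter ℕ), ∃ h : a ∈ T.B k,
      g k a = matrixTrace (T.e k) ⟨a, h⟩ := fun j a ha =>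
    huf (eventually_atTop.2 ⟨j, fun k hk => ⟨T.mono hk ha, hg k ⟨a, T.mono hk ha⟩⟩⟩)
  refine ⟨τ', ?_, ?_, ?_⟩
  · refine tendsto_nhds_unique (hτ 1) (tendsto_const_nhds.congr' ?_)
    filter_upwards [hev 0 1 (one_mem _)] with k ⟨h, hk⟩
    rw [hk, matrixTrace_apply]
    have : (T.n k : ℂ) ≠ 0 := by exact_mod_cast (T.pos k).ne'
    have h1 : (⟨1, h⟩ : T.B k) = 1 := rfl
    simp [h1, this]
  · intro a
    refine T.dense.induction (P := fun a => 0 ≤ τ' (star a * a)) (fun a ha => ?_)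
      (isClosed_le continuous_const (by fun_prop)) a
    obtain ⟨j, ha⟩ := mem_iUnion.1 ha
    refine ge_of_tendsto (hτ (star a * a)) ?_
    filter_upwards [hev j (star a * a) (mul_mem (star_mem ha) ha),
      huf (eventually_ge_atTop j)] with k ⟨h, hk⟩ hjk
    have ha' : a ∈ T.B k := T.mono hjk ha
    have h1 : (⟨star a * a, h⟩ : T.B k) = star ⟨a, ha'⟩ * ⟨a, ha'⟩ := rfl
    rw [hk, matrixTrace_apply, h1, map_mul, map_star]
    exact mul_nonneg (by simp) (trace_star_mul_self_nonneg _)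
  · have key : ∀ j, ∀ a ∈ T.B j, ∀ b ∈ T.B j, τ' (a * b) = τ' (b * a) := fun j a ha b hb => by
      refine tendsto_nhds_unique (hτ (a * b)) ((hτ (b * a)).congr' ?_)
      filter_upwards [hev j (a * b) (mul_mem ha hb), hev j (b * a) (mul_mem hb ha),
        huf (eventually_ge_atTop j)] with k ⟨h, hk⟩ ⟨h', hk'⟩ hjk
      have h1 : (⟨a * b, h⟩ : T.B k) = ⟨a, T.mono hjk ha⟩ * ⟨b, T.mono hjk hb⟩ := rfl
      have h2 : (⟨b * a, h'⟩ : T.B k) = ⟨b, T.mono hjk hb⟩ * ⟨a, T.mono hjk ha⟩ := rfl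
      rw [hk, hk', matrixTrace_apply, matrixTrace_apply, h1, h2, map_mul, map_mul,
        Matrix.trace_mul_comm]
    intro a b
    refine T.dense.induction (P := fun a => ∀ b, τ' (a * b) = τ' (b * a)) (fun a ha => ?_)
      ?_ a b
    · intro b
      refine T.dense.induction (P := fun b => τ' (a * b) = τ' (b * a)) (fun b hb => ?_)
        (isClosed_eq (by fun_prop) (by fun_prop)) b
      obtain ⟨i, ha⟩ := mem_iUnion.1 ha
      obtain ⟨j, hb⟩ := mem_iUnion.1 hb
      exact key (max i j) a (T.mono (le_max_left _ _) ha) b (T.mono (le_max_right _ _) hb)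
    · simp only [ofPred_forall]
      exact isClosed_iInter fun b => isClosed_eq (by fun_prop) (by fun_prop)

theorem isTracialState_tr : IsTracialState (tr A) :=
  Classical.epsilon_spec T.exists_isTracialState

end MatrixTower

theorem IsTracialState.norm_le {τ : A →ₗ[ℂ] ℂ} (hτ : IsTracialState τ) (a : A) : ‖τ a‖ ≤ ‖a‖ :=
  norm_le_of_positive τ hτ.map_one hτ.nonneg a

theorem IsTracialState.continuous {τ : A →ₗ[ℂ] ℂ} (hτ : IsTracialState τ) : Continuous τ :=
  (τ.mkContinuous 1 fun a => by rw [one_mul]; exact hτ.norm_le a).continuous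

theorem IsTracialState.eq_matrixTrace {τ : A →ₗ[ℂ] ℂ} (hτ : IsTracialState τ) {q : ℕ} (hq : 0 < q)
    {M : StarSubalgebra ℂ A} (e : M ≃⋆ₐ[ℂ] Matrix (Fin q) (Fin q) ℂ) (a : M) :
    τ a = (q : ℂ)⁻¹ * (e a).trace := by
  have h0 : (q : ℂ) ≠ 0 := by exact_mod_cast hq.ne'
  have := trace_unique (τ.comp (M.subtype.toAlgHom.toLinearMap.comp e.symm.toAlgEquiv.toLinearMap))
    (fun a b => by simp [hτ.trace]) (e a)
  simp [hτ.map_one] at this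
  rw [← this]; field_simp

theorem MatrixTower.tracialState_unique (T : MatrixTower A) {τ σ : A →ₗ[ℂ] ℂ}
    (hτ : IsTracialState τ) (hσ : IsTracialState σ) : τ = σ := by
  ext a
  refine T.dense.induction (P := fun a => τ a = σ a) (fun a ha => ?_)
    (isClosed_eq hτ.continuous hσ.continuous) a
  obtain ⟨k, ha⟩ := mem_iUnion.1 ha
  exact (hτ.eq_matrixTrace (T.pos k) (T.e k) ⟨a, ha⟩).trans
    (hσ.eq_matrixTrace (T.pos k) (T.e k) ⟨a, ha⟩).symm

/-- Composition with an automorphism is again a tracial state, so uniqueness applies. -/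
theorem MatrixTower.tr_map (T : MatrixTower A) (α : A ≃⋆ₐ[ℂ] A) (a : A) : tr A (α a) = tr A a := by
  have hτ := T.isTracialState_tr
  have : IsTracialState ((tr A).comp α.toAlgEquiv.toLinearMap) :=
    ⟨by simp [hτ.map_one], fun a => by simpa [map_star] using hτ.nonneg (α a),
      fun a b => by simp [hτ.trace]⟩
  exact congrArg (fun f : A →ₗ[ℂ] ℂ => f a) (T.tracialState_unique this hτ)

/-- The tracial state as a continuous functional. -/
def MatrixTower.trL (T : MatrixTower A) : A →L[ℂ] ℂ := ⟨tr A, T.isTracialState_tr.continuous⟩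

end UHF

end ZTwoUHF

end

noncomputable section

namespace ZTwoUHF

open Set Filter Topology

/-! ### Matrix units and the conditional expectation onto a matrix subalgebra -/

section MatrixUnits

variable {A : Type*} [CStarAlgebra A] {q : ℕ} {M : StarSubalgebra ℂ A}
  (e : M ≃⋆ₐ[ℂ] Matrix (Fin q) (Fin q) ℂ)

/-- Matrix units of a full matrix subalgebra. -/
def mUnit (i j : Fin q) : A := (e.symm (Matrix.single i j 1) : M)

theorem mUnit_mem (i j : Fin q) : mUnit e i j ∈ M := (e.symm (Matrix.single i j 1)).2

theorem mUnit_mul (i j k l : Fin q) :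
    mUnit e i j * mUnit e k l = if j = k then mUnit e i l else 0 := by
  have h : mUnit e i j * mUnit e k l =
      ((e.symm (Matrix.single i j 1 * Matrix.single k l 1) : M) : A) := by
    rw [map_mul]; rfl
  rw [h]
  split_ifs with hjk
  · subst hjk; rw [Matrix.single_mul_single_same, mul_one]; rfl
  · rw [Matrix.single_mul_single_of_ne _ _ _ _ hjk, map_zero]; rfl

theorem star_mUnit (i j : Fin q) : star (mUnit e i j) = mUnit e j i := by
  have h : star (mUnit e i j) = ((e.symm (star (Matrix.single i j 1)) : M) : A) := by
    rw [map_star]; rfl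
  rw [h, Matrix.star_eq_conjTranspose, Matrix.conjTranspose_single, star_one]; rfl

theorem sum_mUnit : ∑ i, mUnit e i i = 1 := by
  have h : ∑ i, mUnit e i i = ((e.symm (∑ i, Matrix.single i i 1) : M) : A) := by
    rw [map_sum, AddSubmonoidClass.coe_finsetSum]; rfl
  rw [h, Matrix.sum_single_one, map_one]; rfl

theorem eq_sum_mUnit (d : M) : (d : A) = ∑ i, ∑ j, e d i j • mUnit e i j := by
  have h : d = e.symm (e d) := by simp
  conv_lhs => rw [h, Matrix.matrix_eq_sum_single (e d)]
  simp only [map_sum, AddSubmonoidClass.coe_finsetSum]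
  refine Finset.sum_congr rfl fun i _ => Finset.sum_congr rfl fun j _ => ?_
  have : Matrix.single i j (e d i j) = e d i j • Matrix.single i j (1 : ℂ) := by simp
  rw [this, map_smul]; rfl

variable {τ : A →ₗ[ℂ] ℂ} (hτ : IsTracialState τ) (hq : 0 < q)

include hτ hq in
theorem trace_mUnit (i j : Fin q) : τ (mUnit e i j) = if i = j then (q : ℂ)⁻¹ else 0 := by
  rw [mUnit, hτ.eq_matrixTrace hq e]
  split_ifs with h
  · subst h; simp
  · simp [h]

variable (τ) in
/-- The trace preserving conditional expectation onto a full matrix subalgebra. -/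
def condExp : A →ₗ[ℂ] A :=
  ∑ i, ∑ j, (q : ℂ) • (τ.comp (LinearMap.mulRight ℂ (mUnit e j i))).smulRight (mUnit e i j)

theorem condExp_apply (a : A) :
    condExp e τ a = ∑ i, ∑ j, (q : ℂ) • τ (a * mUnit e j i) • mUnit e i j := by
  simp [condExp]

theorem condExp_mem (a : A) : condExp e τ a ∈ M := by
  rw [condExp_apply]
  exact sum_mem fun i _ => sum_mem fun j _ =>
    SMulMemClass.smul_mem _ (SMulMemClass.smul_mem _ (mUnit_mem e i j))

include hτ hq in
theorem trace_condExp_mul (a : A) {d : A} (hd : d ∈ M) : τ (condExp e τ a * d) = τ (a * d) := by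
  have key : ∀ k l, τ (condExp e τ a * mUnit e k l) = τ (a * mUnit e k l) := fun k l => by
    simp only [condExp_apply, Finset.sum_mul, map_sum, smul_mul_assoc, map_smul, mUnit_mul]
    have h0 : (q : ℂ) ≠ 0 := by exact_mod_cast hq.ne'
    have : ∀ i j : Fin q, (q : ℂ) • τ (a * mUnit e j i) • τ (if j = k then mUnit e i l else 0) =
        if j = k then (if i = l then τ (a * mUnit e k l) else 0) else 0 := fun i j => by
      split_ifs with h1 h2
      · subst h1; subst h2
        rw [trace_mUnit e hτ hq, if_pos rfl]
        simp only [smul_eq_mul]; field_simp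
      · rw [trace_mUnit e hτ hq, if_neg h2]; simp
      · simp
    simp only [this]
    simp
  have hd' : d = _ := eq_sum_mUnit e ⟨d, hd⟩
  rw [hd']
  simp [Finset.mul_sum, key]

include e in
theorem trace_star_mul_self_pos {x : A} (hx : x ∈ M) (h : τ (star x * x) = 0)
    (hτ : IsTracialState τ) (hq : 0 < q) : x = 0 := by
  have h1 := hτ.eq_matrixTrace hq e (star ⟨x, hx⟩ * ⟨x, hx⟩)
  have h2 : τ ((star ⟨x, hx⟩ * ⟨x, hx⟩ : M) : A) = 0 := h
  have h0 : (q : ℂ)⁻¹ ≠ 0 := by simp [hq.ne']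
  rw [h2, map_mul, map_star, eq_comm, mul_eq_zero, or_iff_right h0, Matrix.star_eq_conjTranspose,
    Matrix.trace_conjTranspose_mul_self_eq_zero_iff] at h1
  have : (⟨x, hx⟩ : M) = 0 := by simpa using h1
  exact congrArg Subtype.val this

include e hτ hq

/-- The trace pairing on M is nondegenerate. All module properties of the conditional expectation
are checked against it. -/
theorem eq_of_trace_mul {x y : A} (hx : x ∈ M) (hy : y ∈ M)
    (h : ∀ d ∈ M, τ (x * d) = τ (y * d)) : x = y := by
  refine sub_eq_zero.1 (trace_star_mul_self_pos e (sub_mem hx hy) ?_ hτ hq)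
  rw [hτ.trace, sub_mul, map_sub, h _ (star_mem (sub_mem hx hy)), sub_self]

theorem condExp_of_mem {d : A} (hd : d ∈ M) : condExp e τ d = d :=
  eq_of_trace_mul e hτ hq (condExp_mem e d) hd fun _ hc => trace_condExp_mul e hτ hq d hc

theorem condExp_mul_right (a : A) {d : A} (hd : d ∈ M) :
    condExp e τ (a * d) = condExp e τ a * d :=
  eq_of_trace_mul e hτ hq (condExp_mem e _) (mul_mem (condExp_mem e a) hd) fun c hc => by
    rw [trace_condExp_mul e hτ hq _ hc, mul_assoc, mul_assoc,
      trace_condExp_mul e hτ hq _ (mul_mem hd hc)]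

theorem condExp_mul_left (a : A) {d : A} (hd : d ∈ M) :
    condExp e τ (d * a) = d * condExp e τ a :=
  eq_of_trace_mul e hτ hq (condExp_mem e _) (mul_mem hd (condExp_mem e a)) fun c hc => by
    rw [trace_condExp_mul e hτ hq _ hc, mul_assoc, hτ.trace, mul_assoc,
      mul_assoc, hτ.trace d, mul_assoc, trace_condExp_mul e hτ hq _ (mul_mem hc hd)]

/-- The norm of z is its operator norm on M with the inner product τ(x⋆y), since ‖z⋆z‖ is attained
as an eigenvalue of left multiplication by z⋆z. -/
theorem norm_le_of_trace_le {z : A} (hz : z ∈ M) {C : ℝ} (hC : 0 ≤ C)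
    (h : ∀ d ∈ M, τ (star (z * d) * (z * d)) ≤ (C ^ 2 : ℝ) * τ (star d * d)) : ‖z‖ ≤ C := by
  have := finiteDimensional_of_matrix e
  let _ := CStarAlgebra.spectralOrder A
  let _ := CStarAlgebra.spectralOrderedRing A
  have : Nontrivial A := ⟨1, 0, fun h0 => by simpa [h0] using hτ.map_one⟩
  have hspec := CStarAlgebra.norm_mem_spectrum_of_nonneg (star_mul_self_nonneg z)
  set r := ‖star z * z‖
  have hr : r = ‖z‖ ^ 2 := by rw [sq]; exact CStarRing.norm_star_mul_self
  let w : M := algebraMap ℂ M r - star ⟨z, hz⟩ * ⟨z, hz⟩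
  have hw : ¬ IsUnit w := fun hu => by
    have := hu.map M.subtype
    refine hspec ?_
    convert this using 1
    simp [w]
    rfl
  -- In finite dimension a non-invertible w kills some d ≠ 0, which is an eigenvector: z⋆z d = r d.
  have hinj : ¬ Function.Injective (LinearMap.mulLeft ℂ w) := fun hi => by
    obtain ⟨v, hv⟩ := LinearMap.surjective_of_injective hi 1
    have hv' : w * v = 1 := hv
    refine hw ⟨⟨w, v, hv', ?_⟩, rfl⟩
    apply hi
    simp [← mul_assoc, hv']
  rw [injective_iff_map_eq_zero] at hinj
  push Not at hinj
  obtain ⟨d, hd, hd0⟩ := hinj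
  have hd' : star z * z * (d : A) = (r : ℂ) • (d : A) := by
    have h1 : (algebraMap ℂ M r - star ⟨z, hz⟩ * ⟨z, hz⟩) * d = 0 := hd
    rw [sub_mul, sub_eq_zero, Algebra.algebraMap_eq_smul_one, smul_mul_assoc, one_mul] at h1
    exact (congrArg Subtype.val h1).symm
  have h2 := h d d.2
  have h3 : star (z * (d : A)) * (z * d) = (r : ℂ) • (star (d : A) * d) := by
    rw [star_mul, mul_assoc, ← mul_assoc (star z), hd', mul_smul_comm]
  rw [h3, map_smul, smul_eq_mul] at h2
  have hpos := hτ.nonneg (d : A)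
  have hne : τ (star (d : A) * d) ≠ 0 := fun h0 =>
    hd0 (Subtype.ext (trace_star_mul_self_pos e d.2 h0 hτ hq))
  rw [Complex.nonneg_iff] at hpos
  have hlt : 0 < (τ (star (d : A) * d)).re := lt_of_le_of_ne hpos.1 fun h0 =>
    hne (Complex.ext h0.symm hpos.2.symm)
  have h4 := (Complex.le_def.1 h2).1
  rw [Complex.re_ofReal_mul, Complex.re_ofReal_mul] at h4
  have h5 : r ≤ C ^ 2 := le_of_mul_le_mul_right h4 hlt
  rw [hr] at h5
  exact le_of_sq_le_sq h5 hC

/-- For d in M, E(a) d is the orthogonal projection of a d in the inner product given by τ. So it is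
no longer than a d, whose length is at most ‖a‖ times that of d. -/
theorem norm_condExp_le (a : A) : ‖condExp e τ a‖ ≤ ‖a‖ := by
  let _ := CStarAlgebra.spectralOrder A
  let _ := CStarAlgebra.spectralOrderedRing A
  set z := condExp e τ a with hz
  refine norm_le_of_trace_le e hτ hq (condExp_mem e a) (norm_nonneg a) fun d hd => ?_
  have hM := condExp_mem e (τ := τ) a
  rw [← hz] at hM ⊢
  have h1 : τ (star (z * d) * (z * d)) ≤ τ (star (a * d) * (a * d)) := by
    have h2 := hτ.nonneg ((a - z) * d)
    have e1 : τ (star (z * d) * (a * d)) = τ (star (z * d) * (z * d)) := by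
      rw [hτ.trace, hτ.trace _ (z * d), mul_assoc, mul_assoc,
        ← trace_condExp_mul e hτ hq a (mul_mem hd (star_mem (mul_mem hM hd)))]
    have e2 : τ (star (a * d) * (z * d)) = τ (star (z * d) * (z * d)) := by
      have hs : ∀ x : A, τ (star x) = star (τ x) := map_star_of_positive τ hτ.map_one hτ.nonneg
      have := congrArg star e1
      rw [← hs, ← hs] at this
      simpa using this
    have e3 : star ((a - z) * d) * ((a - z) * d) = star (a * d) * (a * d) - star (z * d) * (a * d)
        - star (a * d) * (z * d) + star (z * d) * (z * d) := by
      simp only [sub_mul, star_sub, mul_sub]; abel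
    rw [e3, map_add, map_sub, map_sub, e1, e2] at h2
    have := add_le_add_left h2 (τ (star (z * d) * (z * d)))
    simpa using this
  refine h1.trans ?_
  have h3 : 0 ≤ algebraMap ℝ A (‖a‖ ^ 2) - star a * a :=
    sub_nonneg.2 CStarAlgebra.star_mul_le_algebraMap_norm_sq
  obtain ⟨c, hc⟩ := CStarAlgebra.nonneg_iff_eq_star_mul_self.1 h3
  have h4 := hτ.nonneg (c * d)
  have e4 : star (c * d) * (c * d) = ((‖a‖ ^ 2 : ℝ) : ℂ) • (star d * d) - star (a * d) * (a * d) := by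
    rw [star_mul, mul_assoc, ← mul_assoc (star c), ← hc, sub_mul, mul_sub,
      Algebra.algebraMap_eq_smul_one, smul_mul_assoc, one_mul, mul_smul_comm, Complex.coe_smul,
      star_mul]
    simp only [mul_assoc]
  rw [e4, map_sub, map_smul, smul_eq_mul] at h4
  exact sub_nonneg.1 h4

end MatrixUnits

end ZTwoUHF

end

noncomputable section

namespace ZTwoUHF

open Set Filter Topology MeasureTheory

/-! ### Averaging over the unitary group of a finite dimensional subalgebra -/

section Averaging

variable {A : Type*} [CStarAlgebra A] (B : StarSubalgebra ℂ A)

instance borelUnitary : MeasurableSpace (unitary B) := borel _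

instance borelSpaceUnitary : BorelSpace (unitary B) := ⟨rfl⟩

theorem norm_le_one_of_unitary {u : A} (hu : u ∈ unitary A) : ‖u‖ ≤ 1 := by
  rcases subsingleton_or_nontrivial A with h | h
  · rw [Subsingleton.elim u 0, norm_zero]; exact zero_le_one
  · exact (CStarRing.norm_of_mem_unitary hu).le

variable {B}

theorem coe_unitary_mem (u : unitary B) : ((u : B) : A) ∈ unitary A := by
  have h := u.2
  rw [Unitary.mem_iff] at h ⊢
  exact ⟨congrArg Subtype.val h.1, congrArg Subtype.val h.2⟩

theorem coe_unitary_mem_U (u : unitary B) : ((u : B) : A) ∈ U B := ⟨coe_unitary_mem u, (u : B).2⟩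

theorem exists_unitary_of_mem_U {a : A} (ha : a ∈ U B) : ∃ u : unitary B, ((u : B) : A) = a := by
  refine ⟨⟨⟨a, ha.2⟩, ?_⟩, rfl⟩
  have h := ha.1
  rw [Unitary.mem_iff] at h ⊢
  exact ⟨Subtype.ext h.1, Subtype.ext h.2⟩

theorem one_mem_U : (1 : A) ∈ U B := ⟨one_mem _, one_mem _⟩

theorem star_mem_U {a : A} (ha : a ∈ U B) : star a ∈ U B :=
  ⟨Unitary.star_mem ha.1, star_mem ha.2⟩

variable (B) in
instance compactSpace_unitary [FiniteDimensional ℂ B] : CompactSpace (unitary B) := by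
  have : ProperSpace B := FiniteDimensional.proper ℂ B
  have hc : IsClosed ((unitary B : Submonoid B) : Set B) := isClosed_unitary
  refine isCompact_iff_compactSpace.1 (Metric.isCompact_of_isClosed_isBounded hc ?_)
  refine (Metric.isBounded_closedBall (x := (0 : B)) (r := 1)).subset fun u hu => ?_
  rw [mem_closedBall_zero_iff]
  exact norm_le_one_of_unitary (coe_unitary_mem ⟨u, hu⟩)

theorem isCompact_U [FiniteDimensional ℂ B] : IsCompact (U B) := by
  have : U B = range fun u : unitary B => ((u : B) : A) := by
    ext a
    exact ⟨fun ha => exists_unitary_of_mem_U ha, fun ⟨u, hu⟩ => hu ▸ coe_unitary_mem_U u⟩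
  rw [this]
  exact isCompact_range (by fun_prop)

variable (B) in
/-- The normalized Haar measure on the unitary group of a finite dimensional subalgebra. -/
def haarU [FiniteDimensional ℂ B] : Measure (unitary B) := Measure.haarMeasure ⊤

variable [FiniteDimensional ℂ B]

instance : IsProbabilityMeasure (haarU B) := ⟨by
  have := Measure.haarMeasure_self (G := unitary B) (K₀ := ⊤)
  simpa [haarU] using this⟩

instance : (haarU B).IsMulLeftInvariant := by unfold haarU; infer_instance

theorem integrable_haarU {f : unitary B → A} (hf : Continuous f) : Integrable f (haarU B) :=
  hf.integrable_of_hasCompactSupport (HasCompactSupport.of_compactSpace f)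

theorem integral_mem_haarU {f : unitary B → A} (hf : Continuous f) (S : Submodule ℂ A)
    (hS : IsClosed (S : Set A)) (h : ∀ u, f u ∈ S) : ∫ u, f u ∂haarU B ∈ S :=
  (S.restrictScalars ℝ).convex.integral_mem hS (Eventually.of_forall h) (integrable_haarU hf)

theorem norm_integral_sub_le {f : unitary B → A} (hf : Continuous f) {c : A} {ε : ℝ}
    (h : ∀ u, ‖f u - c‖ ≤ ε) : ‖∫ u, f u ∂haarU B - c‖ ≤ ε := by
  have := (convex_closedBall c ε).integral_mem (μ := haarU B) Metric.isClosed_closedBall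
    (Eventually.of_forall fun u => by
      rw [mem_closedBall_iff_norm]; exact h u) (integrable_haarU hf)
  rwa [mem_closedBall_iff_norm] at this

theorem continuous_conj_unitary (x : A) :
    Continuous fun u : unitary B => ((u : B) : A) * x * star ((u : B) : A) := by fun_prop

variable (B) in
/-- The average over the unitary group of `B`. -/
def avg : A →L[ℂ] A :=
  LinearMap.mkContinuous
    { toFun := fun x => ∫ u : unitary B, ((u : B) : A) * x * star ((u : B) : A) ∂haarU B
      map_add' := fun x y => by
        rw [← integral_add (integrable_haarU (continuous_conj_unitary x))
          (integrable_haarU (continuous_conj_unitary y))]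
        simp only [mul_add, add_mul]
      map_smul' := fun c x => by
        rw [RingHom.id_apply, ← integral_smul]
        simp only [mul_smul_comm, smul_mul_assoc] } 1 fun x => by
    have := norm_integral_sub_le (continuous_conj_unitary (B := B) x) (c := 0) (ε := 1 * ‖x‖)
      fun u => by
        have hu := norm_le_one_of_unitary (coe_unitary_mem u)
        rw [sub_zero]
        refine (norm_mul_le _ _).trans ?_
        rw [norm_star]
        calc _ ≤ ‖((u : B) : A)‖ * ‖x‖ * ‖((u : B) : A)‖ := by gcongr; exact norm_mul_le _ _
          _ ≤ 1 * ‖x‖ * 1 := by gcongr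
          _ = _ := mul_one _
    simpa using this

theorem avg_apply (x : A) :
    avg B x = ∫ u : unitary B, ((u : B) : A) * x * star ((u : B) : A) ∂haarU B := rfl

/-- Conjugating the average by g translates the integration variable, which Haar measure does not
see. -/
theorem avg_commute {a : A} (ha : a ∈ U B) (x : A) : a * avg B x = avg B x * a := by
  obtain ⟨g, rfl⟩ := exists_unitary_of_mem_U ha
  have h1 : ((g : B) : A) * avg B x * star ((g : B) : A) = avg B x := by
    have hL := ((ContinuousLinearMap.mul ℂ A ((g : B) : A)).comp
      ((ContinuousLinearMap.mul ℂ A).flip (star ((g : B) : A)))).integral_comp_comm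
      (integrable_haarU (continuous_conj_unitary (B := B) x))
    simp only [ContinuousLinearMap.comp_apply, ContinuousLinearMap.mul_apply',
      ContinuousLinearMap.flip_apply] at hL
    rw [avg_apply, mul_assoc, ← hL]
    conv_rhs => rw [← integral_mul_left_eq_self _ g]
    refine integral_congr_ae (Eventually.of_forall fun u => ?_)
    simp [mul_assoc]
  have h2 := (Unitary.mem_iff.1 (coe_unitary_mem g)).1
  conv_rhs => rw [← h1]
  rw [mul_assoc, h2, mul_one]

theorem norm_avg_sub_le {x : A} {ε : ℝ} (h : ∀ a ∈ U B, ‖x * a - a * x‖ ≤ ε) :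
    ‖avg B x - x‖ ≤ ε := by
  refine norm_integral_sub_le (continuous_conj_unitary x) fun u => ?_
  have h1 := h _ (coe_unitary_mem_U u)
  have h2 := (Unitary.mem_iff.1 (coe_unitary_mem u)).2
  have e : ((u : B) : A) * x * star ((u : B) : A) - x =
      -(x * ((u : B) : A) - ((u : B) : A) * x) * star ((u : B) : A) := by
    rw [neg_sub, sub_mul, mul_assoc x, h2, mul_one]
  rw [e]
  refine (norm_mul_le _ _).trans ?_
  rw [norm_neg, norm_star]
  exact (mul_le_of_le_one_right (norm_nonneg _) (norm_le_one_of_unitary (coe_unitary_mem u))).trans h1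

/-- Used to keep an average inside a conjugate of a finite dimensional stage, so that averaging
preserves algebraicity. -/
theorem avg_mem {x : A} (S : Submodule ℂ A) (hS : IsClosed (S : Set A))
    (h : ∀ a ∈ U B, a * x * star a ∈ S) : avg B x ∈ S :=
  integral_mem_haarU (continuous_conj_unitary x) S hS fun u => h _ (coe_unitary_mem_U u)

/-- A finite dimensional subalgebra is contained in the span of its unitaries. -/
theorem mem_span_U {b : A} (hb : b ∈ B) : b ∈ Submodule.span ℂ (U B) := by
  have : IsClosed (B : Set A) := isClosed_of_finiteDimensional B
  have h : (⟨b, hb⟩ : B) ∈ Submodule.span ℂ (unitary B : Set B) := by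
    rw [CStarAlgebra.span_unitary]; trivial
  have h1 := Submodule.mem_map_of_mem (f := B.subtype.toAlgHom.toLinearMap) h
  rw [Submodule.map_span] at h1
  refine Submodule.span_mono ?_ h1
  rintro _ ⟨u, hu, rfl⟩
  exact coe_unitary_mem_U ⟨u, hu⟩

end Averaging

end ZTwoUHF

end

noncomputable section

namespace ZTwoUHF

open Set Filter Topology MeasureTheory

/-! ### Moving a finite dimensional subalgebra into a stage of the tower -/

section Perturbation

variable {A : Type*} [CStarAlgebra A]

theorem MatrixTower.exists_approx (T : MatrixTower A) {K : Set A} (hK : IsCompact K) {ε : ℝ}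
    (hε : 0 < ε) : ∃ k₀, ∀ k ≥ k₀, ∀ x ∈ K, ∃ d ∈ T.B k, ‖x - d‖ < ε := by
  obtain ⟨k₀, hk₀⟩ := hK.elim_directed_cover (fun k => Metric.thickening ε (T.B k : Set A))
    (fun k => Metric.isOpen_thickening) (fun x _ => by
      obtain ⟨d, hd, hdk⟩ := Metric.dense_iff.1 T.dense x ε hε
      obtain ⟨k, hdk⟩ := mem_iUnion.1 hdk
      exact mem_iUnion.2 ⟨k, Metric.mem_thickening_iff.2 ⟨d, hdk, by rwa [dist_comm]⟩⟩)
    (directed_of_isDirected_le fun i j hij => Metric.thickening_subset_of_subset ε (T.mono hij))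
  refine ⟨k₀, fun k hk x hx => ?_⟩
  obtain ⟨d, hd, hxd⟩ := Metric.mem_thickening_iff.1 (hk₀ hx)
  exact ⟨d, T.mono hk hd, by rwa [← dist_eq_norm]⟩

theorem isUnit_of_norm_sub_one_lt {V : A} (h : ‖V - 1‖ < 1) : IsUnit V := by
  have := isUnit_one_sub_of_norm_lt_one (x := 1 - V) (by rwa [norm_sub_rev])
  rwa [sub_sub_cancel] at this

theorem norm_one_le : ‖(1 : A)‖ ≤ 1 := norm_le_one_of_unitary (one_mem _)

theorem norm_inverse_le {V : A} {r : ℝ} (h : ‖V - 1‖ ≤ r) (hr : r < 1) :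
    ‖Ring.inverse V‖ ≤ (1 - r)⁻¹ := by
  have hu := isUnit_of_norm_sub_one_lt (h.trans_lt hr)
  have h1 : Ring.inverse V = 1 - (V - 1) * Ring.inverse V := by
    rw [sub_mul, Ring.mul_inverse_cancel _ hu, one_mul, sub_sub_cancel]
  have h2 : ‖Ring.inverse V‖ ≤ 1 + r * ‖Ring.inverse V‖ := by
    calc ‖Ring.inverse V‖ = ‖1 - (V - 1) * Ring.inverse V‖ := by rw [← h1]
      _ ≤ ‖(1 : A)‖ + ‖(V - 1) * Ring.inverse V‖ := norm_sub_le _ _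
      _ ≤ 1 + r * ‖Ring.inverse V‖ := add_le_add norm_one_le
        ((norm_mul_le _ _).trans (mul_le_mul_of_nonneg_right h (norm_nonneg _)))
  rw [← one_div, le_div_iff₀ (by linarith)]
  linarith

/-- Conjugation by an invertible element. -/
def conj (S x : A) : A := S * x * Ring.inverse S

theorem conj_mul {S : A} (hS : IsUnit S) (x y : A) : conj S (x * y) = conj S x * conj S y := by
  simp only [conj, mul_assoc]
  rw [← mul_assoc (Ring.inverse S) S, Ring.inverse_mul_cancel _ hS, one_mul]

theorem conj_one {S : A} (hS : IsUnit S) : conj S (1 : A) = 1 := by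
  rw [conj, mul_one, Ring.mul_inverse_cancel _ hS]

theorem ringInverse_mul {S V : A} (hS : IsUnit S) (hV : IsUnit V) :
    Ring.inverse (V * S) = Ring.inverse S * Ring.inverse V := by
  obtain ⟨u, rfl⟩ := hS
  obtain ⟨v, rfl⟩ := hV
  rw [← Units.val_mul, Ring.inverse_unit, Ring.inverse_unit, Ring.inverse_unit, mul_inv_rev,
    Units.val_mul]

theorem conj_conj {S V : A} (hS : IsUnit S) (hV : IsUnit V) (x : A) :
    conj V (conj S x) = conj (V * S) x := by
  simp only [conj, mul_assoc, ringInverse_mul hS hV]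

theorem continuous_conj (S : A) : Continuous (conj S) := by unfold conj; fun_prop

theorem norm_conj_le {S : A} (h : ‖S - 1‖ ≤ 1 / 8) {x : A} (hx : ‖x‖ ≤ 1) : ‖conj S x‖ ≤ 2 := by
  have h1 := norm_inverse_le h (by norm_num)
  have h2 : ‖S‖ ≤ 9 / 8 := by
    calc ‖S‖ = ‖(S - 1) + 1‖ := by rw [sub_add_cancel]
      _ ≤ 1 / 8 + 1 := (norm_add_le _ _).trans (add_le_add h norm_one_le)
      _ = 9 / 8 := by norm_num
  calc ‖conj S x‖ ≤ ‖S‖ * ‖x‖ * ‖Ring.inverse S‖ :=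
        (norm_mul_le _ _).trans (mul_le_mul_of_nonneg_right (norm_mul_le _ _) (norm_nonneg _))
    _ ≤ 9 / 8 * 1 * (1 - 1 / 8)⁻¹ := by gcongr
    _ ≤ 2 := by norm_num

variable {τ : A →ₗ[ℂ] ℂ} {q : ℕ} {M : StarSubalgebra ℂ A}
  (e : M ≃⋆ₐ[ℂ] Matrix (Fin q) (Fin q) ℂ) {B : StarSubalgebra ℂ A} [FiniteDimensional ℂ B]

/-- A Newton step. The homomorphism ρ = Ad S is ε-close to E ∘ ρ, which is multiplicative up to ε².
The average V of E(ρ(u)) ρ(u⁻¹) therefore intertwines the two up to order ε², and conjugating by V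
leaves a distance to M quadratic in ε. -/
theorem exists_perturbation_step (hτ : IsTracialState τ) (hq : 0 < q) {S : A}
    (hS : ‖S - 1‖ ≤ 1 / 8) {ε : ℝ} (hε : ε ≤ 1 / 48)
    (h : ∀ a ∈ U B, ‖conj S a - condExp e τ (conj S a)‖ ≤ ε) :
    ∃ V : A, ‖V - 1‖ ≤ 2 * ε ∧
      ∀ a ∈ U B, ‖conj (V * S) a - condExp e τ (conj (V * S) a)‖ ≤ 8 * ε ^ 2 := by
  have hSu : IsUnit S := isUnit_of_norm_sub_one_lt (hS.trans_lt (by norm_num))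
  have hε0 : 0 ≤ ε := (norm_nonneg _).trans (h 1 one_mem_U)
  let E := condExp e τ
  have hE : ∀ a, ‖E a‖ ≤ ‖a‖ := norm_condExp_le e hτ hq
  have hEc : Continuous E :=
    (E.mkContinuous 1 fun a => by rw [one_mul]; exact hE a).continuous
  let ρ : unitary B → A := fun u => conj S ((u : B) : A)
  have hρc : Continuous ρ := (continuous_conj S).comp (by fun_prop)
  have hρm : ∀ u v, ρ (u * v) = ρ u * ρ v := fun u v => conj_mul hSu _ _
  have hρ1 : ρ 1 = 1 := conj_one hSu
  have hρn : ∀ u, ‖ρ u‖ ≤ 2 := fun u => norm_conj_le hS (norm_le_one_of_unitary (coe_unitary_mem u))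
  have hρE : ∀ u, ‖ρ u - E (ρ u)‖ ≤ ε := fun u => h _ (coe_unitary_mem_U u)
  let V : A := ∫ u, E (ρ u) * ρ u⁻¹ ∂haarU B
  have hc1 : Continuous fun u => E (ρ u) * ρ u⁻¹ :=
    (hEc.comp hρc).mul (hρc.comp continuous_inv)
  have hV : ‖V - 1‖ ≤ 2 * ε := norm_integral_sub_le hc1 fun u => by
    have : E (ρ u) * ρ u⁻¹ - 1 = -(ρ u - E (ρ u)) * ρ u⁻¹ := by
      rw [neg_sub, sub_mul, ← hρm, mul_inv_cancel, hρ1]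
    rw [this]
    calc _ ≤ ‖-(ρ u - E (ρ u))‖ * ‖ρ u⁻¹‖ := norm_mul_le _ _
      _ ≤ ε * 2 := by
        rw [norm_neg]
        exact mul_le_mul (hρE u) (hρn _) (norm_nonneg _) hε0
      _ = 2 * ε := mul_comm _ _
  have hVu : IsUnit V := isUnit_of_norm_sub_one_lt (hV.trans_lt (by linarith))
  refine ⟨V, hV, fun a ha => ?_⟩
  obtain ⟨g, rfl⟩ := exists_unitary_of_mem_U ha
  -- The source of the quadratic gain: by the bimodule property, the failure of E to be
  -- multiplicative involves only the parts of x and y outside M.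
  have hEE : ∀ x y, E (x * y) - E x * E y = E ((x - E x) * (y - E y)) := fun x y => by
    have h1 : E (x * E y) = E x * E y := condExp_mul_right e hτ hq x (condExp_mem e y)
    have h2 : E (E x * y) = E x * E y := condExp_mul_left e hτ hq y (condExp_mem e x)
    have h3 : E (E x * E y) = E x * E y :=
      condExp_of_mem e hτ hq (mul_mem (condExp_mem e x) (condExp_mem e y))
    simp only [mul_sub, sub_mul, map_sub, h1, h2, h3]
    abel
  -- Translation by g in the Haar integral moves ρ(g) from the right of V into the argument of E.
  have hVg : V * ρ g = ∫ u, E (ρ (g * u)) * ρ u⁻¹ ∂haarU B := by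
    have h1 : V = ∫ u, E (ρ (g * u)) * ρ (g * u)⁻¹ ∂haarU B :=
      (integral_mul_left_eq_self (fun u => E (ρ u) * ρ u⁻¹) g).symm
    have hc2 : Continuous fun u => E (ρ (g * u)) * ρ (g * u)⁻¹ :=
      hc1.comp (continuous_const.mul continuous_id)
    have hL := ((ContinuousLinearMap.mul ℂ A).flip (ρ g)).integral_comp_comm (integrable_haarU hc2)
    simp only [ContinuousLinearMap.flip_apply, ContinuousLinearMap.mul_apply'] at hL
    rw [h1, ← hL]
    refine integral_congr_ae (Eventually.of_forall fun u => ?_)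
    simp only [mul_assoc]
    rw [← hρm]
    simp
  have hVE : ‖V * ρ g - E (ρ g) * V‖ ≤ 2 * ε ^ 2 := by
    have hL := (ContinuousLinearMap.mul ℂ A (E (ρ g))).integral_comp_comm (integrable_haarU hc1)
    simp only [ContinuousLinearMap.mul_apply'] at hL
    have hc3 : Continuous fun u => E (ρ (g * u)) * ρ u⁻¹ :=
      (hEc.comp (hρc.comp (continuous_const.mul continuous_id))).mul (hρc.comp continuous_inv)
    have hc4 : Continuous fun u => E (ρ g) * (E (ρ u) * ρ u⁻¹) := continuous_const.mul hc1
    rw [hVg, ← hL, ← integral_sub (integrable_haarU hc3) (integrable_haarU hc4), ← sub_zero (∫ _, _ ∂_)]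
    refine norm_integral_sub_le (hc3.sub hc4) fun u => ?_
    have : E (ρ (g * u)) * ρ u⁻¹ - E (ρ g) * (E (ρ u) * ρ u⁻¹) =
        E ((ρ g - E (ρ g)) * (ρ u - E (ρ u))) * ρ u⁻¹ := by
      rw [← mul_assoc, ← sub_mul, hρm, hEE]
    rw [sub_zero]
    change ‖E (ρ (g * u)) * ρ u⁻¹ - E (ρ g) * (E (ρ u) * ρ u⁻¹)‖ ≤ _
    rw [this]
    calc _ ≤ ‖E ((ρ g - E (ρ g)) * (ρ u - E (ρ u)))‖ * ‖ρ u⁻¹‖ := norm_mul_le _ _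
      _ ≤ (ε * ε) * 2 := by
        refine mul_le_mul ((hE _).trans ((norm_mul_le _ _).trans ?_)) (hρn _) (norm_nonneg _)
          (by positivity)
        exact mul_le_mul (hρE g) (hρE u) (norm_nonneg _) hε0
      _ = 2 * ε ^ 2 := by ring
  have hfin : ‖conj V (ρ g) - E (ρ g)‖ ≤ 4 * ε ^ 2 := by
    have h1 : conj V (ρ g) - E (ρ g) = (V * ρ g - E (ρ g) * V) * Ring.inverse V := by
      rw [sub_mul, mul_assoc (E _), Ring.mul_inverse_cancel _ hVu, mul_one]; rfl
    have h2 := norm_inverse_le (hV.trans (show 2 * ε ≤ 1 / 2 by linarith)) (by norm_num)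
    rw [h1]
    calc _ ≤ 2 * ε ^ 2 * (1 - 1 / 2)⁻¹ :=
          (norm_mul_le _ _).trans (mul_le_mul hVE h2 (norm_nonneg _) (by positivity))
      _ = 4 * ε ^ 2 := by norm_num; ring
  rw [← conj_conj hSu hVu]
  change ‖conj V (ρ g) - E (conj V (ρ g))‖ ≤ _
  have h3 : conj V (ρ g) - E (conj V (ρ g)) =
      (conj V (ρ g) - E (ρ g)) - E (conj V (ρ g) - E (ρ g)) := by
    have : E (E (ρ g)) = E (ρ g) := condExp_of_mem e hτ hq (condExp_mem e _)
    rw [map_sub, this]; abel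
  rw [h3]
  calc _ ≤ 4 * ε ^ 2 + 4 * ε ^ 2 := (norm_sub_le _ _).trans (add_le_add hfin ((hE _).trans hfin))
    _ = 8 * ε ^ 2 := by ring

/-- Iterate the Newton step. For ε ≤ 1/48 the bound 8 ε² at least halves the error, the m-th
displacement is at most 3 ε 2⁻ᵐ, and these sum to 6 ε ≤ 1/8, so every iterate stays in the range of
the step. The limit maps B into M. -/
theorem exists_conj_mem (hτ : IsTracialState τ) (hq : 0 < q) {ε : ℝ} (hε : ε ≤ 1 / 48)
    (h : ∀ a ∈ U B, ‖a - condExp e τ a‖ ≤ ε) :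
    ∃ S : A, ‖S - 1‖ ≤ 6 * ε ∧ ∀ a ∈ U B, conj S a ∈ M := by
  have hε0 : 0 ≤ ε := (norm_nonneg _).trans (h 1 one_mem_U)
  let Good : ℕ → A → Prop := fun m S => ‖S - 1‖ ≤ 6 * ε * (1 - (1 / 2) ^ m) ∧
    ∀ a ∈ U B, ‖conj S a - condExp e τ (conj S a)‖ ≤ ε * (1 / 2) ^ m
  have hstep : ∀ m S, Good m S → ∃ S', Good (m + 1) S' ∧ ‖S' - S‖ ≤ 3 * ε * (1 / 2) ^ m := by
    rintro m S ⟨h1, h2⟩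
    have hp : (0 : ℝ) < (1 / 2) ^ m := by positivity
    have hp1 : ((1 : ℝ) / 2) ^ m ≤ 1 := pow_le_one₀ (by norm_num) (by norm_num)
    have hS8 : ‖S - 1‖ ≤ 1 / 8 := h1.trans (by nlinarith)
    obtain ⟨V, hV, hV2⟩ := exists_perturbation_step e hτ hq hS8 (by nlinarith) h2
    have hSn : ‖S‖ ≤ 9 / 8 := by
      calc ‖S‖ = ‖(S - 1) + 1‖ := by rw [sub_add_cancel]
        _ ≤ 1 / 8 + 1 := (norm_add_le _ _).trans (add_le_add hS8 norm_one_le)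
        _ = 9 / 8 := by norm_num
    have hd : ‖V * S - S‖ ≤ 3 * ε * (1 / 2) ^ m := by
      have : V * S - S = (V - 1) * S := by rw [sub_mul, one_mul]
      rw [this]
      calc _ ≤ ‖V - 1‖ * ‖S‖ := norm_mul_le _ _
        _ ≤ 2 * (ε * (1 / 2) ^ m) * (9 / 8) := mul_le_mul hV hSn (norm_nonneg _) (by positivity)
        _ ≤ _ := by nlinarith [mul_nonneg hε0 hp.le]
    refine ⟨V * S, ⟨?_, fun a ha => (hV2 a ha).trans ?_⟩, hd⟩
    · calc ‖V * S - 1‖ = ‖(V * S - S) + (S - 1)‖ := by rw [sub_add_sub_cancel]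
        _ ≤ 3 * ε * (1 / 2) ^ m + 6 * ε * (1 - (1 / 2) ^ m) :=
          (norm_add_le _ _).trans (add_le_add hd h1)
        _ = _ := by rw [pow_succ]; ring
    · rw [pow_succ (1 / 2 : ℝ) m]
      have h3 : ε * (1 / 2) ^ m ≤ 1 / 48 := by nlinarith
      have h4 := mul_nonneg hε0 hp.le
      rw [← mul_assoc]
      generalize ε * (1 / 2) ^ m = x at h3 h4
      nlinarith
  choose! next hnext hdist using hstep
  let S : ℕ → A := fun m => Nat.rec 1 (fun m S => next m S) m
  have hgood : ∀ m, Good m (S m) := fun m => by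
    induction m with
    | zero =>
      refine ⟨by simp [S], fun a ha => ?_⟩
      have : conj (S 0) a = a := by simp [S, conj]
      rw [this, pow_zero, mul_one]; exact h a ha
    | succ m ih => exact hnext m _ ih
  have hcau : CauchySeq S := cauchySeq_of_le_geometric (1 / 2) (3 * ε) (by norm_num) fun m => by
    rw [dist_eq_norm, norm_sub_rev]; exact hdist m _ (hgood m)
  obtain ⟨S', hS'⟩ := cauchySeq_tendsto_of_complete hcau
  have hn : ‖S' - 1‖ ≤ 6 * ε := by
    refine le_of_tendsto (hS'.sub_const 1).norm (Eventually.of_forall fun m => (hgood m).1.trans ?_)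
    have hp : (0 : ℝ) < (1 / 2) ^ m := by positivity
    nlinarith
  have hu : IsUnit S' := isUnit_of_norm_sub_one_lt (hn.trans_lt (by linarith))
  refine ⟨S', hn, fun a ha => ?_⟩
  have hinv : Tendsto (fun m => Ring.inverse (S m)) atTop (𝓝 (Ring.inverse S')) := by
    obtain ⟨v, rfl⟩ := hu
    exact (NormedRing.inverse_continuousAt v).tendsto.comp hS'
  have hconj : Tendsto (fun m => conj (S m) a) atTop (𝓝 (conj S' a)) :=
    (hS'.mul_const a).mul hinv
  have hEc : Continuous (condExp e τ) :=
    ((condExp e τ).mkContinuous 1 fun a => by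
      rw [one_mul]; exact norm_condExp_le e hτ hq a).continuous
  have h0 : Tendsto (fun m : ℕ => ε * (1 / 2 : ℝ) ^ m) atTop (𝓝 0) := by
    simpa using (tendsto_pow_atTop_nhds_zero_of_lt_one (r := (1 / 2 : ℝ)) (by norm_num)
      (by norm_num)).const_mul ε
  have hlim : ‖conj S' a - condExp e τ (conj S' a)‖ ≤ 0 :=
    le_of_tendsto_of_tendsto' (hconj.sub ((hEc.tendsto _).comp hconj)).norm h0
      fun m => (hgood m).2 a ha
  rw [norm_le_zero_iff, sub_eq_zero] at hlim
  rw [hlim]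
  exact condExp_mem e _

variable (B) in
/-- A finite dimensional subalgebra is moved into a matrix subalgebra by an invertible element
close to the unit. -/
theorem MatrixTower.exists_conj_mem (T : MatrixTower A) {ε : ℝ} (hε : 0 < ε) :
    ∃ k₀, ∀ k ≥ k₀, ∃ S : A, IsUnit S ∧ ‖S - 1‖ ≤ ε ∧ ∀ b ∈ B, conj S b ∈ T.B k := by
  -- The bound ε / 6 pays for the total displacement 6 η, and 1/48 is the threshold of the
  -- iteration. Stages are η / 2-close because a - E a = (a - d) - E(a - d) doubles the distance.
  set η := min (ε / 6) (1 / 48)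
  have hη : 0 < η := by positivity
  obtain ⟨k₀, hk₀⟩ := T.exists_approx (isCompact_U (B := B)) (half_pos hη)
  refine ⟨k₀, fun k hk => ?_⟩
  have hτ := T.isTracialState_tr
  obtain ⟨S, hS, hSU⟩ := ZTwoUHF.exists_conj_mem (B := B) (T.e k) hτ (T.pos k) (ε := η)
    (min_le_right _ _) fun a ha => by
      obtain ⟨d, hd, had⟩ := hk₀ k hk a ha
      have : a - condExp (T.e k) (tr A) a = (a - d) - condExp (T.e k) (tr A) (a - d) := by
        rw [map_sub, condExp_of_mem (T.e k) hτ (T.pos k) hd]; abel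
      rw [this]
      have := norm_condExp_le (T.e k) hτ (T.pos k) (a - d)
      exact (norm_sub_le _ _).trans (by linarith)
  have h1 : 6 * η ≤ ε := by linarith [min_le_left (ε / 6) (1 / 48)]
  have h2 : 6 * η < 1 := by linarith [min_le_right (ε / 6) (1 / 48)]
  refine ⟨S, isUnit_of_norm_sub_one_lt (hS.trans_lt h2), hS.trans h1, fun b hb => ?_⟩
  refine Submodule.span_induction (p := fun b _ => conj S b ∈ T.B k) (fun a ha => hSU a ha) ?_ ?_ ?_
    (mem_span_U hb)
  · simp [conj]
  · intro x y _ _ hx hy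
    have : conj S (x + y) = conj S x + conj S y := by simp [conj, mul_add, add_mul]
    rw [this]; exact add_mem hx hy
  · intro c x _ hx
    have : conj S (c • x) = c • conj S x := by simp [conj]
    rw [this]; exact SMulMemClass.smul_mem c hx

end Perturbation

end ZTwoUHF

end

noncomputable section

namespace ZTwoUHF

open Set Filter Topology

/-! ### Polar decomposition of invertible elements -/

section Polar

variable {A : Type*} [CStarAlgebra A]

/-- The inverse of the modulus of an invertible element. -/
def modInv (y : A) : A := cfc (fun x : ℝ => (√x)⁻¹) (star y * y)

/-- The unitary part in the polar decomposition of an invertible element. -/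
def polar (y : A) : A := y * modInv y

theorem spectrum_star_mul_self_pos {y : A} (hy : IsUnit y) :
    ∀ x ∈ spectrum ℝ (star y * y), 0 < x := fun x hx => by
  refine lt_of_le_of_ne (spectrum_star_mul_self_nonneg x hx) fun h0 => ?_
  subst h0
  exact spectrum.zero_notMem ℝ ((IsUnit.star hy).mul hy) hx

theorem continuousOn_sqrt_inv {s : Set ℝ} (hs : ∀ x ∈ s, 0 < x) :
    ContinuousOn (fun x : ℝ => (√x)⁻¹) s :=
  Real.continuous_sqrt.continuousOn.inv₀ fun x hx => (Real.sqrt_pos.2 (hs x hx)).ne'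

theorem isSelfAdjoint_modInv (y : A) : IsSelfAdjoint (modInv y) := cfc_predicate _ _

/-- The modulus. -/
def modulus (y : A) : A := cfc Real.sqrt (star y * y)

theorem modulus_mul_modulus (y : A) : modulus y * modulus y = star y * y := by
  have hsa : IsSelfAdjoint (star y * y) := .star_mul_self y
  rw [modulus, ← cfc_mul _ _ _ Real.continuous_sqrt.continuousOn Real.continuous_sqrt.continuousOn]
  conv_rhs => rw [← cfc_id' ℝ (star y * y) hsa]
  exact cfc_congr fun x hx => Real.mul_self_sqrt (spectrum_star_mul_self_nonneg x hx)

theorem modInv_mul_modulus {y : A} (hy : IsUnit y) : modInv y * modulus y = 1 := by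
  have hs := spectrum_star_mul_self_pos hy
  have hsa : IsSelfAdjoint (star y * y) := .star_mul_self y
  rw [modulus, modInv, ← cfc_mul _ _ _ (continuousOn_sqrt_inv hs)
    Real.continuous_sqrt.continuousOn, ← cfc_const_one ℝ (star y * y) hsa]
  exact cfc_congr fun x hx => inv_mul_cancel₀ (Real.sqrt_pos.2 (hs x hx)).ne'

theorem modulus_mul_modInv {y : A} (hy : IsUnit y) : modulus y * modInv y = 1 :=
  (cfc_commute_cfc _ _ _ : Commute (modulus y) (modInv y)).eq.trans (modInv_mul_modulus hy)

theorem modInv_mul_modInv {y : A} (hy : IsUnit y) : modInv y * (star y * y) * modInv y = 1 := by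
  rw [← modulus_mul_modulus, ← mul_assoc, modInv_mul_modulus hy, one_mul, modulus_mul_modInv hy]

theorem star_polar_mul_self {y : A} (hy : IsUnit y) : star (polar y) * polar y = 1 := by
  rw [polar, star_mul, (isSelfAdjoint_modInv y).star_eq, mul_assoc, ← mul_assoc (star y),
    ← mul_assoc, modInv_mul_modInv hy]

theorem isUnit_modInv {y : A} (hy : IsUnit y) : IsUnit (modInv y) :=
  ⟨⟨modInv y, modulus y, modInv_mul_modulus hy, modulus_mul_modInv hy⟩, rfl⟩

theorem polar_mem_unitary {y : A} (hy : IsUnit y) : polar y ∈ unitary A := by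
  have h := star_polar_mul_self hy
  have hu : IsUnit (polar y) := hy.mul (isUnit_modInv hy)
  rw [Unitary.mem_iff]
  refine ⟨h, ?_⟩
  obtain ⟨v, hv⟩ := hu
  rw [← hv] at h ⊢
  rw [← Units.inv_eq_of_mul_eq_one_left h, Units.mul_inv]

theorem polar_one : polar (1 : A) = 1 := by
  have h := modInv_mul_modulus (A := A) isUnit_one
  have h2 : modulus (1 : A) = 1 := by
    rw [modulus, star_one, one_mul, cfc_apply_one]; simp
  rw [h2, mul_one] at h
  rw [polar, h, one_mul]

/-- The difference is the unitary part times 1 - |y|, and |1 - √x| ≤ |x - 1| on the spectrum of y⋆y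
since x - 1 = (√x + 1)(√x - 1). -/
theorem norm_polar_sub_le {y : A} (hy : IsUnit y) : ‖polar y - y‖ ≤ ‖star y * y - 1‖ := by
  have hsa : IsSelfAdjoint (star y * y) := .star_mul_self y
  have h1 : polar y - y = polar y * (1 - modulus y) := by
    rw [mul_sub, mul_one, polar, mul_assoc, modInv_mul_modulus hy, mul_one]
  have h2 : ‖1 - modulus y‖ ≤ ‖star y * y - 1‖ := by
    have e1 : 1 - modulus y = cfc (fun x : ℝ => 1 - √x) (star y * y) := by
      rw [cfc_sub _ _ _ continuousOn_const Real.continuous_sqrt.continuousOn,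
        cfc_const_one ℝ (star y * y) hsa]; rfl
    have e2 : star y * y - 1 = cfc (fun x : ℝ => x - 1) (star y * y) := by
      rw [cfc_sub _ _ _ (continuousOn_id' _) continuousOn_const, cfc_id' ℝ _ hsa,
        cfc_const_one ℝ (star y * y) hsa]
    rw [e1]
    refine norm_cfc_le (norm_nonneg _) fun x hx => ?_
    have h3 := norm_apply_le_norm_cfc (fun x : ℝ => x - 1) (star y * y) hx
      (by fun_prop) hsa
    rw [← e2] at h3
    refine le_trans ?_ h3
    have hx0 := spectrum_star_mul_self_nonneg x hx
    have h4 : x - 1 = (√x + 1) * (√x - 1) := by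
      rw [← sq_sub_sq, Real.sq_sqrt hx0]; ring
    rw [h4, norm_mul, norm_sub_rev]
    refine le_mul_of_one_le_left (norm_nonneg _) ?_
    rw [Real.norm_of_nonneg (by positivity)]
    linarith [Real.sqrt_nonneg x]
  rw [h1]
  refine (norm_mul_le _ _).trans ?_
  exact (mul_le_of_le_one_left (norm_nonneg _)
    (norm_le_one_of_unitary (polar_mem_unitary hy))).trans h2

theorem norm_star_mul_self_sub_one_le {y w : A} (hw : w ∈ unitary A) {ε : ℝ} (h : ‖y - w‖ ≤ ε)
    (hε : ε ≤ 1) : ‖star y * y - 1‖ ≤ 3 * ε := by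
  have hw1 := norm_le_one_of_unitary hw
  have hy : ‖star y‖ ≤ 1 + ε := by
    rw [norm_star]
    calc ‖y‖ = ‖w + (y - w)‖ := by rw [add_sub_cancel]
      _ ≤ 1 + ε := (norm_add_le _ _).trans (add_le_add hw1 h)
  have e : star y * y - 1 = star y * (y - w) + star (y - w) * w := by
    rw [star_sub, sub_mul, (Unitary.mem_iff.1 hw).1, mul_sub]; abel
  have hε0 : 0 ≤ ε := (norm_nonneg _).trans h
  rw [e]
  calc _ ≤ ‖star y‖ * ‖y - w‖ + ‖star (y - w)‖ * ‖w‖ :=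
        (norm_add_le _ _).trans (add_le_add (norm_mul_le _ _) (norm_mul_le _ _))
    _ ≤ (1 + ε) * ε + ε * 1 := by rw [norm_star (y - w)]; gcongr
    _ ≤ 3 * ε := by nlinarith

theorem isUnit_of_norm_sub_unitary_lt {y w : A} (hw : w ∈ unitary A) (h : ‖y - w‖ < 1) :
    IsUnit y := by
  have h1 : ‖y * star w - 1‖ < 1 := by
    rw [← (Unitary.mem_iff.1 hw).2, ← sub_mul]
    refine lt_of_le_of_lt (norm_mul_le _ _) ?_
    rw [norm_star]
    exact (mul_le_of_le_one_right (norm_nonneg _) (norm_le_one_of_unitary hw)).trans_lt h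
  have h2 := (isUnit_of_norm_sub_one_lt h1).mul (Unitary.isUnit_coe (U := ⟨w, hw⟩))
  rwa [mul_assoc, (Unitary.mem_iff.1 hw).1, mul_one] at h2

theorem norm_polar_sub_unitary_le {y w : A} (hw : w ∈ unitary A) {ε : ℝ} (h : ‖y - w‖ ≤ ε)
    (hε : ε < 1) : ‖polar y - w‖ ≤ 4 * ε := by
  have hy := isUnit_of_norm_sub_unitary_lt hw (h.trans_lt hε)
  calc ‖polar y - w‖ = ‖(polar y - y) + (y - w)‖ := by rw [sub_add_sub_cancel]
    _ ≤ 3 * ε + ε := (norm_add_le _ _).trans (add_le_add ((norm_polar_sub_le hy).trans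
      (norm_star_mul_self_sub_one_le hw h hε.le)) h)
    _ = 4 * ε := by ring

theorem continuous_polar {X : Type*} [TopologicalSpace X] {y : X → A} (hc : Continuous y)
    (hu : ∀ x, IsUnit (y x)) : Continuous fun x => polar (y x) := by
  refine hc.mul ?_
  rw [← continuousOn_univ]
  refine ContinuousOn.cfc_of_mem_nhdsSet (s := Ioi 0) _ ?_ (by fun_prop)
    (fun x _ => .star_mul_self (y x)) (continuousOn_sqrt_inv fun x hx => hx)
  refine (isOpen_Ioi.mem_nhdsSet).2 ?_
  exact iUnion₂_subset fun x _ r hr => spectrum_star_mul_self_pos (hu x) r hr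

end Polar

/-! ### Smooth paths in the identity component of the unitary group -/

section Connected

variable {C : Type*} [CStarAlgebra C]

open Polynomial in
/-- The polar part of an invertible algebraic element is connected to the unit. -/
theorem polar_mem_pathComponent {c : C} (hc : IsUnit c) {p : ℂ[X]} (hp : p ≠ 0)
    (hpc : aeval c p = 0) :
    (⟨polar c, polar_mem_unitary hc⟩ : unitary C) ∈ pathComponent (1 : unitary C) := by
  rcases subsingleton_or_nontrivial C with hsub | hnt
  · rw [Subsingleton.elim (⟨polar c, polar_mem_unitary hc⟩ : unitary C) 1]
    exact mem_pathComponent_self 1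
  have hfin : (spectrum ℂ c).Finite := by
    refine (p.roots.toFinset.finite_toSet).subset fun z hz => ?_
    have := spectrum.subset_polynomial_aeval c p ⟨z, hz, rfl⟩
    rw [hpc, spectrum.zero_eq, mem_singleton_iff] at this
    simpa [hp] using this
  -- F contains the parameters z at which (1 - z) + z c fails to be invertible. It is finite and
  -- omits 0 and 1, so a path from 0 to 1 in its complement in ℂ gives a path of invertibles from 1
  -- to c, whose polar parts are then taken.
  let F : Set ℂ := (fun w => (1 - w)⁻¹) '' (spectrum ℂ c \ {1})
  have hF : F.Countable := ((hfin.sdiff).image _).countable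
  have hunit : ∀ z ∉ F, IsUnit (algebraMap ℂ C (1 - z) + z • c) := fun z hz => by
    by_cases h0 : z = 0
    · simp [h0]
    · have h1 : (1 - z⁻¹) ∉ spectrum ℂ c := fun h => hz ⟨_, ⟨h, by simp [h0]⟩, by simp⟩
      rw [spectrum.notMem_iff] at h1
      have h2 : algebraMap ℂ C (1 - z) + z • c = (-z) • (algebraMap ℂ C (1 - z⁻¹) - c) := by
        rw [smul_sub, neg_smul, neg_smul, sub_neg_eq_add, Algebra.algebraMap_eq_smul_one,
          Algebra.algebraMap_eq_smul_one, smul_smul, ← neg_smul]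
        congr 2
        field_simp; ring
      rw [h2]
      rw [Algebra.smul_def]
      exact ((IsUnit.mk0 _ (neg_ne_zero.2 h0)).map (algebraMap ℂ C)).mul h1
  have hpath := hF.isPathConnected_compl_of_one_lt_rank (by
    rw [Complex.rank_real_complex]; norm_num)
  have h0F : (0 : ℂ) ∈ Fᶜ := by
    rintro ⟨w, hw, h⟩
    have h1 : 1 - w = 0 := by simpa using h
    exact hw.2 (sub_eq_zero.1 h1).symm
  have h1F : (1 : ℂ) ∈ Fᶜ := by
    rintro ⟨w, hw, h⟩
    have h1 : w = 0 := by
      have := inv_eq_one.1 h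
      linear_combination -this
    exact spectrum.zero_notMem ℂ hc (h1 ▸ hw.1)
  obtain ⟨γ, hγ⟩ := hpath.joinedIn 0 h0F 1 h1F
  let y : unitInterval → C := fun t => algebraMap ℂ C (1 - γ t) + γ t • c
  have hy : ∀ t, IsUnit (y t) := fun t => hunit _ (hγ t)
  have hyc : Continuous y := by
    have : Continuous (algebraMap ℂ C) := continuous_algebraMap ℂ C
    fun_prop
  refine ⟨⟨⟨fun t => ⟨polar (y t), polar_mem_unitary (hy t)⟩,
    (continuous_polar hyc hy).subtype_mk _⟩, ?_, ?_⟩⟩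
  · ext; simp [y, polar_one]
  · ext; simp [y]

theorem contDiff_exp_smul (x : C) :
    ContDiff ℝ ∞ fun t : ℝ => NormedSpace.exp (Complex.I • (t • x)) := by
  have h1 : ContDiff ℂ ∞ (NormedSpace.exp : C → C) := by
    rw [contDiff_iff_contDiffAt]
    exact fun x => (NormedSpace.exp_analytic (𝕂 := ℂ) x).contDiffAt
  exact (h1.restrict_scalars ℝ).comp (by fun_prop)

/-- Smooth paths in the identity component of the unitary group. -/
theorem exists_smooth_path_of_mem_pathComponent {u : unitary C}
    (hu : u ∈ pathComponent (1 : unitary C)) :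
    ∃ h : ℝ → C, ContDiff ℝ ∞ h ∧ (∀ t, h t ∈ unitary C) ∧ h 0 = 1 ∧ h 1 = u := by
  -- Unitaries in the identity component are finite products of exponentials; scaling each exponent
  -- by t gives a smooth path.
  obtain ⟨l, rfl⟩ := Unitary.mem_pathComponentOne_iff.1 hu
  induction l with
  | nil => exact ⟨fun _ => 1, contDiff_const, fun _ => one_mem _, rfl, by simp⟩
  | cons x l ih =>
    obtain ⟨h, h1, h2, h3, h4⟩ := ih (by
      exact Unitary.mem_pathComponentOne_iff.2 ⟨l, rfl⟩)
    refine ⟨fun t => NormedSpace.exp (Complex.I • (t • (x : C))) * h t,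
      (contDiff_exp_smul _).mul h1, fun t => mul_mem ?_ (h2 t), ?_, ?_⟩
    · exact (selfAdjoint.expUnitary (t • x)).2
    · simp [h3]
    · simp [h4]

end Connected

end ZTwoUHF

end

noncomputable section

namespace ZTwoUHF

open Set Filter Topology

/-! ### Paths of unitaries almost commuting with a finite dimensional subalgebra -/

section PathLemma

variable {A : Type*} [CStarAlgebra A] {B : StarSubalgebra ℂ A}

variable (B) in
/-- The commutant of the unitary group of `B`. -/
def commutant : StarSubalgebra ℂ A := StarSubalgebra.centralizer ℂ (U B)

theorem mem_commutant {z : A} : z ∈ commutant B ↔ ∀ a ∈ U B, a * z = z * a := by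
  rw [commutant, StarSubalgebra.mem_centralizer_iff]
  exact ⟨fun h a ha => (h a ha).1, fun h a ha => ⟨h a ha, h _ (star_mem_U ha)⟩⟩

theorem isClosed_commutant : IsClosed (commutant B : Set A) := by
  rw [commutant, StarSubalgebra.coe_centralizer]
  exact Set.isClosed_centralizer _

instance : CStarAlgebra (commutant B) :=
  StarSubalgebra.cstarAlgebra _ (h_closed := isClosed_commutant)

/-- Conjugation by an invertible element. -/
def conjAlgHom (S : A) (hS : IsUnit S) : A →ₐ[ℂ] A :=
  AlgHom.ofLinearMap
    { toFun := conj S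
      map_add' := fun x y => by simp only [conj, mul_add, add_mul]
      map_smul' := fun c x => by simp [conj] }
    (conj_one hS) (conj_mul hS)

theorem conj_inverse_conj {S : A} (hS : IsUnit S) (x : A) : conj (Ring.inverse S) (conj S x) = x := by
  rw [conj_conj hS hS.ringInverse, Ring.inverse_mul_cancel _ hS, conj, Ring.inverse_one, one_mul,
    mul_one]

theorem conj_conj_inverse {S : A} (hS : IsUnit S) (x : A) : conj S (conj (Ring.inverse S) x) = x := by
  rw [conj_conj hS.ringInverse hS, Ring.mul_inverse_cancel _ hS, conj, Ring.inverse_one, one_mul,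
    mul_one]

theorem norm_avg_le [FiniteDimensional ℂ B] (x : A) : ‖avg B x‖ ≤ ‖x‖ := by
  have h : ‖avg B‖ ≤ 1 := LinearMap.mkContinuous_norm_le _ zero_le_one _
  exact ((avg B).le_opNorm x).trans (mul_le_of_le_one_left (norm_nonneg _) h)

theorem avg_of_mem_commutant [FiniteDimensional ℂ B] {x : A} (hx : x ∈ commutant B) :
    avg B x = x := by
  have := norm_avg_sub_le (B := B) (x := x) (ε := 0) fun a ha => by
    rw [mem_commutant.1 hx a ha, sub_self, norm_zero]
  exact sub_eq_zero.1 (norm_le_zero_iff.1 this)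

theorem avg_mem_commutant [FiniteDimensional ℂ B] (x : A) : avg B x ∈ commutant B :=
  mem_commutant.2 fun _ ha => avg_commute ha x

/-- Elements of the commutant of a finite dimensional subalgebra are limits of algebraic elements
of the commutant. -/
theorem exists_isIntegral_near (T : MatrixTower A) [FiniteDimensional ℂ B] {y : A}
    (hy : y ∈ commutant B) {ε : ℝ} (hε : 0 < ε) :
    ∃ c ∈ commutant B, ‖c - y‖ ≤ ε ∧ IsIntegral ℂ c := by
  -- The bound 1/2 gives ‖S⁻¹‖ ≤ 2; the other makes conjugation by S⁻¹ move d by at most 4 (‖y‖ + 1)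
  -- r ≤ ε / 2.
  set r := min (1 / 2) (ε / (8 * (‖y‖ + 1)))
  have hr0 : 0 < r := by positivity
  obtain ⟨k₁, h₁⟩ := T.exists_conj_mem B hr0
  obtain ⟨k₂, h₂⟩ := T.exists_approx (isCompact_singleton (x := y)) (ε := min 1 (ε / 2))
    (by positivity)
  obtain ⟨S, hS, hS1, hSB⟩ := h₁ (max k₁ k₂) (le_max_left _ _)
  obtain ⟨d, hd, hyd⟩ := h₂ (max k₁ k₂) (le_max_right _ _) y rfl
  set k := max k₁ k₂
  have := finiteDimensional_of_matrix (T.e k)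
  -- Conjugation by S carries B into the stage, so it carries each b (S⁻¹ d S) b⋆ there, and hence
  -- their average. The average is thus similar to an element of a finite dimensional algebra, which
  -- is why it is algebraic.
  have hmem : conj S (avg B (conj (Ring.inverse S) d)) ∈ T.B k := by
    refine avg_mem ((T.B k).toSubalgebra.toSubmodule.comap (conjAlgHom S hS).toLinearMap)
      (IsClosed.preimage (continuous_conj S) (isClosed_of_finiteDimensional (T.B k)))
      fun a ha => ?_
    change conj S _ ∈ T.B k
    rw [conj_mul hS, conj_mul hS, conj_conj_inverse hS]
    exact mul_mem (mul_mem (hSB a ha.2) hd) (hSB _ (star_mem ha.2))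
  refine ⟨avg B (conj (Ring.inverse S) d), avg_mem_commutant _, ?_, ?_⟩
  · have h1 : avg B (conj (Ring.inverse S) d) - y = avg B (conj (Ring.inverse S) d - y) := by
      rw [map_sub, avg_of_mem_commutant hy]
    have h2 : conj (Ring.inverse S) d - d =
        Ring.inverse S * (d * (S - 1) - (S - 1) * d) := by
      rw [conj, Ring.inverse_inverse hS, mul_sub d, mul_one, sub_mul, one_mul,
        sub_sub_sub_cancel_right, mul_sub, ← mul_assoc, ← mul_assoc, Ring.inverse_mul_cancel _ hS,
        one_mul]
    have h3 : ‖Ring.inverse S‖ ≤ 2 := by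
      refine (norm_inverse_le (hS1.trans (min_le_left _ _)) (by norm_num)).trans ?_
      norm_num
    have h4 : ‖d‖ ≤ ‖y‖ + 1 := by
      have := norm_sub_norm_le d y
      rw [norm_sub_rev] at this
      linarith [hyd.trans_le (min_le_left _ _)]
    have h5 : ‖d * (S - 1) - (S - 1) * d‖ ≤ 2 * ((‖y‖ + 1) * r) := by
      refine (norm_sub_le _ _).trans ?_
      have a1 := (norm_mul_le d (S - 1)).trans
        (mul_le_mul h4 hS1 (norm_nonneg _) (by positivity))
      have a2 := (norm_mul_le (S - 1) d).trans
        (mul_le_mul hS1 h4 (norm_nonneg _) (by positivity))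
      linarith
    have h6 : (‖y‖ + 1) * r ≤ ε / 8 := by
      calc (‖y‖ + 1) * r ≤ (‖y‖ + 1) * (ε / (8 * (‖y‖ + 1))) := by
            gcongr; exact min_le_right _ _
        _ = ε / 8 := by field_simp
    rw [h1]
    refine (norm_avg_le _).trans ?_
    calc ‖conj (Ring.inverse S) d - y‖
        ≤ ‖conj (Ring.inverse S) d - d‖ + ‖d - y‖ := norm_sub_le_norm_sub_add_norm_sub _ _ _
      _ ≤ 2 * (2 * ((‖y‖ + 1) * r)) + ε / 2 := by
          rw [h2, norm_sub_rev d y]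
          exact add_le_add ((norm_mul_le _ _).trans
            (mul_le_mul h3 h5 (norm_nonneg _) zero_le_two)) (hyd.le.trans (min_le_right _ _))
      _ ≤ ε := by linarith
  · have hinj : Function.Injective (conjAlgHom S hS) := fun x y hxy => by
      rw [← conj_inverse_conj hS x, ← conj_inverse_conj hS y]
      exact congrArg _ hxy
    rw [← isIntegral_algHom_iff (conjAlgHom S hS) hinj]
    have h1 : IsIntegral ℂ (⟨_, hmem⟩ : T.B k) := Algebra.IsIntegral.isIntegral _
    exact h1.map (T.B k).subtype.toAlgHom

/-- A unitary that almost commutes with a finite dimensional subalgebra is connected to the unit by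
a smooth path of unitaries that almost commute with the subalgebra. -/
theorem exists_smooth_path (T : MatrixTower A) [FiniteDimensional ℂ B] {δ : ℝ}
    (hδ0 : 0 < δ) (hδ : δ ≤ 1 / 16) {w : A} (hw : w ∈ unitary A)
    (h : ∀ a ∈ U B, ‖w * a - a * w‖ ≤ δ) :
    ∃ h : ℝ → A, ContDiff ℝ ∞ h ∧ (∀ t, h t ∈ unitary A) ∧ h 0 = 1 ∧ h 1 = w ∧
      ∀ t ∈ Icc (0 : ℝ) 1, ∀ a ∈ U B, ‖h t * a - a * h t‖ ≤ 16 * δ := by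
  -- The average is δ-close to w and c is δ-close to the average, so c is 2δ-close to w and its
  -- polar part is 6δ + 2δ = 8δ-close to w.
  obtain ⟨c, hc, hcy, p, hp, hpc⟩ := exists_isIntegral_near T (avg_mem_commutant (B := B) w) hδ0
  have hcw : ‖c - w‖ ≤ 2 * δ := by
    have := norm_sub_le_norm_sub_add_norm_sub c (avg B w) w
    linarith [norm_avg_sub_le h]
  have h1 := norm_star_mul_self_sub_one_le hw hcw (by linarith)
  have hunit := isUnit_of_norm_sub_unitary_lt hw (y := c) (by linarith)
  let c' : commutant B := ⟨c, hc⟩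
  -- The inverse of c is needed inside the commutant. There c⋆c and cc⋆ are close to 1, which
  -- provides a left and a right inverse.
  have hs1 : IsUnit (star c' * c') := isUnit_of_norm_sub_one_lt (A := commutant B) (by
    change ‖star c * c - 1‖ < 1
    linarith)
  have hcw' : ‖star c - star w‖ ≤ 2 * δ := by rwa [← star_sub, norm_star]
  have hs2 : IsUnit (c' * star c') := isUnit_of_norm_sub_one_lt (A := commutant B) (by
    change ‖c * star c - 1‖ < 1
    have := norm_star_mul_self_sub_one_le (Unitary.star_mem hw) hcw' (by linarith)
    rw [star_star] at this
    linarith)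
  have hc' : IsUnit c' := isUnit_iff_exists_and_exists.2
    ⟨⟨star c' * Ring.inverse (c' * star c'), by
      rw [← mul_assoc, Ring.mul_inverse_cancel _ hs2]⟩,
     ⟨Ring.inverse (star c' * c') * star c', by
      rw [mul_assoc, Ring.inverse_mul_cancel _ hs1]⟩⟩
  have hpc' : Polynomial.aeval c' p = 0 := by
    apply Subtype.val_injective
    have : (commutant B).subtype.toAlgHom (Polynomial.aeval c' p) = Polynomial.aeval c p :=
      (Polynomial.aeval_algHom_apply _ _ _).symm
    rw [← Polynomial.aeval_def] at hpc
    exact this.trans hpc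
  obtain ⟨g, hg, hgu, hg0, hg1⟩ := exists_smooth_path_of_mem_pathComponent
    (polar_mem_pathComponent hc' hp.ne_zero hpc')
  have hgu' : ∀ t, (g t : A) ∈ unitary A := fun t =>
    coe_unitary_mem (B := commutant B) ⟨g t, hgu t⟩
  have hg' : ContDiff ℝ ∞ fun t => (g t : A) := by
    let L : commutant B →L[ℝ] A := (commutant B).toSubalgebra.toSubmodule.subtypeL.restrictScalars ℝ
    exact L.contDiff.comp hg
  let P : commutant B := polar c'
  have hpw : ‖(P : A) - w‖ ≤ 8 * δ := by
    have a1 : ‖polar c' - c'‖ ≤ ‖star c' * c' - 1‖ := norm_polar_sub_le hc'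
    have a2 : ‖(P : A) - c‖ ≤ ‖star c * c - 1‖ := a1
    have := norm_sub_le_norm_sub_add_norm_sub (P : A) c w
    linarith
  have hpu : (P : A) ∈ unitary A := by
    have := hgu' 1
    rw [hg1] at this
    exact this
  -- The remainder after the exactly commuting factor P. It is 8δ-close to 1, so its exponential
  -- path is too, and commutators along that path are at most 2 · 8δ.
  let v : unitary A := ⟨w * star (P : A), mul_mem hw (Unitary.star_mem hpu)⟩
  have hv : ‖(v : A) - 1‖ ≤ 8 * δ := by
    change ‖w * star (P : A) - 1‖ ≤ _
    rw [← (Unitary.mem_iff.1 hpu).2, ← sub_mul]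
    refine (norm_mul_le _ _).trans ((mul_le_of_le_one_right (norm_nonneg _)
      (norm_le_one_of_unitary (Unitary.star_mem hpu))).trans ?_)
    rwa [norm_sub_rev]
  have hv2 : ‖(v : A) - 1‖ < 2 := by linarith
  refine ⟨fun t => (selfAdjoint.expUnitary (t • Unitary.argSelfAdjoint v) : A) * g t,
    (contDiff_exp_smul _).mul hg', fun t => mul_mem (Subtype.prop _) (hgu' t), ?_, ?_, ?_⟩
  · simp [hg0]
  · simp only [one_smul, expUnitary_argSelfAdjoint hv2, hg1]
    change w * star (P : A) * (P : A) = w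
    rw [mul_assoc, (Unitary.mem_iff.1 hpu).1, mul_one]
  · intro t ht a ha
    set E : A := (selfAdjoint.expUnitary (t • Unitary.argSelfAdjoint v) : A)
    have hE : ‖E - 1‖ ≤ 8 * δ :=
      (Unitary.norm_expUnitary_smul_argSelfAdjoint_sub_one_le v ht hv2).trans hv
    have hga : a * (g t : A) = g t * a := mem_commutant.1 (g t).2 a ha
    have h2 : E * g t * a - a * (E * g t) = ((E - 1) * a - a * (E - 1)) * g t := by
      simp only [sub_mul, mul_sub, mul_assoc, one_mul, mul_one]
      rw [← hga]; abel
    rw [h2]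
    refine (norm_mul_le _ _).trans ((mul_le_of_le_one_right (norm_nonneg _)
      (norm_le_one_of_unitary (hgu' t))).trans ((norm_sub_le _ _).trans ?_))
    have a1 := (norm_mul_le (E - 1) a).trans
      (mul_le_of_le_one_right (norm_nonneg _) (norm_le_one_of_unitary ha.1))
    have a2 := (norm_mul_le a (E - 1)).trans
      (mul_le_of_le_one_left (norm_nonneg _) (norm_le_one_of_unitary ha.1))
    linarith

theorem isUnitaryPath_of_contDiff {h : ℝ → A} (h1 : ContDiff ℝ ∞ h) (h2 : ∀ t, h t ∈ unitary A) :
    IsUnitaryPath h where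
  unitary_mem t _ := h2 t
  continuousOn := h1.continuous.continuousOn
  piecewise := ⟨1, fun i => (i : ℕ), fun i j hij => Nat.cast_lt.2 hij, by simp, by simp,
    fun _ => h1.contDiffOn⟩

/-- The unitary group of a UHF algebra is connected by smooth paths. -/
theorem exists_smooth_path_one (T : MatrixTower A) {w : A} (hw : w ∈ unitary A) :
    ∃ h : ℝ → A, ContDiff ℝ ∞ h ∧ (∀ t, h t ∈ unitary A) ∧ h 0 = 1 ∧ h 1 = w := by
  have : FiniteDimensional ℂ (⊥ : StarSubalgebra ℂ A) :=
    inferInstanceAs (FiniteDimensional ℂ (⊥ : Subalgebra ℂ A))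
  obtain ⟨h, h1, h2, h3, h4, -⟩ := exists_smooth_path (B := (⊥ : StarSubalgebra ℂ A)) T
    (δ := 1 / 16) (by norm_num) le_rfl hw (fun a ha => by
      obtain ⟨z, rfl⟩ := StarSubalgebra.mem_bot.1 ha.2
      rw [Algebra.commutes, sub_self, norm_zero]; norm_num)
  exact ⟨h, h1, h2, h3, h4⟩

/-- The path lemma loses a factor 16, and 16 / 144 = 1/9 < 1/8. -/
theorem MatrixTower.isGoodConstant (T : MatrixTower A) : IsGoodConstant A (1 / 144) := by
  refine ⟨by norm_num, by norm_num, fun B hB w hw h => ?_⟩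
  obtain ⟨g, h1, h2, h3, h4, h5⟩ := exists_smooth_path T (δ := 1 / 144) (by norm_num) (by norm_num)
    hw fun a ha => (h a ha).le
  exact ⟨g, isUnitaryPath_of_contDiff h1 h2, h3, h4, fun t ht a ha =>
    (h5 t ht a ha).trans_lt (by norm_num)⟩

end PathLemma

end ZTwoUHF

end

noncomputable section

namespace ZTwoUHF

open Set Filter Topology

/-! ### Homomorphisms from matrix algebras are inner -/

section Equivalence

/-- Idempotents with the same trace are equivalent. -/
theorem exists_equivalence_of_trace_eq {V : Type*} [AddCommGroup V] [Module ℂ V]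
    [FiniteDimensional ℂ V] {f g : V →ₗ[ℂ] V} (hf : IsIdempotentElem f) (hg : IsIdempotentElem g)
    (h : LinearMap.trace ℂ V f = LinearMap.trace ℂ V g) :
    ∃ X Y : V →ₗ[ℂ] V, Y * X = f ∧ X * Y = g := by
  have pf := (LinearMap.isProj_range_iff_isIdempotentElem f).2 hf
  have pg := (LinearMap.isProj_range_iff_isIdempotentElem g).2 hg
  rw [pf.trace, pg.trace, Nat.cast_inj] at h
  let E := LinearEquiv.ofFinrankEq _ _ h
  refine ⟨(LinearMap.range g).subtype ∘ₗ E.toLinearMap ∘ₗ f.rangeRestrict,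
    (LinearMap.range f).subtype ∘ₗ E.symm.toLinearMap ∘ₗ g.rangeRestrict, ?_, ?_⟩
  · ext v
    have h1 : g.rangeRestrict (E (f.rangeRestrict v) : V) = E (f.rangeRestrict v) :=
      Subtype.ext (pg.map_id _ (E (f.rangeRestrict v)).2)
    simp only [Module.End.mul_apply, LinearMap.comp_apply, Submodule.subtype_apply,
      LinearEquiv.coe_coe, h1, LinearEquiv.symm_apply_apply]
    rfl
  · ext v
    have h1 : f.rangeRestrict (E.symm (g.rangeRestrict v) : V) = E.symm (g.rangeRestrict v) :=
      Subtype.ext (pf.map_id _ (E.symm (g.rangeRestrict v)).2)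
    simp only [Module.End.mul_apply, LinearMap.comp_apply, Submodule.subtype_apply,
      LinearEquiv.coe_coe, h1, LinearEquiv.apply_symm_apply]
    rfl

theorem Matrix.exists_equivalence_of_trace_eq {N : ℕ} {f g : Matrix (Fin N) (Fin N) ℂ}
    (hf : IsIdempotentElem f) (hg : IsIdempotentElem g) (h : f.trace = g.trace) :
    ∃ X Y : Matrix (Fin N) (Fin N) ℂ, Y * X = f ∧ X * Y = g := by
  obtain ⟨X, Y, h1, h2⟩ := ZTwoUHF.exists_equivalence_of_trace_eq
    (hf.map (Matrix.toLinAlgEquiv' (R := ℂ) (n := Fin N)))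
    (hg.map (Matrix.toLinAlgEquiv' (R := ℂ) (n := Fin N)))
    (by
      change LinearMap.trace ℂ _ (Matrix.toLin' f) = LinearMap.trace ℂ _ (Matrix.toLin' g)
      rw [Matrix.trace_toLin'_eq, Matrix.trace_toLin'_eq, h])
  refine ⟨Matrix.toLinAlgEquiv'.symm X, Matrix.toLinAlgEquiv'.symm Y, ?_, ?_⟩
  · rw [← map_mul, h1, AlgEquiv.symm_apply_apply]
  · rw [← map_mul, h2, AlgEquiv.symm_apply_apply]

variable {A : Type*} [CStarAlgebra A]

theorem exists_equivalence_of_tr_eq (T : MatrixTower A) {k : ℕ} {f g : A} (hfm : f ∈ T.B k)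
    (hgm : g ∈ T.B k) (hf : IsIdempotentElem f) (hg : IsIdempotentElem g)
    (h : tr A f = tr A g) : ∃ X Y : A, Y * X = f ∧ X * Y = g := by
  have e1 := T.isTracialState_tr.eq_matrixTrace (T.pos k) (T.e k) ⟨f, hfm⟩
  have e2 := T.isTracialState_tr.eq_matrixTrace (T.pos k) (T.e k) ⟨g, hgm⟩
  have h0 : (T.n k : ℂ)⁻¹ ≠ 0 := by simp [(T.pos k).ne']
  have hf' : IsIdempotentElem (⟨f, hfm⟩ : T.B k) := Subtype.ext hf
  have hg' : IsIdempotentElem (⟨g, hgm⟩ : T.B k) := Subtype.ext hg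
  obtain ⟨X, Y, h1, h2⟩ := Matrix.exists_equivalence_of_trace_eq (hf'.map (T.e k))
    (hg'.map (T.e k)) (mul_left_cancel₀ h0 (e1.symm.trans (h.trans e2)))
  refine ⟨((T.e k).symm X : T.B k), ((T.e k).symm Y : T.B k), ?_, ?_⟩
  · have : (T.e k).symm Y * (T.e k).symm X = ⟨f, hfm⟩ := by
      rw [← map_mul, h1, StarAlgEquiv.symm_apply_apply]
    exact congrArg Subtype.val this
  · have : (T.e k).symm X * (T.e k).symm Y = ⟨g, hgm⟩ := by
      rw [← map_mul, h2, StarAlgEquiv.symm_apply_apply]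
    exact congrArg Subtype.val this

/-- Systems of matrix units. -/
structure IsMatrixUnits {q : ℕ} (f : Fin q → Fin q → A) : Prop where
  mul : ∀ i j k l, f i j * f k l = if j = k then f i l else 0
  sum : ∑ i, f i i = 1

theorem isMatrixUnits_mUnit {q : ℕ} {M : StarSubalgebra ℂ A}
    (e : M ≃⋆ₐ[ℂ] Matrix (Fin q) (Fin q) ℂ) : IsMatrixUnits (mUnit e) :=
  ⟨mUnit_mul e, sum_mUnit e⟩

theorem IsMatrixUnits.map {q : ℕ} {f : Fin q → Fin q → A} (h : IsMatrixUnits f) {g : A → A}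
    (h1 : g 1 = 1) (hmul : ∀ a b, g (a * b) = g a * g b) (hadd : ∀ a b, g (a + b) = g a + g b) :
    IsMatrixUnits fun i j => g (f i j) := by
  let G : A →+* A :=
    { toFun := g
      map_one' := h1
      map_mul' := hmul
      map_add' := hadd
      map_zero' := by simpa using hadd 0 0 }
  refine ⟨fun i j k l => ?_, ?_⟩
  · change G (f i j) * G (f k l) = _
    rw [← map_mul, h.mul]
    split_ifs
    · rfl
    · exact map_zero G
  · change ∑ i, G (f i i) = 1
    rw [← map_sum, h.sum, map_one]

theorem IsMatrixUnits.tr_eq {q : ℕ} {f : Fin q → Fin q → A} (h : IsMatrixUnits f)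
    {τ : A →ₗ[ℂ] ℂ} (hτ : IsTracialState τ) (j : Fin q) : τ (f j j) = (q : ℂ)⁻¹ := by
  have h1 : ∀ i, τ (f i i) = τ (f j j) := fun i => by
    have e1 := h.mul i j j i
    have e2 := h.mul j i i j
    rw [if_pos rfl] at e1 e2
    rw [← e1, ← e2, hτ.trace]
  have h2 := congrArg τ h.sum
  rw [map_sum, Finset.sum_congr rfl fun i _ => h1 i, hτ.map_one, Finset.sum_const,
    Finset.card_univ, Fintype.card_fin, nsmul_eq_mul] at h2
  exact eq_inv_of_mul_eq_one_right h2

/-- The corners f₀₀ and g₀₀ both have trace 1/q, so some X carries one to the other inside the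
stage. The sum of the g_i0 X f_0i spreads it over all matrix units. -/
theorem exists_intertwiner (T : MatrixTower A) {q : ℕ} (hq : 0 < q) {k : ℕ}
    {f g : Fin q → Fin q → A} (hf : IsMatrixUnits f) (hg : IsMatrixUnits g)
    (hfm : ∀ i j, f i j ∈ T.B k) (hgm : ∀ i j, g i j ∈ T.B k) :
    ∃ V : A, IsUnit V ∧ ∀ i j, V * f i j = g i j * V := by
  have : NeZero q := ⟨hq.ne'⟩
  obtain ⟨X, Y, h1, h2⟩ := exists_equivalence_of_tr_eq T (hfm 0 0) (hgm 0 0)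
    (by rw [IsIdempotentElem, hf.mul, if_pos rfl]) (by rw [IsIdempotentElem, hg.mul, if_pos rfl])
    ((hf.tr_eq T.isTracialState_tr 0).trans (hg.tr_eq T.isTracialState_tr 0).symm)
  have hX : X * f 0 0 = g 0 0 * X := by rw [← h1, ← h2, mul_assoc]
  have hY : Y * g 0 0 = f 0 0 * Y := by rw [← h1, ← h2, mul_assoc]
  have key : ∀ {f g : Fin q → Fin q → A} (_ : IsMatrixUnits f) (_ : IsMatrixUnits g) {X Y : A}
      (_ : Y * X = f 0 0) (_ : X * Y = g 0 0) (_ : X * f 0 0 = g 0 0 * X),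
      (∑ i, g i 0 * X * f 0 i) * (∑ i, f i 0 * Y * g 0 i) = 1 := by
    intro f g hf hg X Y h1 h2 hX
    have h3 : ∀ i j, g i 0 * X * f 0 i * (f j 0 * Y * g 0 j) = if i = j then g i i else 0 := by
      intro i j
      have : g i 0 * X * f 0 i * (f j 0 * Y * g 0 j) = g i 0 * (X * (f 0 i * f j 0) * Y) * g 0 j := by
        simp only [mul_assoc]
      rw [this, hf.mul]
      split_ifs with h
      · rw [hX, mul_assoc (g 0 0), h2, hg.mul, if_pos rfl, hg.mul, if_pos rfl, hg.mul, if_pos rfl, h]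
      · simp
    simp only [Finset.sum_mul_sum, h3, Finset.sum_ite_eq, Finset.mem_univ, if_true, hg.sum]
  refine ⟨∑ i, g i 0 * X * f 0 i, isUnit_iff_exists_and_exists.2
    ⟨⟨_, key hf hg h1 h2 hX⟩, ⟨_, key hg hf h2 h1 hY⟩⟩, fun i j => ?_⟩
  rw [Finset.sum_mul, Finset.mul_sum]
  simp only [mul_assoc, hf.mul]
  simp only [← mul_assoc, hg.mul, ite_mul, mul_ite, mul_zero, zero_mul, Finset.sum_ite_eq,
    Finset.sum_ite_eq', Finset.mem_univ, if_true]

/-- Unital homomorphisms from full matrix subalgebras are inner. -/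
theorem exists_unitary_conj (T : MatrixTower A) {q : ℕ} (hq : 0 < q) {M : StarSubalgebra ℂ A}
    (e : M ≃⋆ₐ[ℂ] Matrix (Fin q) (Fin q) ℂ) (φ : M →⋆ₐ[ℂ] A) :
    ∃ u ∈ unitary A, ∀ b : M, φ b = u * b * star u := by
  have := finiteDimensional_of_matrix e
  have : FiniteDimensional ℂ φ.range :=
    inferInstanceAs (FiniteDimensional ℂ (LinearMap.range φ.toAlgHom.toLinearMap))
  -- The domain and the range of φ are both moved into one stage by similarities, so that their
  -- matrix units can be compared there; y undoes these similarities.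
  obtain ⟨k₁, h₁⟩ := T.exists_conj_mem M one_pos
  obtain ⟨k₂, h₂⟩ := T.exists_conj_mem φ.range one_pos
  obtain ⟨S, hS, -, hSM⟩ := h₁ (max k₁ k₂) (le_max_left _ _)
  obtain ⟨R, hR, -, hRM⟩ := h₂ (max k₁ k₂) (le_max_right _ _)
  have hadd : ∀ S a b : A, conj S (a + b) = conj S a + conj S b := fun S a b => by
    simp only [conj, mul_add, add_mul]
  have hφ : IsMatrixUnits fun i j => φ (e.symm (Matrix.single i j 1)) := by
    refine ⟨fun i j k l => ?_, ?_⟩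
    · rw [← map_mul, ← map_mul]
      split_ifs with h
      · subst h; simp
      · rw [Matrix.single_mul_single_of_ne (h := h), map_zero, map_zero]
    · rw [← map_sum, ← map_sum, Matrix.sum_single_one, map_one, map_one]
  obtain ⟨V, hV, hVi⟩ := exists_intertwiner T hq
    ((isMatrixUnits_mUnit e).map (conj_one hS) (conj_mul hS) (hadd S))
    (hφ.map (conj_one hR) (conj_mul hR) (hadd R)) (fun i j => hSM _ (mUnit_mem e i j))
    (fun i j => hRM _ ⟨_, rfl⟩)
  set y := Ring.inverse R * V * S with hy
  have hyu : IsUnit y := (hR.ringInverse.mul hV).mul hS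
  have hy1 : ∀ i j, y * mUnit e i j = φ (e.symm (Matrix.single i j 1)) * y := fun i j => by
    calc y * mUnit e i j = Ring.inverse R * (V * conj S (mUnit e i j)) * S := by
          simp only [hy, conj, mul_assoc, Ring.inverse_mul_cancel _ hS, mul_one]
      _ = Ring.inverse R * (conj R (φ (e.symm (Matrix.single i j 1))) * V) * S := by rw [hVi]
      _ = _ := by
          simp only [hy, conj, ← mul_assoc, Ring.inverse_mul_cancel _ hR, one_mul]
  have hy2 : ∀ b : M, y * b = φ b * y := fun b => by
    have h1 : φ b = ∑ i, ∑ j, e b i j • φ (e.symm (Matrix.single i j 1)) := by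
      have h : b = e.symm (e b) := by simp
      conv_lhs => rw [h, Matrix.matrix_eq_sum_single (e b)]
      simp only [map_sum]
      refine Finset.sum_congr rfl fun i _ => Finset.sum_congr rfl fun j _ => ?_
      rw [← map_smul, ← map_smul, Matrix.smul_single, smul_eq_mul, mul_one]
    rw [eq_sum_mUnit e b, h1]
    simp only [Finset.mul_sum, Finset.sum_mul, mul_smul_comm, smul_mul_assoc, hy1]
  clear_value y
  have hy3 : ∀ b : M, (b : A) * star y = star y * φ b := fun b => by
    have := congrArg star (hy2 (star b))
    rwa [star_mul, star_mul, map_star, star_star, StarMemClass.coe_star, star_star] at this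
  -- Since y intertwines two ⋆-homomorphisms, y⋆y commutes with M, and so does the inverse modulus.
  -- Hence the unitary part of y is again an intertwiner.
  have hy4 : ∀ b : M, Commute (b : A) (modInv y) := fun b => by
    have : Commute (star y * y) (b : A) := by
      change star y * y * b = b * (star y * y)
      rw [mul_assoc, hy2, ← mul_assoc, ← hy3, mul_assoc]
    exact (this.cfc_real _).symm
  refine ⟨polar y, polar_mem_unitary hyu, fun b => ?_⟩
  have h5 : φ b * polar y = polar y * b := by
    rw [polar, ← mul_assoc, ← hy2, mul_assoc, (hy4 b).eq, ← mul_assoc]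
  rw [← h5, mul_assoc, (Unitary.mem_iff.1 (polar_mem_unitary hyu)).2, mul_one]

/-- Automorphisms are approximately inner. -/
theorem exists_unitary_conj_automorphism (T : MatrixTower A) (α : A ≃⋆ₐ[ℂ] A) (k : ℕ) :
    ∃ u ∈ unitary A, ∀ b ∈ T.B k, α b = u * b * star u := by
  obtain ⟨u, hu, h⟩ := exists_unitary_conj T (T.pos k) (T.e k)
    ((α : A →⋆ₐ[ℂ] A).comp (T.B k).subtype)
  exact ⟨u, hu, fun b hb => h ⟨b, hb⟩⟩

end Equivalence

end ZTwoUHF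

end

noncomputable section

namespace ZTwoUHF

open Set Filter Topology MeasureTheory

/-! ### Loops attached to idempotents -/

section Idempotent

variable {R : Type*} [NormedRing R] [NormedAlgebra ℂ R] [CompleteSpace R] (t : R →L[ℂ] ℂ)

/-- The loop of units attached to an idempotent. -/
def idempotentLoop (e : R) (s : ℝ) : R := 1 + (Complex.exp (2 * Real.pi * Complex.I * s) - 1) • e

variable {e : R}

theorem hasDerivAt_idempotentLoop (s : ℝ) : HasDerivAt (idempotentLoop e)
    ((2 * Real.pi * Complex.I * Complex.exp (2 * Real.pi * Complex.I * s)) • e) s := by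
  have h1 : HasDerivAt (fun s : ℝ => 2 * Real.pi * Complex.I * (s : ℂ)) (2 * Real.pi * Complex.I) s := by
    simpa using (Complex.ofRealCLM.hasDerivAt (x := s)).const_mul (2 * Real.pi * Complex.I)
  have h2 := ((h1.cexp.sub_const 1).smul_const e).const_add 1
  rwa [mul_comm (Complex.exp _)] at h2

theorem isPath_idempotentLoop : IsPath (idempotentLoop e) := by
  refine IsPath.of_contDiff ?_
  unfold idempotentLoop
  have : ContDiff ℝ 1 fun s : ℝ => Complex.exp (2 * Real.pi * Complex.I * s) := by
    have h : ContDiff ℝ 1 fun s : ℝ => (s : ℂ) := Complex.ofRealCLM.contDiff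
    exact (contDiff_const.mul h).cexp
  fun_prop

theorem idempotentLoop_mul (he : IsIdempotentElem e) (s : ℝ) :
    idempotentLoop e s * (1 + ((Complex.exp (2 * Real.pi * Complex.I * s))⁻¹ - 1) • e) = 1 := by
  have h0 := Complex.exp_ne_zero (2 * Real.pi * Complex.I * s)
  set z := Complex.exp (2 * Real.pi * Complex.I * s) with hz
  simp only [idempotentLoop, ← hz, add_mul, mul_add, one_mul, mul_one, smul_mul_smul_comm, he.eq]
  rw [add_assoc, ← add_smul, ← add_smul]
  have : (z - 1) + (z⁻¹ - 1 + (z - 1) * (z⁻¹ - 1)) = 0 := by field_simp; ring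
  rw [this, zero_smul, add_zero]

theorem mul_idempotentLoop (he : IsIdempotentElem e) (s : ℝ) :
    (1 + ((Complex.exp (2 * Real.pi * Complex.I * s))⁻¹ - 1) • e) * idempotentLoop e s = 1 := by
  have := idempotentLoop_mul he (-s)
  simpa [idempotentLoop, Complex.exp_neg] using this

theorem isUnit_idempotentLoop (he : IsIdempotentElem e) (s : ℝ) : IsUnit (idempotentLoop e s) :=
  isUnit_iff_exists_and_exists.2 ⟨⟨_, idempotentLoop_mul he s⟩, ⟨_, mul_idempotentLoop he s⟩⟩

/-- The logarithmic derivative is the constant 2πi e. Integrality of windings thereby becomes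
integrality of traces of idempotents. -/
theorem wind_idempotentLoop (he : IsIdempotentElem e) :
    wind t (idempotentLoop e) = 2 * Real.pi * Complex.I * t e := by
  have h : ∀ s : ℝ, t (deriv (idempotentLoop e) s * Ring.inverse (idempotentLoop e s)) =
      2 * Real.pi * Complex.I * t e := fun s => by
    have h0 := Complex.exp_ne_zero (2 * Real.pi * Complex.I * s)
    have h1 : Ring.inverse (idempotentLoop e s) =
        1 + ((Complex.exp (2 * Real.pi * Complex.I * s))⁻¹ - 1) • e :=
      left_inv_eq_right_inv (Ring.inverse_mul_cancel _ (isUnit_idempotentLoop he s))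
        (idempotentLoop_mul he s)
    rw [(hasDerivAt_idempotentLoop s).deriv, h1]
    set z := Complex.exp (2 * Real.pi * Complex.I * s) with hz
    rw [mul_add, mul_one, smul_mul_smul_comm, he.eq, ← add_smul, map_smul, smul_eq_mul]
    congr 1
    field_simp; ring
  simp only [wind, h, intervalIntegral.integral_const, sub_zero, one_smul]

end Idempotent

/-! ### K₀(A) as the increasing union of the groups (1 / n_k) ℤ -/

section KZero

variable {A : Type*} [CStarAlgebra A]

namespace MatrixTower

variable (T : MatrixTower A)

/-- Square matrices with entries in a stage of the tower. -/
def matrixSubalgebra (n k : ℕ) : Subalgebra ℂ (CStarMatrix (Fin n) (Fin n) A) where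
  carrier := {M | ∀ i j, M i j ∈ T.B k}
  mul_mem' {M N} hM hN i j := by
    rw [CStarMatrix.mul_apply]
    exact sum_mem fun l _ => mul_mem (hM i l) (hN l j)
  add_mem' {M N} hM hN i j := add_mem (hM i j) (hN i j)
  algebraMap_mem' r i j := by
    rw [CStarMatrix.algebraMap_apply]
    split_ifs
    · exact algebraMap_mem _ _
    · exact zero_mem _

/-- Square matrices over a stage of the tower, as matrices over the stage. -/
def matrixSubalgebraHom (n k : ℕ) :
    T.matrixSubalgebra n k →ₐ[ℂ] Matrix (Fin n) (Fin n) (T.B k) :=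
  AlgHom.ofLinearMap
    { toFun := fun M => Matrix.of fun i j => ⟨M.1 i j, M.2 i j⟩
      map_add' := fun _ _ => rfl
      map_smul' := fun _ _ => rfl }
    (by
      ext i j
      change ((1 : CStarMatrix (Fin n) (Fin n) A) i j) = ((1 : Matrix (Fin n) (Fin n) (T.B k)) i j : A)
      rw [CStarMatrix.one_apply, Matrix.one_apply]
      split_ifs <;> rfl)
    (fun M N => by
      ext i j
      change (M.1 * N.1 : CStarMatrix (Fin n) (Fin n) A) i j = _
      rw [CStarMatrix.mul_apply, Matrix.mul_apply, AddSubmonoidClass.coe_finsetSum]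
      rfl)

/-- Square matrices over a stage of the tower, as complex matrices. -/
def complexMatrixHom (n k : ℕ) :
    T.matrixSubalgebra n k →ₐ[ℂ] Matrix (Fin (n * T.n k)) (Fin (n * T.n k)) ℂ :=
  ((Matrix.reindexAlgEquiv ℂ ℂ finProdFinEquiv).toAlgHom.comp
    ((Matrix.compAlgEquiv (Fin n) (Fin (T.n k)) ℂ ℂ).toAlgHom.comp
      ((T.e k).toAlgEquiv.toAlgHom.mapMatrix))).comp (T.matrixSubalgebraHom n k)

/-- The trace of a matrix over `A`. -/
def matrixTr (n : ℕ) (M : CStarMatrix (Fin n) (Fin n) A) : ℂ := ∑ i, tr A (M i i)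

theorem matrixTr_eq (n k : ℕ) (M : T.matrixSubalgebra n k) :
    matrixTr n (M : CStarMatrix (Fin n) (Fin n) A) = (T.n k : ℂ)⁻¹ * (T.complexMatrixHom n k M).trace := by
  have h1 : (T.complexMatrixHom n k M).trace =
      ∑ i, (T.e k ⟨M.1 i i, M.2 i i⟩).trace := by
    simp only [Matrix.trace]
    rw [← finProdFinEquiv.sum_comp, Fintype.sum_prod_type]
    simp [complexMatrixHom, Matrix.comp, matrixSubalgebraHom]
    rfl
  rw [h1, Finset.mul_sum]
  exact Finset.sum_congr rfl fun i _ =>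
    T.isTracialState_tr.eq_matrixTrace (T.pos k) (T.e k) ⟨M.1 i i, M.2 i i⟩

theorem dense_matrixSubalgebra (n : ℕ) :
    Dense (⋃ k, (T.matrixSubalgebra n k : Set (CStarMatrix (Fin n) (Fin n) A))) := by
  intro M
  have hK : IsCompact (range fun p : Fin n × Fin n => M p.1 p.2) := (finite_range _).isCompact
  have h : ∀ m : ℕ, ∃ N ∈ ⋃ k, (T.matrixSubalgebra n k : Set (CStarMatrix (Fin n) (Fin n) A)),
      ∀ i j, ‖M i j - N i j‖ < 1 / ((m : ℝ) + 1) := fun m => by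
    obtain ⟨k, hk⟩ := T.exists_approx hK (ε := 1 / ((m : ℝ) + 1)) (by positivity)
    choose! d hd hd' using hk k le_rfl
    exact ⟨CStarMatrix.ofMatrix (Matrix.of fun i j => d (M i j)),
      mem_iUnion.2 ⟨k, fun i j => hd _ ⟨(i, j), rfl⟩⟩, fun i j => hd' _ ⟨(i, j), rfl⟩⟩
  choose N hN hMN using h
  refine mem_closure_of_tendsto (b := atTop) (f := N) ?_ (Eventually.of_forall hN)
  refine tendsto_pi_nhds.2 fun i => tendsto_pi_nhds.2 fun j => ?_
  rw [tendsto_iff_norm_sub_tendsto_zero]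
  refine squeeze_zero (fun _ => norm_nonneg _) (fun m => ?_)
    (tendsto_one_div_add_atTop_nhds_zero_nat (𝕜 := ℝ))
  rw [norm_sub_rev]
  exact (hMN m i j).le

/-- Traces of idempotent matrices. -/
theorem exists_trace_idempotent {n : ℕ} {e : Matrix (Fin n) (Fin n) A} (he : e * e = e) :
    ∃ (k : ℕ) (m : ℤ), ∑ i, tr A (e i i) = (T.n k : ℂ)⁻¹ * m := by
  let _ := CStarAlgebra.spectralOrder A
  let _ := CStarAlgebra.spectralOrderedRing A
  let t : CStarMatrix (Fin n) (Fin n) A →L[ℂ] ℂ :=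
    { toFun := matrixTr n
      map_add' := fun M N => by simp [matrixTr, Finset.sum_add_distrib]
      map_smul' := fun c M => by simp [matrixTr, Finset.mul_sum]
      cont := by
        refine continuous_finsetSum _ fun i _ => T.trL.continuous.comp ?_
        exact (continuous_apply i).comp (continuous_apply i) }
  have ht : ∀ M N, t (M * N) = t (N * M) := fun M N => by
    change ∑ i, tr A ((M * N) i i) = ∑ i, tr A ((N * M) i i)
    simp only [CStarMatrix.mul_apply, map_sum]
    rw [Finset.sum_comm]
    simp only [T.isTracialState_tr.trace (M _ _)]
  have he' : IsIdempotentElem (CStarMatrix.ofMatrix e) := he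
  have : ∀ k, FiniteDimensional ℂ (T.matrixSubalgebra n k) := fun k => by
    have := finiteDimensional_of_matrix (T.e k)
    refine FiniteDimensional.of_injective (T.matrixSubalgebraHom n k).toLinearMap fun M N h => ?_
    refine Subtype.ext (CStarMatrix.ext fun i j => ?_)
    exact congrArg Subtype.val (congrFun (congrFun h i) j)
  -- Integrality is applied in M_n(A), filtered by the matrix algebras over the stages; e itself
  -- never has to be moved into a stage.
  obtain ⟨k, m, h⟩ := wind_of_dense (t := t) ht (T.matrixSubalgebra n)
    (fun k l hkl M hM i j => T.mono hkl (hM i j)) this (T.dense_matrixSubalgebra n)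
    (fun k => n * T.n k) (T.complexMatrixHom n) (fun k => (T.n k : ℂ)⁻¹) (T.matrixTr_eq n)
    (isPath_idempotentLoop (e := CStarMatrix.ofMatrix e)) (fun s _ => isUnit_idempotentLoop he' s)
    (by simp [idempotentLoop])
  rw [wind_idempotentLoop t he'] at h
  exact ⟨k, m, mul_left_cancel₀ Complex.two_pi_I_ne_zero h⟩

/-- A minimal projection of stage j has trace 1 / n_j; in stage k its trace is its rank over n_k. -/
theorem n_dvd {j k : ℕ} (h : j ≤ k) : T.n j ∣ T.n k := by
  have : NeZero (T.n j) := ⟨(T.pos j).ne'⟩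
  have h1 := trace_mUnit (T.e j) T.isTracialState_tr (T.pos j) 0 0
  rw [if_pos rfl] at h1
  have hm : mUnit (T.e j) 0 0 ∈ T.B k := T.mono h (mUnit_mem _ _ _)
  have h2 := T.isTracialState_tr.eq_matrixTrace (T.pos k) (T.e k) ⟨_, hm⟩
  have hid : IsIdempotentElem (⟨_, hm⟩ : T.B k) := Subtype.ext (by
    change mUnit (T.e j) 0 0 * mUnit (T.e j) 0 0 = _
    rw [mUnit_mul, if_pos rfl])
  have h3 := ((LinearMap.isProj_range_iff_isIdempotentElem _).2
    ((hid.map (T.e k)).map (Matrix.toLinAlgEquiv' (R := ℂ) (n := Fin (T.n k))))).trace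
  change LinearMap.trace ℂ _ (Matrix.toLin' _) = _ at h3
  rw [Matrix.trace_toLin'_eq] at h3
  rw [h3, h1] at h2
  have hj : (T.n j : ℂ) ≠ 0 := by exact_mod_cast (T.pos j).ne'
  have hk : (T.n k : ℂ) ≠ 0 := by exact_mod_cast (T.pos k).ne'
  field_simp at h2
  exact ⟨_, by exact_mod_cast h2⟩

/-- Traces of idempotents have this form, and the fractions form a group because the n_k are a
divisibility chain. Conversely 1 / n_k is the trace of a minimal projection of stage k. -/
theorem mem_K₀_top {x : ℝ} :
    x ∈ K₀ (⊤ : StarSubalgebra ℂ A) ↔ ∃ (k : ℕ) (m : ℤ), x = m / T.n k := by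
  constructor
  · intro hx
    refine AddSubgroup.closure_induction ?_ ⟨0, 0, by simp⟩ ?_ ?_ hx
    · rintro r ⟨n, e, he, -, hr⟩
      obtain ⟨k, m, h⟩ := T.exists_trace_idempotent he.isIdempotentElem
      refine ⟨k, m, Complex.ofReal_injective ?_⟩
      rw [hr, h]; push_cast; ring
    · rintro _ _ - - ⟨k, m, rfl⟩ ⟨l, m', rfl⟩
      obtain ⟨c, hc⟩ := T.n_dvd (le_max_left k l)
      obtain ⟨d, hd⟩ := T.n_dvd (le_max_right k l)
      refine ⟨max k l, m * c + m' * d, ?_⟩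
      have h1 : (T.n k : ℝ) ≠ 0 := by exact_mod_cast (T.pos k).ne'
      have h2 : (T.n l : ℝ) ≠ 0 := by exact_mod_cast (T.pos l).ne'
      have h3 : (T.n (max k l) : ℝ) ≠ 0 := by exact_mod_cast (T.pos _).ne'
      have hc' : (T.n (max k l) : ℝ) = T.n k * c := by exact_mod_cast hc
      have hd' : (T.n (max k l) : ℝ) = T.n l * d := by exact_mod_cast hd
      push_cast
      rw [add_div]
      congr 1
      · rw [div_eq_div_iff h1 h3, hc']; ring
      · rw [div_eq_div_iff h2 h3, hd']; ring
    · rintro _ - ⟨k, m, rfl⟩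
      exact ⟨k, -m, by push_cast; ring⟩
  · rintro ⟨k, m, rfl⟩
    have : NeZero (T.n k) := ⟨(T.pos k).ne'⟩
    have h : ((T.n k : ℝ)⁻¹) ∈ K₀ (⊤ : StarSubalgebra ℂ A) := by
      refine AddSubgroup.subset_closure ⟨1, Matrix.of fun _ _ => mUnit (T.e k) 0 0, ⟨?_, ?_⟩,
        fun _ _ => trivial, ?_⟩
      · refine Matrix.ext fun i j => ?_
        simp [Matrix.mul_apply, mUnit_mul]
      · refine Matrix.ext fun i j => ?_
        simp [Matrix.star_apply, star_mUnit]
      · simp [trace_mUnit (T.e k) T.isTracialState_tr (T.pos k)]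
    have := zsmul_mem h m
    rwa [zsmul_eq_mul, ← div_eq_mul_inv] at this

theorem wind_mem_K₀ {h : ℝ → A} (hh : IsPath h) (hu : ∀ s ∈ Icc (0 : ℝ) 1, IsUnit (h s))
    (hl : h 0 = h 1) : ∃ r ∈ K₀ (⊤ : StarSubalgebra ℂ A),
      wind T.trL h = 2 * Real.pi * Complex.I * (r : ℝ) := by
  obtain ⟨k, m, h⟩ := wind_of_dense T.isTracialState_tr.trace (t := T.trL)
    (fun k => (T.B k).toSubalgebra) (fun _ _ hkl => T.mono hkl)
    (fun k => finiteDimensional_of_matrix (T.e k)) T.dense T.n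
    (fun k => (T.e k).toAlgEquiv.toAlgHom) (fun k => (T.n k : ℂ)⁻¹)
    (fun k d => T.isTracialState_tr.eq_matrixTrace (T.pos k) (T.e k) d) hh hu hl
  refine ⟨m / T.n k, T.mem_K₀_top.2 ⟨k, m, rfl⟩, ?_⟩
  rw [h]; push_cast; ring

end MatrixTower

end KZero

end ZTwoUHF

end

noncomputable section

namespace ZTwoUHF

open Set Filter Topology MeasureTheory

/-! ### The standard embedding x ↦ x ⊗ 1 and its commutant -/

section Embedding

open Kronecker

variable {q m N : ℕ} (E : Fin q × Fin m ≃ Fin N)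

/-- The embedding of a full matrix algebra into a larger one. -/
def kroneckerHom : Matrix (Fin q) (Fin q) ℂ →⋆ₐ[ℂ] Matrix (Fin N) (Fin N) ℂ where
  toFun x := Matrix.reindex E E (x ⊗ₖ (1 : Matrix (Fin m) (Fin m) ℂ))
  map_one' := by simp
  map_zero' := by simp
  map_add' x y := by rw [Matrix.add_kronecker]; rfl
  map_mul' x y := by
    change _ = Matrix.reindexAlgEquiv ℂ ℂ E _ * Matrix.reindexAlgEquiv ℂ ℂ E _
    rw [← map_mul, ← Matrix.mul_kronecker_mul, one_mul]; rfl
  commutes' r := by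
    rw [Algebra.algebraMap_eq_smul_one, Matrix.smul_kronecker, Matrix.one_kronecker_one]
    change Matrix.reindexAlgEquiv ℂ ℂ E _ = _
    rw [map_smul, map_one, Algebra.algebraMap_eq_smul_one]
  map_star' x := by
    simp only [Matrix.star_eq_conjTranspose, Matrix.conjTranspose_reindex,
      Matrix.conjTranspose_kronecker, Matrix.conjTranspose_one]

theorem kroneckerHom_apply (x : Matrix (Fin q) (Fin q) ℂ) :
    kroneckerHom E x = Matrix.reindexAlgEquiv ℂ ℂ E (x ⊗ₖ (1 : Matrix (Fin m) (Fin m) ℂ)) := rfl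

theorem kroneckerHom_injective (hm : 0 < m) : Function.Injective (kroneckerHom E) := fun x y h => by
  have h1 := (Matrix.reindexAlgEquiv ℂ ℂ E).injective h
  ext i j
  have := congrFun (congrFun h1 (i, ⟨0, hm⟩)) (j, ⟨0, hm⟩)
  simpa using this

/-- A projection in the commutant of the embedded matrix algebra. -/
def kroneckerProj (i : Fin m) : Matrix (Fin N) (Fin N) ℂ :=
  Matrix.reindexAlgEquiv ℂ ℂ E ((1 : Matrix (Fin q) (Fin q) ℂ) ⊗ₖ Matrix.single i i 1)

theorem isStarProjection_kroneckerProj (i : Fin m) : IsStarProjection (kroneckerProj E i) := by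
  refine ⟨?_, ?_⟩
  · rw [IsIdempotentElem, kroneckerProj, ← map_mul, ← Matrix.mul_kronecker_mul]
    simp
  · change Matrix.conjTranspose (Matrix.reindex E E _) = Matrix.reindex E E _
    rw [Matrix.conjTranspose_reindex, Matrix.conjTranspose_kronecker]
    simp

theorem kroneckerProj_commute (i : Fin m) (x : Matrix (Fin q) (Fin q) ℂ) :
    kroneckerHom E x * kroneckerProj E i = kroneckerProj E i * kroneckerHom E x := by
  rw [kroneckerHom_apply, kroneckerProj, ← map_mul, ← map_mul, ← Matrix.mul_kronecker_mul,
    ← Matrix.mul_kronecker_mul, one_mul, one_mul, mul_one, mul_one]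

theorem trace_kroneckerProj (i : Fin m) : (kroneckerProj E i).trace = q := by
  have : (kroneckerProj E i).trace =
      ((1 : Matrix (Fin q) (Fin q) ℂ) ⊗ₖ Matrix.single i i (1 : ℂ)).trace := by
    rw [Matrix.trace, Matrix.trace, ← E.sum_comp]
    simp [kroneckerProj]
  rw [this, Matrix.trace_kronecker]
  simp

end Embedding

/-! ### K₀ and windings for the relative commutant of a matrix subalgebra -/

section RelativeCommutant

variable {A : Type*} [CStarAlgebra A]

theorem commute_of_mem_commutant {B : StarSubalgebra ℂ A} [FiniteDimensional ℂ B] {z b : A}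
    (hz : z ∈ commutant B) (hb : b ∈ B) : b * z = z * b := by
  refine Submodule.span_induction (p := fun b _ => b * z = z * b) (fun a ha => mem_commutant.1 hz a ha)
    (by simp) (fun a b _ _ ha hb => by rw [add_mul, mul_add, ha, hb])
    (fun c a _ ha => by rw [smul_mul_assoc, mul_smul_comm, ha]) (mem_span_U hb)

theorem ringInverse_mem_commutant {B : StarSubalgebra ℂ A} {z : A} (hz : z ∈ commutant B)
    (hu : IsUnit z) : Ring.inverse z ∈ commutant B := by
  refine mem_commutant.2 fun a ha => ?_
  have h := mem_commutant.1 hz a ha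
  calc a * Ring.inverse z = Ring.inverse z * (z * a) * Ring.inverse z := by
        rw [← mul_assoc, Ring.inverse_mul_cancel _ hu, one_mul]
    _ = Ring.inverse z * a := by
        rw [← h, mul_assoc, mul_assoc, Ring.mul_inverse_cancel _ hu, mul_one]

namespace MatrixTower

variable (T : MatrixTower A) {q : ℕ} (hq : 0 < q) {A₀ : StarSubalgebra ℂ A}
  (e : A₀ ≃⋆ₐ[ℂ] Matrix (Fin q) (Fin q) ℂ)

/-- The embedding of a matrix algebra into a stage of the tower. -/
def embedding {k m : ℕ} (hk : T.n k = q * m) : Matrix (Fin q) (Fin q) ℂ →⋆ₐ[ℂ] A :=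
  (T.B k).subtype.comp (((T.e k).symm : _ →⋆ₐ[ℂ] _).comp
    (kroneckerHom (finProdFinEquiv.trans (finCongr hk.symm))))

theorem exists_isMatrixSubalgebra {k : ℕ} (h : q ∣ T.n k) :
    ∃ A₀ : StarSubalgebra ℂ A, IsMatrixSubalgebra q A₀ := by
  obtain ⟨m, hm⟩ := h
  have hm0 : 0 < m := Nat.pos_of_ne_zero fun h0 => (T.pos k).ne' (by rw [hm, h0, mul_zero])
  have hinj : Function.Injective (T.embedding hm) := fun x y hxy =>
    kroneckerHom_injective _ hm0 ((T.e k).symm.injective (Subtype.val_injective hxy))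
  exact ⟨(T.embedding hm).range, ⟨(StarAlgEquiv.ofInjective _ hinj).symm⟩⟩

include T hq in
-- As x commutes with the matrix units, all the x e_jj have the same trace, and they sum to x.
theorem tr_mul_mUnit {x : A} (hx : ∀ b ∈ A₀, b * x = x * b) (i : Fin q) :
    tr A (x * mUnit e i i) = (q : ℂ)⁻¹ * tr A x := by
  have hτ := T.isTracialState_tr
  have h1 : ∀ j, tr A (x * mUnit e j j) = tr A (x * mUnit e i i) := fun j => by
    have e1 := mUnit_mul e j i i j
    have e2 := mUnit_mul e i j j i
    rw [if_pos rfl] at e1 e2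
    rw [← e1, ← e2, ← mul_assoc, ← mul_assoc, hτ.trace, ← mul_assoc, hx _ (mUnit_mem e i j)]
  have h2 : tr A x = ∑ j, tr A (x * mUnit e j j) := by
    rw [← map_sum, ← Finset.mul_sum, sum_mUnit, mul_one]
  rw [h2, Finset.sum_congr rfl fun j _ => h1 j]
  have : (q : ℂ) ≠ 0 := by exact_mod_cast hq.ne'
  simp only [Finset.sum_const, Finset.card_univ, Fintype.card_fin, nsmul_eq_mul]
  field_simp

include T hq e in
-- The trace 1/q of a minimal projection of A₀ must be a fraction with some denominator n_k.
theorem exists_dvd : ∃ k, q ∣ T.n k := by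
  have : NeZero q := ⟨hq.ne'⟩
  obtain ⟨k, m, h⟩ := T.exists_trace_idempotent (n := 1) (e := Matrix.of fun _ _ => mUnit e 0 0)
    (Matrix.ext fun i j => by simp [Matrix.mul_apply, mUnit_mul])
  refine ⟨k, ?_⟩
  simp only [Finset.univ_unique, Finset.sum_singleton, Matrix.of_apply,
    trace_mUnit e T.isTracialState_tr hq, if_true] at h
  have h1 : (q : ℂ) ≠ 0 := by exact_mod_cast hq.ne'
  have h2 : (T.n k : ℂ) ≠ 0 := by exact_mod_cast (T.pos k).ne'
  field_simp at h
  have h3 : (T.n k : ℤ) = q * m := by exact_mod_cast h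
  exact Int.natCast_dvd_natCast.1 ⟨m, h3⟩

include T hq e in
-- Multiplying a projection over A ∩ A₀' by a minimal projection of A₀ divides its trace by q.
-- Conversely, if n_k = q m, a projection 1 ⊗ e in M_q ⊗ M_m provides trace 1/m in the commutant,
-- and the numbers q a / n_k are multiples of such 1/m.
theorem mem_K₀_centralizer {x : ℝ} :
    x ∈ K₀ (StarSubalgebra.centralizer ℂ (A₀ : Set A)) ↔ x / q ∈ K₀ (⊤ : StarSubalgebra ℂ A) := by
  have hq0 : (q : ℝ) ≠ 0 := by exact_mod_cast hq.ne'
  have : NeZero q := ⟨hq.ne'⟩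
  constructor
  · intro hx
    refine AddSubgroup.closure_induction (p := fun x _ => x / (q : ℝ) ∈ K₀ (⊤ : StarSubalgebra ℂ A))
      ?_ (by simp) (fun x y _ _ hx hy => ?_) (fun x _ hx => ?_) hx
    · rintro r ⟨n, f, hf, hfc, hr⟩
      have hc : ∀ i j, ∀ b ∈ A₀, b * f i j = f i j * b := fun i j b hb =>
        ((StarSubalgebra.mem_centralizer_iff ℂ).1 (hfc i j) b hb).1
      have hid : (f.map (· * mUnit e 0 0)) * (f.map (· * mUnit e 0 0)) =
          f.map (· * mUnit e 0 0) := by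
        refine Matrix.ext fun i j => ?_
        have h1 : ∀ l, f i l * mUnit e 0 0 * (f l j * mUnit e 0 0) =
            f i l * f l j * mUnit e 0 0 := fun l => by
          rw [← mul_assoc, mul_assoc (f i l), hc _ _ _ (mUnit_mem e 0 0), mul_assoc, mul_assoc,
            mUnit_mul, if_pos rfl, mul_assoc]
        rw [Matrix.mul_apply]
        simp only [Matrix.map_apply, h1]
        rw [← Finset.sum_mul, ← Matrix.mul_apply, hf.isIdempotentElem.eq]
      obtain ⟨k, m, h⟩ := T.exists_trace_idempotent hid
      refine T.mem_K₀_top.2 ⟨k, m, Complex.ofReal_injective ?_⟩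
      simp only [Matrix.map_apply, T.tr_mul_mUnit hq e (hc _ _)] at h
      rw [← Finset.mul_sum, ← hr] at h
      push_cast
      rw [div_eq_inv_mul, h, div_eq_inv_mul]
    · rw [add_div]; exact add_mem hx hy
    · rw [neg_div]; exact neg_mem hx
  · intro hx
    obtain ⟨k₁, a, ha⟩ := T.mem_K₀_top.1 hx
    obtain ⟨k₂, hk₂⟩ := T.exists_dvd hq e
    set k := max k₁ k₂
    obtain ⟨c, hc⟩ := T.n_dvd (le_max_left k₁ k₂)
    obtain ⟨m, hm⟩ := hk₂.trans (T.n_dvd (le_max_right k₁ k₂))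
    have hm0 : 0 < m := Nat.pos_of_ne_zero fun h0 => (T.pos k).ne' (by rw [hm, h0, mul_zero])
    have hm1 : (m : ℝ) ≠ 0 := by exact_mod_cast hm0.ne'
    have key : ((m : ℝ)⁻¹) ∈ K₀ (StarSubalgebra.centralizer ℂ (A₀ : Set A)) := by
      -- A₀ need not lie in the stage, but it is unitarily conjugate to the standard copy of M_q
      -- there.
      obtain ⟨u, hu, huc⟩ := exists_unitary_conj T hq e ((T.embedding hm).comp (e : A₀ →⋆ₐ[ℂ] _))
      set E := finProdFinEquiv.trans (finCongr hm.symm)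
      set P : A := (((T.e k).symm (kroneckerProj E ⟨0, hm0⟩) : T.B k) : A) with hP
      have hPs : IsStarProjection P := by
        have h := isStarProjection_kroneckerProj E ⟨0, hm0⟩
        refine ⟨?_, ?_⟩
        · have h1 := (h.isIdempotentElem.map (T.e k).symm).map (T.B k).subtype
          exact h1
        · have h1 := (h.isSelfAdjoint.map (T.e k).symm).map (T.B k).subtype
          exact h1
      have hPt : tr A P = (m : ℂ)⁻¹ := by
        rw [hP, T.isTracialState_tr.eq_matrixTrace (T.pos k) (T.e k), StarAlgEquiv.apply_symm_apply,
          trace_kroneckerProj, hm]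
        have hq1 : (q : ℂ) ≠ 0 := by exact_mod_cast hq.ne'
        push_cast
        field_simp
      have hPc : ∀ x, T.embedding hm x * P = P * T.embedding hm x := fun x => by
        have h1 := congrArg (fun y => (((T.e k).symm y : T.B k) : A))
          (kroneckerProj_commute E ⟨0, hm0⟩ x)
        simp only [map_mul] at h1
        exact h1
      have hu1 := (Unitary.mem_iff.1 hu).1
      have hu2 := (Unitary.mem_iff.1 hu).2
      have hcomm : ∀ b ∈ A₀, b * (star u * P * u) = star u * P * u * b := fun b hb => by
        have h1 : u * b * star u = T.embedding hm (e ⟨b, hb⟩) := (huc ⟨b, hb⟩).symm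
        calc b * (star u * P * u) = star u * ((u * b * star u) * P) * u := by
              simp only [← mul_assoc, hu1, one_mul]
          _ = star u * (P * (u * b * star u)) * u := by rw [h1, hPc]
          _ = star u * P * u * b := by simp only [mul_assoc, hu1, mul_one]
      refine AddSubgroup.subset_closure ⟨1, Matrix.of fun _ _ => star u * P * u, ⟨?_, ?_⟩,
        fun _ _ => ?_, ?_⟩
      · refine Matrix.ext fun i j => ?_
        have : star u * P * u * (star u * P * u) = star u * P * u := by
          calc star u * P * u * (star u * P * u) = star u * P * (u * star u) * P * u := by
                simp only [mul_assoc]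
            _ = star u * (P * P) * u := by rw [hu2, mul_one, mul_assoc (star u)]
            _ = _ := by rw [hPs.isIdempotentElem.eq]
        simp [Matrix.mul_apply, this]
      · refine Matrix.ext fun i j => ?_
        simp [Matrix.star_apply, hPs.isSelfAdjoint.star_eq, mul_assoc]
      · refine (StarSubalgebra.mem_centralizer_iff ℂ).2 fun b hb => ⟨hcomm b hb, hcomm _ ?_⟩
        exact star_mem (s := A₀) hb
      · simp only [Finset.univ_unique, Finset.sum_singleton, Matrix.of_apply]
        rw [T.isTracialState_tr.trace, ← mul_assoc, hu2, one_mul, hPt]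
        push_cast; rfl
    have h1 := zsmul_mem key (a * c)
    have h2 : x = (a * c : ℤ) • ((m : ℝ)⁻¹) := by
      have h3 : (T.n k₁ : ℝ) ≠ 0 := by exact_mod_cast (T.pos k₁).ne'
      have h4 : (q : ℝ) * m = T.n k₁ * c := by
        have : (q * m : ℕ) = T.n k₁ * c := hm.symm.trans hc
        exact_mod_cast this
      rw [zsmul_eq_mul]
      field_simp at ha ⊢
      push_cast
      refine mul_left_cancel₀ (mul_ne_zero h3 hq0) ?_
      linear_combination (q : ℝ) * m * ha + a * q * h4
    rwa [h2]

include T hq e in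
/-- Loops of invertible elements that almost commute with a full matrix subalgebra. -/
theorem wind_mem_K₀_centralizer {h : ℝ → A} (hh : IsPath h)
    (hu : ∀ s ∈ Icc (0 : ℝ) 1, h s ∈ unitary A) (hl : h 0 = h 1) {r : ℝ} (hr : r < 1)
    (hc : ∀ s ∈ Icc (0 : ℝ) 1, ∀ a ∈ U A₀, ‖h s * a - a * h s‖ ≤ r) :
    ∃ x ∈ K₀ (StarSubalgebra.centralizer ℂ (A₀ : Set A)),
      wind T.trL h = 2 * Real.pi * Complex.I * (x : ℝ) := by
  have := finiteDimensional_of_matrix e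
  have : NeZero q := ⟨hq.ne'⟩
  have hq0 : (q : ℂ) ≠ 0 := by exact_mod_cast hq.ne'
  have hunit : ∀ s ∈ Icc (0 : ℝ) 1, IsUnit (h s) := fun s hs =>
    Unitary.isUnit_coe (U := ⟨h s, hu s hs⟩)
  -- Averaging moves h by at most r < 1 into the commutant of A₀, which changes neither
  -- invertibility nor the winding.
  set y : ℝ → A := fun s => avg A₀ (h s) with hy
  have hyp : IsPath y := hh.clm_comp ((avg A₀).restrictScalars ℝ)
  have hyc : ∀ s, y s ∈ commutant A₀ := fun s => avg_mem_commutant _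
  have hyh : ∀ s ∈ Icc (0 : ℝ) 1, ‖y s - h s‖ ≤ r := fun s hs => norm_avg_sub_le (hc s hs)
  have hyu : ∀ s ∈ Icc (0 : ℝ) 1, IsUnit (y s) := fun s hs =>
    isUnit_of_norm_sub_unitary_lt (hu s hs) ((hyh s hs).trans_lt hr)
  have hw1 : wind T.trL y = wind T.trL h := by
    refine wind_eq_of_close T.isTracialState_tr.trace hyp hh hyu hunit (fun s hs => ?_) ?_
    · have h1 : Ring.inverse (h s) = star (h s) :=
        left_inv_eq_right_inv (Ring.inverse_mul_cancel _ (hunit s hs))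
          (Unitary.mem_iff.1 (hu s hs)).2
      rw [h1, ← (Unitary.mem_iff.1 (hu s hs)).2, ← sub_mul]
      exact (norm_mul_le _ _).trans_lt ((mul_le_of_le_one_right (norm_nonneg _)
        (norm_le_one_of_unitary (Unitary.star_mem (hu s hs)))).trans_lt ((hyh s hs).trans_lt hr))
    · simp only [hy, hl]
  set p := mUnit e 0 0
  have hpp : p * p = p := by rw [mUnit_mul, if_pos rfl]
  have hp1 : p * (1 - p) = 0 := by rw [mul_sub, mul_one, hpp, sub_self]
  have hp2 : (1 - p) * p = 0 := by rw [sub_mul, one_mul, hpp, sub_self]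
  have hp3 : (1 - p) * (1 - p) = 1 - p := by rw [sub_mul, one_mul, hp1, sub_zero]
  have hpc : ∀ z ∈ commutant A₀, p * z = z * p := fun z hz =>
    commute_of_mem_commutant hz (mUnit_mem e 0 0)
  have hmul : ∀ z ∈ commutant A₀, ∀ z' ∈ commutant A₀,
      (z * p + (1 - p)) * (z' * p + (1 - p)) = z * z' * p + (1 - p) := fun z _ z' hz' => by
    rw [add_mul, mul_add, mul_add, hp3]
    have a1 : z * p * (z' * p) = z * z' * p := by
      rw [← mul_assoc, mul_assoc z, hpc z' hz', ← mul_assoc, mul_assoc _ p, hpp]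
    have a2 : z * p * (1 - p) = 0 := by rw [mul_assoc, hp1, mul_zero]
    have a3 : (1 - p) * (z' * p) = 0 := by rw [← hpc z' hz', ← mul_assoc, hp2, zero_mul]
    rw [a1, a2, a3, add_zero, zero_add]
  -- The corner of y at a minimal projection, completed by 1 - p to an invertible of A. Its
  -- logarithmic derivative is p times that of y, so its winding is 1/q of the original.
  set g : ℝ → A := fun s => y s * p + (1 - p) with hg
  have hgp : IsPath g := (hyp.mul (isPath_const p)).add (isPath_const _)
  have hgi : ∀ s ∈ Icc (0 : ℝ) 1, g s * (Ring.inverse (y s) * p + (1 - p)) = 1 ∧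
      (Ring.inverse (y s) * p + (1 - p)) * g s = 1 := fun s hs => by
    have hi := ringInverse_mem_commutant (hyc s) (hyu s hs)
    refine ⟨?_, ?_⟩
    · rw [hg, hmul _ (hyc s) _ hi, Ring.mul_inverse_cancel _ (hyu s hs), one_mul, add_sub_cancel]
    · rw [hg, hmul _ hi _ (hyc s), Ring.inverse_mul_cancel _ (hyu s hs), one_mul, add_sub_cancel]
  have hgu : ∀ s ∈ Icc (0 : ℝ) 1, IsUnit (g s) := fun s hs =>
    isUnit_iff_exists_and_exists.2 ⟨⟨_, (hgi s hs).1⟩, ⟨_, (hgi s hs).2⟩⟩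
  obtain ⟨F, hF, hdF⟩ := hh.differentiable
  have hw2 : wind T.trL g = (q : ℂ)⁻¹ * wind T.trL y := by
    rw [wind, wind, ← intervalIntegral.integral_const_mul]
    refine intervalIntegral.integral_congr_ae (ae_Ioo_diff hF fun s hs => ?_)
    have hs' := Ioo_subset_Icc_self hs.1
    have hd : HasDerivAt y (avg A₀ (deriv h s)) s :=
      ((avg A₀).restrictScalars ℝ).hasFDerivAt.comp_hasDerivAt s (hdF s hs).hasDerivAt
    have hd2 : HasDerivAt g (avg A₀ (deriv h s) * p) s := (hd.mul_const p).add_const _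
    have hi := ringInverse_mem_commutant (hyc s) (hyu s hs')
    have hgin : Ring.inverse (g s) = Ring.inverse (y s) * p + (1 - p) :=
      left_inv_eq_right_inv (Ring.inverse_mul_cancel _ (hgu s hs')) (hgi s hs').1
    rw [hd.deriv, hd2.deriv, hgin, mul_add, mul_assoc _ p (1 - p), hp1, mul_zero, add_zero,
      mul_assoc, ← mul_assoc p, hpc _ hi, mul_assoc _ p p, hpp, ← mul_assoc]
    refine T.tr_mul_mUnit hq e (fun b hb => ?_) 0
    exact commute_of_mem_commutant (mul_mem (avg_mem_commutant _) hi) hb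
  obtain ⟨x, hx, hxw⟩ := T.wind_mem_K₀ hgp hgu (by simp only [hg, hy, hl])
  refine ⟨q * x, (T.mem_K₀_centralizer hq e).2 ?_, ?_⟩
  · rwa [mul_div_cancel_left₀ _ (by exact_mod_cast hq.ne')]
  · rw [← hw1]
    rw [hw2] at hxw
    field_simp at hxw
    rw [hxw]; push_cast; ring

end MatrixTower

end RelativeCommutant

end ZTwoUHF

end

noncomputable section

namespace ZTwoUHF

open Set Filter Topology MeasureTheory

/-! ### Piecewise smooth unitary paths -/

section Bridge

variable {A : Type*} [CStarAlgebra A]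

theorem intervalIntegrable_deriv_of_contDiffOn {h : ℝ → A} {a b : ℝ} (hab : a < b)
    (hh : ContDiffOn ℝ ∞ h (Icc a b)) : IntervalIntegrable (deriv h) volume a b := by
  have h1 : ContinuousOn (derivWithin h (Icc a b)) (uIcc a b) := by
    rw [uIcc_of_le hab.le]
    exact hh.continuousOn_derivWithin (uniqueDiffOn_Icc hab) (by simp)
  refine h1.intervalIntegrable.congr_ae ?_
  rw [EventuallyEq, ae_restrict_iff' measurableSet_uIoc]
  have h2 : ∀ᵐ s ∂(volume : Measure ℝ), s ∉ ({b} : Set ℝ) := (countable_singleton _).ae_notMem _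
  filter_upwards [h2] with s hs hs'
  rw [uIoc_of_le hab.le] at hs'
  exact derivWithin_of_mem_nhds (Icc_mem_nhds hs'.1 (lt_of_le_of_ne hs'.2 hs))

/-- The breakpoints form the exceptional set; on each piece the derivative agrees almost everywhere
with a continuous function. -/
theorem IsUnitaryPath.isPath {h : ℝ → A} (hh : IsUnitaryPath h) : IsPath h := by
  obtain ⟨n, t, ht, h0, h1, hs⟩ := hh.piecewise
  refine ⟨hh.continuousOn, ⟨range t, countable_range t, ?_⟩, ?_⟩
  · suffices H : ∀ i, ∀ s ∈ Ioo (0 : ℝ) (t i) \ range t, DifferentiableAt ℝ h s by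
      have := H (Fin.last n)
      rwa [h1] at this
    intro i
    induction i using Fin.induction with
    | zero => rw [h0]; simp
    | succ i ih =>
      rintro s ⟨hs', hsr⟩
      rcases lt_trichotomy s (t i.castSucc) with hlt | heq | hgt
      · exact ih s ⟨⟨hs'.1, hlt⟩, hsr⟩
      · exact absurd ⟨_, heq.symm⟩ hsr
      · exact ((hs i).contDiffAt (Icc_mem_nhds hgt hs'.2)).differentiableAt (by simp)
  · suffices H : ∀ i, IntervalIntegrable (deriv h) volume 0 (t i) by
      have := H (Fin.last n)
      rwa [h1] at this
    intro i
    induction i using Fin.induction with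
    | zero => rw [h0]
    | succ i ih =>
      exact ih.trans (intervalIntegrable_deriv_of_contDiffOn (ht i.castSucc_lt_succ) (hs i))

theorem isUnit_of_unitary {u : A} (hu : u ∈ unitary A) : IsUnit u :=
  Unitary.isUnit_coe (U := ⟨u, hu⟩)

theorem ringInverse_of_unitary {u : A} (hu : u ∈ unitary A) : Ring.inverse u = star u :=
  left_inv_eq_right_inv (Ring.inverse_mul_cancel _ (isUnit_of_unitary hu)) (Unitary.mem_iff.1 hu).2

theorem winding_eq (T : MatrixTower A) {h : ℝ → A} (hu : ∀ s ∈ Icc (0 : ℝ) 1, h s ∈ unitary A) :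
    winding h = ((2 * Real.pi * Complex.I)⁻¹ * wind T.trL h).re := by
  rw [winding, wind]
  congr 2
  refine intervalIntegral.integral_congr fun s hs => ?_
  rw [uIcc_of_le zero_le_one] at hs
  simp only [ringInverse_of_unitary (hu s hs)]
  rfl

theorem winding_of_wind_eq (T : MatrixTower A) {h : ℝ → A}
    (hu : ∀ s ∈ Icc (0 : ℝ) 1, h s ∈ unitary A) {x : ℝ}
    (hx : wind T.trL h = 2 * Real.pi * Complex.I * x) : winding h = x := by
  rw [winding_eq T hu, hx, inv_mul_cancel_left₀ Complex.two_pi_I_ne_zero, Complex.ofReal_re]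

theorem winding_mul (T : MatrixTower A) {h k : ℝ → A} (hh : IsPath h) (hk : IsPath k)
    (hu : ∀ s ∈ Icc (0 : ℝ) 1, h s ∈ unitary A) (ku : ∀ s ∈ Icc (0 : ℝ) 1, k s ∈ unitary A) :
    winding (fun s => h s * k s) = winding h + winding k := by
  rw [winding_eq T hu, winding_eq T ku, winding_eq T fun s hs => mul_mem (hu s hs) (ku s hs),
    wind_mul T.isTracialState_tr.trace hh hk (fun s hs => isUnit_of_unitary (hu s hs))
      fun s hs => isUnit_of_unitary (ku s hs), mul_add, Complex.add_re]

theorem IsPath.star {h : ℝ → A} (hh : IsPath h) : IsPath fun s => star (h s) :=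
  hh.clm_comp ((starL' ℝ : A ≃L[ℝ] A) : A →L[ℝ] A)

theorem winding_star (T : MatrixTower A) {h : ℝ → A} (hh : IsPath h)
    (hu : ∀ s ∈ Icc (0 : ℝ) 1, h s ∈ unitary A) :
    winding (fun s => star (h s)) = - winding h := by
  have h1 := winding_mul T hh hh.star hu fun s hs => Unitary.star_mem (hu s hs)
  have h2 : winding (fun s => h s * Star.star (h s)) = 0 := by
    refine winding_of_wind_eq T (fun s hs => mul_mem (hu s hs) (Unitary.star_mem (hu s hs))) ?_
    rw [wind_congr T.trL (k := fun _ => 1)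
      fun s hs => (Unitary.mem_iff.1 (hu s (Ioo_subset_Icc_self hs))).2, wind_const]
    simp
  linarith

end Bridge

/-! ### Arithmetic of K₀(A) at a prime -/

section Arithmetic

variable {A : Type*} [CStarAlgebra A] (T : MatrixTower A)

/-- A finite supremum of a nonempty set in ℕ∞ is attained. The set is nonempty because the supremum
of the empty set is 0, against 1 ≤ ζ(p). -/
theorem exists_mul_eq_one {p : ℕ} (hp : p ∈ primeSet A) :
    ∃ x ∈ K₀ (⊤ : StarSubalgebra ℂ A), (θ A p : ℝ) * x = 1 := by
  have h1 : ζ A p < ⊤ := hp.2.2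
  have hne : Nonempty {k : ℕ∞ | ∃ j : ℕ, k = j ∧
      ∃ x ∈ K₀ (⊤ : StarSubalgebra ℂ A), (p : ℝ) ^ j * x = 1} := by
    by_contra hemp
    have h2 : ζ A p = 0 := by
      rw [ζ, not_nonempty_iff_eq_empty'.1 hemp, sSup_empty]; rfl
    have := hp.2.1
    rw [h2] at this
    simp at this
  obtain ⟨j, hj, x, hx, hx1⟩ := ENat.sSup_mem_of_nonempty_of_lt_top h1
  refine ⟨x, hx, ?_⟩
  have h3 : (ζ A p).toNat = j := by
    rw [ζ, hj, ENat.toNat_natCast]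
  rw [θ, h3]
  exact_mod_cast hx1

theorem not_exists_mul_eq_one {p : ℕ} (hp : p ∈ primeSet A) :
    ¬ ∃ x ∈ K₀ (⊤ : StarSubalgebra ℂ A), ((p * θ A p : ℕ) : ℝ) * x = 1 := by
  rintro ⟨x, hx, h⟩
  have h1 : (((ζ A p).toNat + 1 : ℕ) : ℕ∞) ≤ ζ A p := le_sSup ⟨_, rfl, x, hx, by
    rw [← h, θ, pow_succ]; push_cast; ring⟩
  rw [← ENat.natCast_toNat hp.2.2.ne, ENat.toNat_natCast] at h1
  have := Nat.cast_le.1 h1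
  omega

theorem θ_pos {p : ℕ} (hp : p ∈ primeSet A) : 0 < θ A p := pow_pos hp.1.pos _

theorem inv_mem_iff {N : ℕ} (hN : 0 < N) :
    (∃ x ∈ K₀ (⊤ : StarSubalgebra ℂ A), (N : ℝ) * x = 1) ↔ ∃ k, N ∣ T.n k := by
  have hN0 : (N : ℝ) ≠ 0 := by exact_mod_cast hN.ne'
  constructor
  · rintro ⟨x, hx, h⟩
    obtain ⟨k, a, rfl⟩ := T.mem_K₀_top.1 hx
    have hk : (T.n k : ℝ) ≠ 0 := by exact_mod_cast (T.pos k).ne'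
    field_simp at h
    have h3 : (T.n k : ℤ) = N * a := by exact_mod_cast h.symm
    exact ⟨k, Int.natCast_dvd_natCast.1 ⟨a, h3⟩⟩
  · rintro ⟨k, a, h⟩
    have hk : (T.n k : ℝ) ≠ 0 := by exact_mod_cast (T.pos k).ne'
    refine ⟨a / T.n k, T.mem_K₀_top.2 ⟨k, a, by push_cast; rfl⟩, ?_⟩
    have : (T.n k : ℝ) = N * a := by exact_mod_cast h
    field_simp
    exact this.symm

/-- A representation of an element of `K₀(A)` with a denominator `θ(p) m`, with `m` prime to `p`. -/
theorem exists_coprime_repr {p : ℕ} (hp : p ∈ primeSet A) {x : ℝ}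
    (hx : x ∈ K₀ (⊤ : StarSubalgebra ℂ A)) : ∃ (k m : ℕ) (a : ℤ), T.n k = θ A p * m ∧ 0 < m ∧
      Nat.Coprime m (θ A p) ∧ x = a / T.n k := by
  obtain ⟨k₁, a, rfl⟩ := T.mem_K₀_top.1 hx
  obtain ⟨k₂, hk₂⟩ := (inv_mem_iff T (θ_pos hp)).1 (exists_mul_eq_one hp)
  obtain ⟨c, hc⟩ := T.n_dvd (le_max_left k₁ k₂)
  obtain ⟨m, hm⟩ := hk₂.trans (T.n_dvd (le_max_right k₁ k₂))
  refine ⟨max k₁ k₂, m, a * c, hm, Nat.pos_of_ne_zero fun h0 => (T.pos _).ne' (by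
    rw [hm, h0, mul_zero]), ?_, ?_⟩
  · refine Nat.Coprime.pow_right _ ((Nat.coprime_comm.1 ((Nat.Prime.coprime_iff_not_dvd hp.1).2 ?_)))
    -- If p divided m, then p θ(p) would divide n_k, against the maximality of ζ(p).
    rintro ⟨d, rfl⟩
    exact not_exists_mul_eq_one hp ((inv_mem_iff T (Nat.mul_pos hp.1.pos (θ_pos hp))).2
      ⟨_, d, hm.trans (by ring)⟩)
  · have h1 : (T.n k₁ : ℝ) ≠ 0 := by exact_mod_cast (T.pos _).ne'
    have h2 : (T.n (max k₁ k₂) : ℝ) ≠ 0 := by exact_mod_cast (T.pos _).ne'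
    have hc' : (T.n (max k₁ k₂) : ℝ) = T.n k₁ * c := by exact_mod_cast hc
    rw [div_eq_div_iff h1 h2, hc']; push_cast; ring

include T in
theorem exists_int_sub_mem {p : ℕ} (hp : p ∈ primeSet A) {x : ℝ}
    (hx : x ∈ K₀ (⊤ : StarSubalgebra ℂ A)) :
    ∃ j : ℤ, (x - j / θ A p) / θ A p ∈ K₀ (⊤ : StarSubalgebra ℂ A) := by
  obtain ⟨k, m, a, hk, hm, hc, rfl⟩ := exists_coprime_repr T hp hx
  -- The square is needed because the difference x - j / θ(p), with x over θ(p) m, is divided by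
  -- θ(p) once more.
  obtain ⟨u, v, huv⟩ := (Nat.isCoprime_iff_coprime.2 (hc.pow_right 2))
  refine ⟨a * u, T.mem_K₀_top.2 ⟨k, a * v * θ A p, ?_⟩⟩
  have h1 : (θ A p : ℝ) ≠ 0 := by exact_mod_cast (θ_pos hp).ne'
  have h2 : (m : ℝ) ≠ 0 := by exact_mod_cast hm.ne'
  have h3 : (u : ℝ) * m + v * θ A p ^ 2 = 1 := by exact_mod_cast huv
  rw [hk]
  push_cast
  field_simp
  linear_combination (-(a : ℝ)) * h3

include T in
-- Together with `exists_int_sub_mem`, this is the isomorphism of K₀(A) / θ(p) K₀(A) with ℤ/θ(p):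
-- one gives surjectivity and the other the kernel of j ↦ j / θ(p).
theorem int_div_mem_iff {p : ℕ} (hp : p ∈ primeSet A) {j : ℤ} :
    ((j : ℝ) / θ A p) / θ A p ∈ K₀ (⊤ : StarSubalgebra ℂ A) ↔ (θ A p : ℤ) ∣ j := by
  have h1 : (θ A p : ℝ) ≠ 0 := by exact_mod_cast (θ_pos hp).ne'
  constructor
  · intro hx
    obtain ⟨k, m, a, hk, hm, hc, h⟩ := exists_coprime_repr T hp hx
    have h2 : (m : ℝ) ≠ 0 := by exact_mod_cast hm.ne'
    rw [hk] at h
    push_cast at h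
    field_simp at h
    have h3 : j * (m : ℤ) = θ A p * a := by
      have : (j : ℝ) * m = θ A p * a := by linear_combination h
      exact_mod_cast this
    exact (Nat.isCoprime_iff_coprime.2 hc.symm).dvd_of_dvd_mul_right ⟨a, h3⟩
  · rintro ⟨c, rfl⟩
    obtain ⟨x, hx, hx1⟩ := exists_mul_eq_one hp
    have : (((θ A p : ℤ) * c : ℤ) : ℝ) / θ A p / θ A p = c • x := by
      rw [zsmul_eq_mul]
      push_cast
      field_simp
      linear_combination (-(c : ℝ)) * hx1
    rw [this]
    exact zsmul_mem hx c

end Arithmetic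

end ZTwoUHF

end

noncomputable section

namespace ZTwoUHF

open Set Filter Topology MeasureTheory

/-! ### Commutator estimates -/

section Commutators

variable {A : Type*} [CStarAlgebra A]

theorem norm_comm_perturb {x : A} (hx : ‖x‖ ≤ 1) (a b : A) :
    ‖x * a - a * x‖ ≤ ‖x * b - b * x‖ + 2 * ‖a - b‖ := by
  have h : x * a - a * x = (x * b - b * x) + (x * (a - b) - (a - b) * x) := by noncomm_ring
  rw [h]
  refine (norm_add_le _ _).trans (add_le_add le_rfl ((norm_sub_le _ _).trans ?_))
  have h1 := (norm_mul_le x (a - b)).trans (mul_le_of_le_one_left (norm_nonneg _) hx)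
  have h2 := (norm_mul_le (a - b) x).trans (mul_le_of_le_one_right (norm_nonneg _) hx)
  linarith

theorem norm_comm_mul_le {x y : A} (hx : ‖x‖ ≤ 1) (hy : ‖y‖ ≤ 1) (a : A) :
    ‖x * y * a - a * (x * y)‖ ≤ ‖x * a - a * x‖ + ‖y * a - a * y‖ := by
  have h : x * y * a - a * (x * y) = (x * a - a * x) * y + x * (y * a - a * y) := by noncomm_ring
  rw [h]
  exact (norm_add_le _ _).trans (add_le_add
    ((norm_mul_le _ _).trans (mul_le_of_le_one_right (norm_nonneg _) hy))
    ((norm_mul_le _ _).trans (mul_le_of_le_one_left (norm_nonneg _) hx)))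

theorem norm_mul_unitary_le {u v : A} (hu : u ∈ unitary A) (hv : v ∈ unitary A) (x : A) :
    ‖u * x * v‖ ≤ ‖x‖ :=
  (norm_mul_le _ _).trans ((mul_le_of_le_one_right (norm_nonneg _)
    (norm_le_one_of_unitary hv)).trans ((norm_mul_le _ _).trans
      (mul_le_of_le_one_left (norm_nonneg _) (norm_le_one_of_unitary hu))))

theorem norm_conj_unitary_le {u : A} (hu : u ∈ unitary A) (x : A) : ‖u * x * star u‖ ≤ ‖x‖ :=
  norm_mul_unitary_le hu (Unitary.star_mem hu) x

theorem norm_comm_star_le {x : A} (hx : x ∈ unitary A) (a : A) :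
    ‖star x * a - a * star x‖ ≤ ‖x * a - a * x‖ := by
  obtain ⟨h1, h2⟩ := Unitary.mem_iff.1 hx
  have h : star x * a - a * star x = star x * (a * x - x * a) * star x := by
    rw [mul_sub, sub_mul, ← mul_assoc, ← mul_assoc, h1, one_mul, mul_assoc _ x, h2, mul_one]
  rw [h, norm_sub_rev (x * a)]
  exact norm_mul_unitary_le (Unitary.star_mem hx) (Unitary.star_mem hx) _

theorem norm_conj_sub {x : A} (hx : x ∈ unitary A) (a : A) :
    ‖x * a * star x - a‖ = ‖x * a - a * x‖ := by
  obtain ⟨h1, h2⟩ := Unitary.mem_iff.1 hx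
  refine le_antisymm ?_ ?_
  · have h : x * a * star x - a = 1 * (x * a - a * x) * star x := by
      rw [one_mul, sub_mul, mul_assoc a, h2, mul_one]
    rw [h]
    exact norm_mul_unitary_le (one_mem _) (Unitary.star_mem hx) _
  · have h : x * a - a * x = 1 * (x * a * star x - a) * x := by
      rw [one_mul, sub_mul, mul_assoc _ (star x), h1, mul_one]
    rw [h]
    exact norm_mul_unitary_le (one_mem _) hx _

theorem norm_map_automorphism (α : A ≃⋆ₐ[ℂ] A) (a : A) : ‖α a‖ = ‖a‖ :=
  NonUnitalStarAlgHom.norm_map α α.injective a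

theorem continuous_automorphism (α : A ≃⋆ₐ[ℂ] A) : Continuous α :=
  (NonUnitalStarAlgHom.isometry α α.injective).continuous

theorem map_mem_unitary (α : A ≃⋆ₐ[ℂ] A) {u : A} (hu : u ∈ unitary A) : α u ∈ unitary A := by
  obtain ⟨h1, h2⟩ := Unitary.mem_iff.1 hu
  rw [Unitary.mem_iff, ← map_star, ← map_mul, ← map_mul, h1, h2, map_one]
  exact ⟨rfl, rfl⟩

/-- Commutators with `uα(z)u⋆`. -/
theorem norm_comm_conj_map_le (α : A ≃⋆ₐ[ℂ] A) {u z : A} (hu : u ∈ unitary A) (hz : z ∈ unitary A)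
    (a b : A) : ‖u * α z * star u * a - a * (u * α z * star u)‖ ≤
      ‖z * b - b * z‖ + 2 * ‖a - u * α b * star u‖ := by
  have hu1 := (Unitary.mem_iff.1 hu).1
  have hw : u * α z * star u ∈ unitary A :=
    mul_mem (mul_mem hu (map_mem_unitary α hz)) (Unitary.star_mem hu)
  refine (norm_comm_perturb (norm_le_one_of_unitary hw) a (u * α b * star u)).trans
    (add_le_add ?_ le_rfl)
  have hc : ∀ x y, u * α x * star u * (u * α y * star u) = u * α (x * y) * star u := fun x y => by
    rw [map_mul]
    calc u * α x * star u * (u * α y * star u) = u * α x * (star u * u) * α y * star u := by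
          simp only [mul_assoc]
      _ = _ := by rw [hu1, mul_one, mul_assoc u]
  rw [hc, hc, ← sub_mul, ← mul_sub, ← map_sub]
  exact (norm_conj_unitary_le hu _).trans (norm_map_automorphism α _).le

/-- The obstruction unitary `u₀ α₀(u₁) (u₁ α₁(u₀))⋆`. -/
def obstruction (α : Fin 2 → A ≃⋆ₐ[ℂ] A) (u : Fin 2 → A) : A :=
  u 0 * α 0 (u 1) * star (u 1 * α 1 (u 0))

theorem obstruction_mem {α : Fin 2 → A ≃⋆ₐ[ℂ] A} {u : Fin 2 → A} (hu : ∀ i, u i ∈ unitary A) :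
    obstruction α u ∈ unitary A :=
  mul_mem (mul_mem (hu 0) (map_mem_unitary _ (hu 1)))
    (Unitary.star_mem (mul_mem (hu 1) (map_mem_unitary _ (hu 0))))

/-- Conjugation by y = u₀ α₀(u₁) after α₀α₁, and by z = u₁ α₁(u₀) after α₁α₀, both approximate β₀β₁
= β₁β₀ at c up to 2η. As α₀α₁ = α₁α₀, the quotient y z⋆ almost commutes with β₀β₁(c). -/
theorem norm_comm_obstruction_le {α β : Fin 2 → A ≃⋆ₐ[ℂ] A}
    (hα : ∀ a, α 0 (α 1 a) = α 1 (α 0 a)) (hβ : ∀ a, β 0 (β 1 a) = β 1 (β 0 a))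
    {u : Fin 2 → A} (hu : ∀ i, u i ∈ unitary A) {c : A} {η : ℝ}
    (h0 : ‖β 0 c - u 0 * α 0 c * star (u 0)‖ ≤ η) (h1 : ‖β 1 c - u 1 * α 1 c * star (u 1)‖ ≤ η)
    (h01 : ‖β 0 (β 1 c) - u 0 * α 0 (β 1 c) * star (u 0)‖ ≤ η)
    (h10 : ‖β 1 (β 0 c) - u 1 * α 1 (β 0 c) * star (u 1)‖ ≤ η) :
    ‖obstruction α u * β 0 (β 1 c) - β 0 (β 1 c) * obstruction α u‖ ≤ 4 * η := by
  have key : ∀ i j : Fin 2, ‖β j c - u j * α j c * star (u j)‖ ≤ η →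
      ‖β i (β j c) - u i * α i (β j c) * star (u i)‖ ≤ η →
      ‖u i * α i (u j) * α i (α j c) * star (u i * α i (u j)) - β i (β j c)‖ ≤ 2 * η := by
    intro i j h h'
    have e : u i * α i (u j) * α i (α j c) * star (u i * α i (u j)) - β i (β j c) =
        -(u i * α i (β j c - u j * α j c * star (u j)) * star (u i)) -
          (β i (β j c) - u i * α i (β j c) * star (u i)) := by
      simp only [map_sub, map_mul, map_star, star_mul, mul_sub, sub_mul, mul_assoc]
      abel
    rw [e]
    refine (norm_sub_le _ _).trans ?_
    rw [norm_neg]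
    have := (norm_conj_unitary_le (hu i) (α i (β j c - u j * α j c * star (u j)))).trans
      ((norm_map_automorphism _ _).le.trans h)
    linarith
  have k0 := key 0 1 h1 h01
  have k1 := key 1 0 h0 h10
  rw [← hα, ← hβ] at k1
  have hy : u 0 * α 0 (u 1) ∈ unitary A := mul_mem (hu 0) (map_mem_unitary _ (hu 1))
  have hz : u 1 * α 1 (u 0) ∈ unitary A := mul_mem (hu 1) (map_mem_unitary _ (hu 0))
  rw [← norm_conj_sub (obstruction_mem hu)]
  unfold obstruction
  set y := u 0 * α 0 (u 1)
  set z := u 1 * α 1 (u 0)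
  set a := β 0 (β 1 c)
  set d := α 0 (α 1 c)
  clear_value y z
  obtain ⟨z1, -⟩ := Unitary.mem_iff.1 hz
  have e : y * star z * a * star (y * star z) - a =
      -((y * star z) * (z * d * star z - a) * star (y * star z)) + (y * d * star y - a) := by
    have : y * star z * (z * d * star z) * star (y * star z) = y * d * star y := by
      rw [star_mul, star_star]
      calc y * star z * (z * d * star z) * (z * star y)
          = y * (star z * z) * d * (star z * z) * star y := by simp only [mul_assoc]
        _ = _ := by rw [z1, mul_one, mul_one]
    rw [mul_sub, sub_mul, this]
    abel
  rw [e]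
  refine (norm_add_le _ _).trans ?_
  rw [norm_neg]
  have := (norm_conj_unitary_le (mul_mem hy (Unitary.star_mem hz)) (z * d * star z - a)).trans k1
  linarith

end Commutators

/-! ### Transport of paths along a change of unitaries -/

section UnitaryPaths

variable {A : Type*} [CStarAlgebra A]

/-- Paths of unitaries for which the winding number is defined. -/
structure IsUPath (h : ℝ → A) : Prop where
  isPath : IsPath h
  mem : ∀ s ∈ Icc (0 : ℝ) 1, h s ∈ unitary A

theorem IsUnitaryPath.isUPath {h : ℝ → A} (hh : IsUnitaryPath h) : IsUPath h :=
  ⟨hh.isPath, hh.unitary_mem⟩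

namespace IsUPath

variable {h k : ℝ → A}

theorem const {u : A} (hu : u ∈ unitary A) : IsUPath fun _ => u := ⟨isPath_const u, fun _ _ => hu⟩

theorem mul (hh : IsUPath h) (hk : IsUPath k) : IsUPath fun s => h s * k s :=
  ⟨hh.isPath.mul hk.isPath, fun s hs => mul_mem (hh.mem s hs) (hk.mem s hs)⟩

theorem star (hh : IsUPath h) : IsUPath fun s => star (h s) :=
  ⟨hh.isPath.star, fun s hs => Unitary.star_mem (hh.mem s hs)⟩

theorem map (hh : IsUPath h) (α : A ≃⋆ₐ[ℂ] A) : IsUPath fun s => α (h s) :=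
  ⟨hh.isPath.clm_comp ((⟨α.toAlgEquiv.toLinearMap, continuous_automorphism α⟩ :
    A →L[ℂ] A).restrictScalars ℝ), fun s hs => map_mem_unitary α (hh.mem s hs)⟩

theorem concat (hh : IsUPath h) (hk : IsUPath k) (e : h 1 = k 0) : IsUPath (concat h k) :=
  ⟨hh.isPath.concat hk.isPath e, concat_cases e hh.mem hk.mem⟩

end IsUPath

variable (T : MatrixTower A) {h k : ℝ → A}

include T in
theorem winding_map (hh : IsUPath h) (α : A ≃⋆ₐ[ℂ] A) :
    winding (fun s => α (h s)) = winding h := by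
  rw [winding_eq T (hh.map α).mem, winding_eq T hh.mem]
  congr 2
  exact wind_map (α.toAlgEquiv.toAlgHom) (continuous_automorphism α) _ (fun a => T.tr_map α a)
    hh.isPath fun s hs => isUnit_of_unitary (hh.mem s hs)

theorem winding_const {u : A} : winding (fun _ : ℝ => u) = 0 := by simp [winding]

include T in
theorem winding_concat (hh : IsUPath h) (hk : IsUPath k) (e : h 1 = k 0) :
    winding (concat h k) = winding h + winding k := by
  rw [winding_eq T (hh.concat hk e).mem, winding_eq T hh.mem, winding_eq T hk.mem,
    wind_concat T.trL hh.isPath hk.isPath e (fun s hs => isUnit_of_unitary (hh.mem s hs))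
      (fun s hs => isUnit_of_unitary (hk.mem s hs)), mul_add, Complex.add_re]

/-- The path `Z₀ (u₀ α₀(Z₁) u₀⋆) k (u₁ α₁(Z₀) u₁⋆)⋆ Z₁⋆`, which moves `k` along a change of the
unitaries `u₀, u₁`. -/
def transport (α : Fin 2 → A ≃⋆ₐ[ℂ] A) (u : Fin 2 → A) (Z : Fin 2 → ℝ → A) (k : ℝ → A) (s : ℝ) : A :=
  Z 0 s * (u 0 * α 0 (Z 1 s) * star (u 0)) * k s * star (u 1 * α 1 (Z 0 s) * star (u 1)) *
    star (Z 1 s)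

variable {α : Fin 2 → A ≃⋆ₐ[ℂ] A} {u : Fin 2 → A} {Z : Fin 2 → ℝ → A}

theorem isUPath_conj_map (hu : ∀ i, u i ∈ unitary A) (hZ : ∀ i, IsUPath (Z i)) (i j : Fin 2) :
    IsUPath fun s => u i * α i (Z j s) * star (u i) :=
  ((IsUPath.const (hu i)).mul ((hZ j).map (α i))).mul (IsUPath.const (Unitary.star_mem (hu i)))

theorem isUPath_transport (hu : ∀ i, u i ∈ unitary A) (hZ : ∀ i, IsUPath (Z i)) (hk : IsUPath k) :
    IsUPath (transport α u Z k) :=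
  ((((hZ 0).mul (isUPath_conj_map hu hZ 0 1)).mul hk).mul (isUPath_conj_map hu hZ 1 0).star).mul
    (hZ 1).star

include T in
theorem winding_conj_map (hu : ∀ i, u i ∈ unitary A) (hZ : ∀ i, IsUPath (Z i)) (i j : Fin 2) :
    winding (fun s => u i * α i (Z j s) * star (u i)) = winding (Z j) := by
  have h1 := IsUPath.const (hu i)
  have h2 := (hZ j).map (α i)
  have h3 := IsUPath.const (Unitary.star_mem (hu i))
  have h12 := h1.mul h2
  rw [winding_mul T h12.isPath h3.isPath h12.mem h3.mem, winding_mul T h1.isPath h2.isPath h1.mem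
    h2.mem, winding_const, winding_const, winding_map T (hZ j), zero_add, add_zero]

include T in
-- Each Z_i occurs once and its image under a conjugated automorphism occurs inversely; both have
-- the same winding.
theorem winding_transport (hu : ∀ i, u i ∈ unitary A) (hZ : ∀ i, IsUPath (Z i)) (hk : IsUPath k) :
    winding (transport α u Z k) = winding k := by
  have h1 := hZ 0
  have h2 := isUPath_conj_map (α := α) hu hZ 0 1
  have h4 := isUPath_conj_map (α := α) hu hZ 1 0
  have h5 := (hZ 1).star
  have h12 := h1.mul h2
  have h123 := h12.mul hk
  have h1234 := h123.mul h4.star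
  unfold transport
  rw [winding_mul T h1234.isPath h5.isPath h1234.mem h5.mem,
    winding_mul T h123.isPath h4.star.isPath h123.mem h4.star.mem,
    winding_mul T h12.isPath hk.isPath h12.mem hk.mem,
    winding_mul T h1.isPath h2.isPath h1.mem h2.mem, winding_star T h4.isPath h4.mem,
    winding_star T (hZ 1).isPath (hZ 1).mem, winding_conj_map T hu hZ, winding_conj_map T hu hZ]
  ring

theorem transport_zero (hu : ∀ i, u i ∈ unitary A) (hZ : ∀ i, Z i 0 = 1) :
    transport α u Z k 0 = k 0 := by
  have h0 := (Unitary.mem_iff.1 (hu 0)).2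
  have h1 := (Unitary.mem_iff.1 (hu 1)).2
  simp only [transport, hZ, map_one, mul_one, one_mul, star_one, h0, h1]

/-- The factors u_i⋆u_i telescope, leaving the obstruction of the changed unitaries. -/
theorem transport_one (hu : ∀ i, u i ∈ unitary A) (hk : k 1 = obstruction α u) :
    transport α u Z k 1 = obstruction α fun i => Z i 1 * u i := by
  have h0 := (Unitary.mem_iff.1 (hu 0)).1
  have h1 := (Unitary.mem_iff.1 (hu 1)).1
  simp only [transport, hk, obstruction, map_mul, star_mul, star_star]
  calc Z 0 1 * (u 0 * α 0 (Z 1 1) * star (u 0)) * (u 0 * α 0 (u 1) * (star (α 1 (u 0)) * star (u 1))) *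
        (u 1 * (star (α 1 (Z 0 1)) * star (u 1))) * star (Z 1 1)
      = Z 0 1 * (u 0 * α 0 (Z 1 1) * (star (u 0) * u 0) * α 0 (u 1) * (star (α 1 (u 0)) *
        (star (u 1) * u 1)) * (star (α 1 (Z 0 1)) * star (u 1))) * star (Z 1 1) := by
        simp only [mul_assoc]
    _ = _ := by
        rw [h0, h1]
        simp only [mul_assoc, mul_one]

/-- Commutators with the transported path. -/
theorem norm_comm_transport_le (hu : ∀ i, u i ∈ unitary A) (hZ : ∀ i, IsUPath (Z i))
    (hk : IsUPath k) {s : ℝ} (hs : s ∈ Icc (0 : ℝ) 1) (a : A) :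
    ‖transport α u Z k s * a - a * transport α u Z k s‖ ≤
      ‖Z 0 s * a - a * Z 0 s‖ +
        ‖u 0 * α 0 (Z 1 s) * star (u 0) * a - a * (u 0 * α 0 (Z 1 s) * star (u 0))‖ +
      ‖k s * a - a * k s‖ +
        ‖u 1 * α 1 (Z 0 s) * star (u 1) * a - a * (u 1 * α 1 (Z 0 s) * star (u 1))‖ +
      ‖Z 1 s * a - a * Z 1 s‖ := by
  have h1 := (hZ 0).mem s hs
  have h2 := (isUPath_conj_map (α := α) hu hZ 0 1).mem s hs
  have h3 := hk.mem s hs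
  have h4 := (isUPath_conj_map (α := α) hu hZ 1 0).mem s hs
  have h5 := (hZ 1).mem s hs
  have n : ∀ {x : A}, x ∈ unitary A → ‖x‖ ≤ 1 := norm_le_one_of_unitary
  unfold transport
  refine (norm_comm_mul_le (n (mul_mem (mul_mem (mul_mem h1 h2) h3) (Unitary.star_mem h4)))
    (n (Unitary.star_mem h5)) a).trans (add_le_add ?_ (norm_comm_star_le h5 a))
  refine (norm_comm_mul_le (n (mul_mem (mul_mem h1 h2) h3)) (n (Unitary.star_mem h4)) a).trans
    (add_le_add ?_ (norm_comm_star_le h4 a))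
  refine (norm_comm_mul_le (n (mul_mem h1 h2)) (n h3) a).trans (add_le_add ?_ le_rfl)
  exact norm_comm_mul_le (n h1) (n h2) a

end UnitaryPaths

end ZTwoUHF

end

noncomputable section

namespace ZTwoUHF

open Set Filter Topology MeasureTheory

/-! ### Approximate conjugacy on compact sets -/

section Approximation

variable {A : Type*} [CStarAlgebra A]

theorem polar_mem {B : StarSubalgebra ℂ A} [FiniteDimensional ℂ B] {y : A} (hy : y ∈ B) :
    polar y ∈ B := by
  have : IsClosed (B : Set A) := isClosed_of_finiteDimensional B
  exact mul_mem hy (cfc_mem (𝕜' := ℂ) _ (mul_mem (star_mem hy) hy))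

theorem MatrixTower.exists_approx_unitary (T : MatrixTower A) {K : Set A} (hK : IsCompact K)
    (hKu : ∀ a ∈ K, a ∈ unitary A) {ε : ℝ} (hε : 0 < ε) :
    ∃ k₀, ∀ k ≥ k₀, ∀ x ∈ K, ∃ b ∈ U (T.B k), ‖x - b‖ < ε := by
  obtain ⟨k₀, h⟩ := T.exists_approx hK (ε := min (ε / 8) (1 / 2)) (by positivity)
  refine ⟨k₀, fun k hk x hx => ?_⟩
  obtain ⟨d, hd, hxd⟩ := h k hk x hx
  have := finiteDimensional_of_matrix (T.e k)
  have h1 : ‖d - x‖ ≤ min (ε / 8) (1 / 2) := by rw [norm_sub_rev]; exact hxd.le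
  have h2 : min (ε / 8) (1 / 2 : ℝ) < 1 := (min_le_right _ _).trans_lt (by norm_num)
  refine ⟨polar d, ⟨polar_mem_unitary (isUnit_of_norm_sub_unitary_lt (hKu x hx)
    (h1.trans_lt h2)), polar_mem hd⟩, ?_⟩
  rw [norm_sub_rev]
  have h3 := norm_polar_sub_unitary_le (hKu x hx) h1 h2
  have := min_le_left (ε / 8) (1 / 2 : ℝ)
  linarith

/-- The set on which the automorphisms are compared in the definition of the relative
invariant. -/
def innerSet (β : Fin 2 → A ≃⋆ₐ[ℂ] A) (B : StarSubalgebra ℂ A) : Set A :=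
  (β 0).symm '' U B ∪ (β 1).symm '' U B ∪ (fun b => (β 0).symm ((β 1).symm b)) '' U B

theorem isCompact_innerSet (β : Fin 2 → A ≃⋆ₐ[ℂ] A) (B : StarSubalgebra ℂ A)
    [FiniteDimensional ℂ B] : IsCompact (innerSet β B) := by
  have h0 := continuous_automorphism (β 0).symm
  have h1 := continuous_automorphism (β 1).symm
  exact ((isCompact_U.image h0).union (isCompact_U.image h1)).union
    (isCompact_U.image (h0.comp h1))

theorem innerSet_unitary (β : Fin 2 → A ≃⋆ₐ[ℂ] A) (B : StarSubalgebra ℂ A) :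
    ∀ a ∈ innerSet β B, a ∈ unitary A := by
  rintro _ ((⟨b, hb, rfl⟩ | ⟨b, hb, rfl⟩) | ⟨b, hb, rfl⟩)
  · exact map_mem_unitary _ hb.1
  · exact map_mem_unitary _ hb.1
  · exact map_mem_unitary _ (map_mem_unitary _ hb.1)

/-- Two pairs of commuting automorphisms are approximately conjugate on compact sets by unitaries
with an obstruction that is connected to the unit by a path of almost commuting unitaries. -/
theorem exists_approximation (T : MatrixTower A) {α β : Fin 2 → A ≃⋆ₐ[ℂ] A}
    (hα : ∀ a, α 0 (α 1 a) = α 1 (α 0 a)) (hβ : ∀ a, β 0 (β 1 a) = β 1 (β 0 a))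
    {K : Set A} (hK : IsCompact K) (hKu : ∀ a ∈ K, a ∈ unitary A) {ε : ℝ} (hε : 0 < ε) :
    ∃ (u : Fin 2 → A) (h : ℝ → A), (∀ i, u i ∈ unitary A) ∧ IsUnitaryPath h ∧ h 0 = 1 ∧
      h 1 = obstruction α u ∧ (∀ i, ∀ a ∈ K, ‖β i a - u i * α i a * star (u i)‖ ≤ ε) ∧
      ∀ s ∈ Icc (0 : ℝ) 1, ∀ a ∈ K, ‖h s * a - a * h s‖ ≤ ε := by
  set ε' := min ε 1
  have hε' : 0 < ε' := by positivity
  have hε1 : ε' ≤ 1 := min_le_right _ _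
  have hε2 : ε' ≤ ε := min_le_left _ _
  -- Elements of K are replaced by unitaries of one stage; the perturbation costs 2 · ε'/4 in
  -- commutators with the final path.
  obtain ⟨k, hk⟩ := T.exists_approx_unitary hK hKu (ε := ε' / 4) (by positivity)
  have hk := hk k le_rfl
  have := finiteDimensional_of_matrix (T.e k)
  set C := (fun b => (β 0).symm ((β 1).symm b)) '' U (T.B k)
  have hC : IsCompact C := isCompact_U.image
    ((continuous_automorphism (β 0).symm).comp (continuous_automorphism (β 1).symm))
  -- The obstruction estimate at an element b of the stage compares the automorphisms at c =
  -- β₀⁻¹β₁⁻¹(b), at β₀(c) and at β₁(c).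
  set K' := K ∪ (C ∪ (β 0 '' C ∪ β 1 '' C))
  have hK' : IsCompact K' := hK.union (hC.union ((hC.image (continuous_automorphism _)).union
    (hC.image (continuous_automorphism _))))
  obtain ⟨l, hl⟩ := T.exists_approx ((hK'.image (continuous_automorphism (α 0))).union
    (hK'.image (continuous_automorphism (α 1)))) (ε := ε' / 256) (by positivity)
  have hl := hl l le_rfl
  -- The unitary u i implements β_i α_i⁻¹ exactly on a stage that nearly contains α_i(K').
  choose u hu hub using fun i => exists_unitary_conj_automorphism T ((α i).symm.trans (β i)) l
  have hin : ∀ i, ∀ a ∈ K', ‖β i a - u i * α i a * star (u i)‖ ≤ ε' / 128 := fun i a ha => by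
    obtain ⟨d, hd, had⟩ := hl (α i a) (by
      fin_cases i
      · exact Or.inl ⟨a, ha, rfl⟩
      · exact Or.inr ⟨a, ha, rfl⟩)
    have h1 : β i ((α i).symm d) = u i * d * star (u i) := hub i d hd
    have e : β i a - u i * α i a * star (u i) =
        β i ((α i).symm (α i a - d)) - u i * (α i a - d) * star (u i) := by
      rw [map_sub, map_sub, h1, StarAlgEquiv.symm_apply_apply, mul_sub, sub_mul]
      abel
    rw [e]
    refine (norm_sub_le _ _).trans ?_
    rw [norm_map_automorphism, norm_map_automorphism]
    have := norm_conj_unitary_le (hu i) (α i a - d)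
    linarith
  have hx := obstruction_mem (α := α) hu
  -- Here 2 · ε'/256 = ε'/128 is the conjugacy error, 4 · ε'/128 = ε'/32 the commutator of the
  -- obstruction, and 16 · ε'/32 = ε'/2 that of the path.
  obtain ⟨h, h1, h2, h3, h4, h5⟩ := exists_smooth_path (B := T.B k) T (δ := ε' / 32) (by positivity)
    (by linarith) hx fun a ha => by
      set c := (β 0).symm ((β 1).symm a) with hc
      have hcC : c ∈ C := ⟨a, ha, rfl⟩
      have hca : β 0 (β 1 c) = a := by
        rw [hβ, hc, StarAlgEquiv.apply_symm_apply, StarAlgEquiv.apply_symm_apply]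
      have := norm_comm_obstruction_le hα hβ hu (c := c) (η := ε' / 128)
        (hin 0 c (Or.inr (Or.inl hcC))) (hin 1 c (Or.inr (Or.inl hcC)))
        (hin 0 _ (Or.inr (Or.inr (Or.inr ⟨c, hcC, rfl⟩))))
        (hin 1 _ (Or.inr (Or.inr (Or.inl ⟨c, hcC, rfl⟩))))
      rw [hca] at this
      linarith
  refine ⟨u, h, hu, isUnitaryPath_of_contDiff h1 h2, h3, h4, fun i a ha =>
    (hin i a (Or.inl ha)).trans (by linarith), fun s hs a ha => ?_⟩
  obtain ⟨b, hb, hab⟩ := hk a ha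
  have := norm_comm_perturb (norm_le_one_of_unitary (h2 s)) a b
  linarith [h5 s hs b hb]

end Approximation

/-! ### Comparing a choice with a path of small commutators -/

section Choices

variable {A : Type*} [CStarAlgebra A]

theorem gen_comm (α : Action A) (a : A) : gen α 0 (gen α 1 a) = gen α 1 (gen α 0 a) := by
  have h : gen α 0 * gen α 1 = gen α 1 * gen α 0 := by
    rw [gen, gen, ← map_mul α, ← map_mul α, mul_comm]
  exact congrArg (fun f : A ≃⋆ₐ[ℂ] A => f a) h

variable (T : MatrixTower A) {α β : Action A} {q : ℕ}

include T in
/-- Paths from the unit to an obstruction have winding numbers in `K₀(A)`. -/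
theorem winding_mem_K₀ {γ : Fin 2 → A ≃⋆ₐ[ℂ] A} {u : Fin 2 → A} (hu : ∀ i, u i ∈ unitary A)
    {h : ℝ → A} (hh : IsUPath h) (h0 : h 0 = 1) (h1 : h 1 = obstruction γ u) :
    winding h ∈ K₀ (⊤ : StarSubalgebra ℂ A) := by
  choose V hV1 hV2 hV3 hV4 using fun i => exists_smooth_path_one T (hu i)
  have hV : ∀ i, IsUPath (V i) := fun i => (isUnitaryPath_of_contDiff (hV1 i) (hV2 i)).isUPath
  have hone : ∀ i : Fin 2, (fun _ => 1 : Fin 2 → A) i ∈ unitary A := fun _ => one_mem _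
  have hk : IsUPath fun _ : ℝ => (1 : A) := IsUPath.const (one_mem _)
  -- Transporting the constant path 1 along paths from 1 to the u_i gives a path from 1 to the
  -- obstruction with winding zero. Dividing h by it leaves a loop.
  have hQ := isUPath_transport (α := γ) hone hV hk
  have hW := winding_transport T (α := γ) hone hV hk
  have hL := hh.mul hQ.star
  obtain ⟨x, hx, hxw⟩ := T.wind_mem_K₀ hL.isPath (fun s hs => isUnit_of_unitary (hL.mem s hs)) (by
    simp only [h0, h1, transport_zero hone hV3]
    rw [transport_one hone (by simp [obstruction])]
    simp only [hV4, mul_one, star_one, (Unitary.mem_iff.1 (obstruction_mem hu)).2])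
  have h2 := winding_of_wind_eq T hL.mem hxw
  rw [winding_mul T hh.isPath hQ.star.isPath hh.mem hQ.star.mem,
    winding_star T hQ.isPath hQ.mem, hW, winding_const, neg_zero, add_zero] at h2
  rwa [h2]

include T in
/-- The winding number computed from a choice agrees, modulo `K₀(A ∩ A₀')`, with the winding number
of a path with sufficiently small commutators. -/
theorem Choice.winding_sub_mem (hq : 0 < q) (D : Choice β α q) {u : Fin 2 → A}
    (hu : ∀ i, u i ∈ unitary A) {h : ℝ → A} (hh : IsUPath h) (h0 : h 0 = 1)
    (h1 : h 1 = obstruction (gen α) u)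
    (hin : ∀ i, ∀ a ∈ innerSet (gen β) D.A₁,
      ‖gen β i a - u i * gen α i a * star (u i)‖ ≤ D.δ₀ / 7)
    (hc : ∀ s ∈ Icc (0 : ℝ) 1, ∀ a ∈ U D.A₀, ‖h s * a - a * h s‖ ≤ 1 / 100) :
    (winding D.h - winding h) / q ∈ K₀ (⊤ : StarSubalgebra ℂ A) := by
  obtain ⟨e⟩ := D.isMatrix
  have := D.finiteDim
  obtain ⟨hδ0, hδ8, hδ⟩ := D.good
  set δ := D.δ₀
  set w : Fin 2 → A := fun i => D.u i
  have hw : ∀ i, w i ∈ unitary A := fun i => (D.u i).2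
  have hDh : IsUPath D.h := D.isPath.isUPath
  have hin' : ∀ i, ∀ a ∈ innerSet (gen β) D.A₁,
      ‖gen β i a - w i * gen α i a * star (w i)‖ < δ / 7 := D.inner_approx
  have hsymm : ∀ i, ∀ a ∈ U D.A₁, (gen β i).symm a ∈ innerSet (gen β) D.A₁ := fun i a ha => by
    fin_cases i
    · exact Or.inl (Or.inl ⟨a, ha, rfl⟩)
    · exact Or.inl (Or.inr ⟨a, ha, rfl⟩)
  -- With d = α_i(β_i⁻¹(a)), conjugation by u_i w_i⋆ sends w_i d w_i⋆ to u_i d u_i⋆, and both are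
  -- within δ/7 of a.
  have hz : ∀ i, ∀ a ∈ U D.A₁,
      ‖u i * star (w i) * a - a * (u i * star (w i))‖ < δ := fun i a ha => by
    have hb := hsymm i a ha
    have k1 := hin i _ hb
    have k2 := hin' i _ hb
    rw [StarAlgEquiv.apply_symm_apply] at k1 k2
    set d := gen α i ((gen β i).symm a)
    have hzi : u i * star (w i) ∈ unitary A := mul_mem (hu i) (Unitary.star_mem (hw i))
    rw [← norm_conj_sub hzi]
    have hww := (Unitary.mem_iff.1 (hw i)).1
    have e1 : u i * star (w i) * (w i * d * star (w i)) * star (u i * star (w i)) =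
        u i * d * star (u i) := by
      rw [star_mul, star_star]
      calc u i * star (w i) * (w i * d * star (w i)) * (w i * star (u i))
          = u i * (star (w i) * w i) * d * (star (w i) * w i) * star (u i) := by
            simp only [mul_assoc]
        _ = _ := by rw [hww, mul_one, mul_one]
    have e2 : u i * star (w i) * a * star (u i * star (w i)) - a =
        u i * star (w i) * (a - w i * d * star (w i)) * star (u i * star (w i)) -
          (a - u i * d * star (u i)) := by
      rw [mul_sub, sub_mul, e1]; abel
    rw [e2]
    refine (norm_sub_le _ _).trans_lt ?_
    have := norm_conj_unitary_le hzi (a - w i * d * star (w i))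
    linarith
  choose Z hZ hZ0 hZ1 hZc using fun i => hδ D.A₁ D.finiteDim (u i * star (w i))
    (mul_mem (hu i) (Unitary.star_mem (hw i))) (hz i)
  have hZu : ∀ i, IsUPath (Z i) := fun i => (hZ i).isUPath
  have hxu := obstruction_mem (α := gen α) hw
  have hkc : IsUPath fun _ : ℝ => obstruction (gen α) w := IsUPath.const hxu
  -- The constant path at the obstruction of w is transported, so the result runs from there to the
  -- obstruction of u with winding zero.
  have hP := isUPath_transport (α := gen α) hw hZu hkc
  have hP0 : transport (gen α) w Z (fun _ => obstruction (gen α) w) 0 = obstruction (gen α) w :=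
    transport_zero hw hZ0
  have hP1 : transport (gen α) w Z (fun _ => obstruction (gen α) w) 1 = obstruction (gen α) u := by
    rw [transport_one hw rfl]
    congr 1
    funext i
    rw [hZ1, mul_assoc, (Unitary.mem_iff.1 (hw i)).1, mul_one]
  have hD1 : D.h 1 = transport (gen α) w Z (fun _ => obstruction (gen α) w) 0 := by
    rw [hP0]; exact D.h_one
  have hcon := hDh.concat hP hD1
  have hL := hcon.mul hh.star
  -- On the transport part the bounds are 1/8 + 2δ/7 twice, 1/8 + 8δ/7 twice and 6δ/7 for the
  -- obstruction. The sum is 1/2 + 26δ/7 < 97/100 because δ < 1/8.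
  have hcomm : ∀ s ∈ Icc (0 : ℝ) 1, ∀ a ∈ U D.A₀,
      ‖concat D.h (transport (gen α) w Z (fun _ => obstruction (gen α) w)) s * a -
        a * concat D.h (transport (gen α) w Z (fun _ => obstruction (gen α) w)) s‖ ≤ 97 / 100 := by
    refine concat_cases hD1 (P := fun x => ∀ a ∈ U D.A₀, ‖x * a - a * x‖ ≤ 97 / 100) (fun s hs a ha => (D.h_comm s hs a ha).le.trans (by norm_num)) ?_
    intro s hs a ha
    obtain ⟨a', ha', b, hb, c, hc, haa', hab, hac⟩ := D.approx a ha
    refine (norm_comm_transport_le hw hZu hkc hs a).trans ?_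
    have f1 : ∀ i, ‖Z i s * a - a * Z i s‖ ≤ 1 / 8 + 2 * (δ / 7) := fun i => by
      have := norm_comm_perturb (norm_le_one_of_unitary ((hZu i).mem s hs)) a a'
      linarith [hZc i s hs a' ha']
    have f2 : ∀ i j, ∀ b ∈ U D.A₁, ‖(gen β i).symm a - b‖ < δ / 7 →
        ‖w i * gen α i (Z j s) * star (w i) * a - a * (w i * gen α i (Z j s) * star (w i))‖ ≤
          1 / 8 + 8 * (δ / 7) := fun i j b hb hab => by
      refine (norm_comm_conj_map_le (gen α i) (hw i) ((hZu j).mem s hs) a b).trans ?_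
      have g1 := hin' i _ (hsymm i a' ha')
      rw [StarAlgEquiv.apply_symm_apply] at g1
      have g2 : ‖a - w i * gen α i b * star (w i)‖ ≤ 4 * (δ / 7) := by
        have e1 : a - w i * gen α i b * star (w i) = (a - a') +
            (a' - w i * gen α i ((gen β i).symm a') * star (w i)) +
            w i * gen α i ((gen β i).symm (a' - a) + ((gen β i).symm a - b)) * star (w i) := by
          simp only [map_sub, map_add, mul_add, mul_sub, add_mul, sub_mul]
          abel
        rw [e1]
        refine (norm_add₃_le).trans ?_
        have g3 := (norm_conj_unitary_le (hw i) (gen α i ((gen β i).symm (a' - a) +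
          ((gen β i).symm a - b)))).trans ((norm_map_automorphism _ _).le.trans (norm_add_le _ _))
        rw [norm_map_automorphism, norm_sub_rev a' a] at g3
        linarith
      linarith [hZc j s hs b hb]
    have f3 : ‖obstruction (gen α) w * a - a * obstruction (gen α) w‖ ≤ 6 * (δ / 7) := by
      set c' := (gen β 0).symm ((gen β 1).symm a') with hc'
      have hc1 : c' ∈ innerSet (gen β) D.A₁ := Or.inr ⟨a', ha', rfl⟩
      have hb0 : gen β 0 c' = (gen β 1).symm a' := by rw [hc', StarAlgEquiv.apply_symm_apply]
      have hca : gen β 0 (gen β 1 c') = a' := by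
        rw [gen_comm, hb0, StarAlgEquiv.apply_symm_apply]
      have hb1 : gen β 1 c' = (gen β 0).symm a' := by
        rw [← hca, StarAlgEquiv.symm_apply_apply]
      have g1 := norm_comm_obstruction_le (gen_comm α) (gen_comm β) hw (c := c') (η := δ / 7)
        (hin' 0 _ hc1).le (hin' 1 _ hc1).le (by rw [hb1]; exact (hin' 0 _ (hsymm 0 a' ha')).le)
        (by rw [hb0]; exact (hin' 1 _ (hsymm 1 a' ha')).le)
      rw [hca] at g1
      have := norm_comm_perturb (norm_le_one_of_unitary hxu) a a'
      linarith
    linarith [f1 0, f1 1, f2 0 1 b hb hab, f2 1 0 c hc hac]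
  -- The loop follows the chosen path, then the transport, divided by h; its commutators stay below
  -- 97/100 + 1/100 < 1.
  obtain ⟨x, hx, hxw⟩ := T.wind_mem_K₀_centralizer hq e hL.isPath hL.mem (by
    rw [concat_of_le _ _ (by norm_num), concat_of_ge hD1 (by norm_num)]
    norm_num
    rw [D.h_zero, h0, hP1, h1, star_one, mul_one, (Unitary.mem_iff.1 (obstruction_mem hu)).2])
    (r := 98 / 100) (by norm_num) fun s hs a ha => by
      refine (norm_comm_mul_le (norm_le_one_of_unitary (hcon.mem s hs))
        (norm_le_one_of_unitary (hh.star.mem s hs)) a).trans ?_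
      have := norm_comm_star_le (hh.mem s hs) a
      linarith [hcomm s hs a ha, hc s hs a ha]
  have h2 := winding_of_wind_eq T hL.mem hxw
  rw [winding_mul T hcon.isPath hh.star.isPath hcon.mem hh.star.mem, winding_star T hh.isPath hh.mem,
    winding_concat T hDh hP hD1, winding_transport T hw hZu hkc, winding_const, add_zero,
    ← sub_eq_add_neg] at h2
  rw [h2]
  exact (T.mem_K₀_centralizer hq e).1 hx

end Choices

end ZTwoUHF

end

noncomputable section

namespace ZTwoUHF

open Set Filter Topology MeasureTheory

/-! ### The cocycle identity -/

section Cocycle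

variable {A : Type*} [CStarAlgebra A]

/-- The inverse of a β-transport times an α-transport is nearly conjugation of k by V₁ b₁, once the
E_i approximate the b_i; the factors V₀ cancel exactly. -/
theorem norm_sandwich_sub_le {V₀ V₁ b₀ b₁ E₀ E₁ k : A} (hV₀ : V₀ ∈ unitary A)
    (hV₁ : V₁ ∈ unitary A) (hb₀ : b₀ ∈ unitary A) (hb₁ : b₁ ∈ unitary A) (hE₁ : E₁ ∈ unitary A)
    (hk : k ∈ unitary A) {ε : ℝ} (h₀ : ‖b₀ - E₀‖ ≤ ε) (h₁ : ‖b₁ - E₁‖ ≤ ε) :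
    ‖V₁ * b₁ * star b₀ * star V₀ * (V₀ * E₀ * k * star E₁ * star V₁) -
      V₁ * b₁ * k * star (V₁ * b₁)‖ ≤ 2 * ε := by
  have e1 := (Unitary.mem_iff.1 hV₀).1
  have e2 := (Unitary.mem_iff.1 hb₀).1
  have e : V₁ * b₁ * star b₀ * star V₀ * (V₀ * E₀ * k * star E₁ * star V₁) -
      V₁ * b₁ * k * star (V₁ * b₁) =
      -(V₁ * b₁ * star b₀ * (b₀ - E₀) * (k * star E₁ * star V₁)) -
        V₁ * b₁ * k * star (b₁ - E₁) * star V₁ := by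
    have h3 : V₁ * b₁ * star b₀ * star V₀ * (V₀ * E₀ * k * star E₁ * star V₁) =
        V₁ * b₁ * star b₀ * (star V₀ * V₀) * E₀ * k * star E₁ * star V₁ := by
      simp only [mul_assoc]
    have h4 : V₁ * b₁ * star b₀ * (b₀ - E₀) * (k * star E₁ * star V₁) =
        V₁ * b₁ * (star b₀ * b₀) * (k * star E₁ * star V₁) -
          V₁ * b₁ * star b₀ * E₀ * k * star E₁ * star V₁ := by
      simp only [mul_sub, sub_mul, mul_assoc]
    rw [h3, h4, e1, e2]
    simp only [star_mul, star_sub, mul_sub, sub_mul, mul_one, mul_assoc]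
    abel
  rw [e]
  refine (norm_sub_le _ _).trans ?_
  rw [norm_neg]
  have n1 := norm_mul_unitary_le (mul_mem (mul_mem hV₁ hb₁) (Unitary.star_mem hb₀))
    (mul_mem (mul_mem hk (Unitary.star_mem hE₁)) (Unitary.star_mem hV₁)) (b₀ - E₀)
  have n2 := norm_mul_unitary_le (mul_mem (mul_mem hV₁ hb₁) hk) (Unitary.star_mem hV₁)
    (star (b₁ - E₁))
  rw [norm_star] at n2
  linarith

theorem conj_star_conj {x : A} (hx : x ∈ unitary A) (a : A) :
    x * (star x * a * x) * star x = a := by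
  have h := (Unitary.mem_iff.1 hx).2
  rw [← mul_assoc, ← mul_assoc, h, one_mul, mul_assoc, h, mul_one]

theorem norm_comm_sub_le {a : A} (ha : ‖a‖ ≤ 1) (x y : A) :
    ‖x * a - a * x‖ ≤ ‖y * a - a * y‖ + 2 * ‖x - y‖ := by
  rw [norm_sub_rev (x * a), norm_sub_rev (y * a)]
  exact norm_comm_perturb ha x y

variable (T : MatrixTower A) {α β γ : Action A} {q : ℕ}

include T in
/-- The cocycle identity for winding numbers. -/
theorem winding_cocycle (hq : 0 < q) (D : Choice γ α q) (D₁ : Choice γ β q) (D₂ : Choice β α q) :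
    (winding D.h - winding D₁.h - winding D₂.h) / q ∈ K₀ (⊤ : StarSubalgebra ℂ A) := by
  have := D.finiteDim
  have := D₁.finiteDim
  have := D₂.finiteDim
  have : FiniteDimensional ℂ D.A₀ := finiteDimensional_of_matrix D.isMatrix.some
  have : FiniteDimensional ℂ D₁.A₀ := finiteDimensional_of_matrix D₁.isMatrix.some
  have : FiniteDimensional ℂ D₂.A₀ := finiteDimensional_of_matrix D₂.isMatrix.some
  have d0 := D.good.1
  have d1 := D₁.good.1
  have d2 := D₂.good.1
  obtain ⟨ε, hε, hε0, hεd, hε1, hε2⟩ : ∃ ε > 0, ε ≤ 1 / 1000 ∧ ε ≤ D.δ₀ / 14 ∧ ε ≤ D₁.δ₀ / 7 ∧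
      ε ≤ D₂.δ₀ / 7 :=
    ⟨min (min (1 / 1000) (D.δ₀ / 14)) (min (D₁.δ₀ / 7) (D₂.δ₀ / 7)), by positivity,
      (min_le_left _ _).trans (min_le_left _ _), (min_le_left _ _).trans (min_le_right _ _),
      (min_le_right _ _).trans (min_le_left _ _), (min_le_right _ _).trans (min_le_right _ _)⟩
  obtain ⟨v, hv, vu, hvp, hv0, hv1, hvin, hvc⟩ := exists_approximation T (gen_comm β) (gen_comm γ)
    (K := (innerSet (gen γ) D.A₁ ∪ U D.A₀) ∪ (innerSet (gen γ) D₁.A₁ ∪ U D₁.A₀))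
    (((isCompact_innerSet _ _).union isCompact_U).union ((isCompact_innerSet _ _).union isCompact_U))
    (by
      rintro a ((h | h) | (h | h))
      exacts [innerSet_unitary _ _ _ h, h.1, innerSet_unitary _ _ _ h, h.1]) hε
  choose V hV1 hV2 hV3 hV4 using fun i => exists_smooth_path_one T (vu i)
  have hV : ∀ i, IsUPath (V i) := fun i => (isUnitaryPath_of_contDiff (hV1 i) (hV2 i)).isUPath
  -- The unitary by which the path for u is conjugated in the composite path.
  set S : ℝ → A := fun s => V 1 s * gen β 1 (V 0 s) with hS
  have hSu : ∀ s, S s ∈ unitary A := fun s => mul_mem (hV2 1 s) (map_mem_unitary _ (hV2 0 s))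
  have hSc : Continuous S :=
    (hV1 1).continuous.mul ((continuous_automorphism _).comp (hV1 0).continuous)
  -- The pair u is chosen after V: it must approximate β on the paths V_i, and its path must almost
  -- commute with the conjugates S⋆ a S.
  obtain ⟨u, hu, uu, hup, hu0, hu1, huin, huc⟩ := exists_approximation T (gen_comm α) (gen_comm β)
    (K := (innerSet (gen γ) D.A₁ ∪ (V 0 '' Icc 0 1 ∪ V 1 '' Icc 0 1)) ∪
      ((innerSet (gen β) D₂.A₁ ∪ U D₂.A₀) ∪
        (fun x : ℝ × A => star (S x.1) * x.2 * S x.1) '' (Icc 0 1 ×ˢ U D.A₀)))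
    (((isCompact_innerSet _ _).union ((isCompact_Icc.image (hV1 0).continuous).union
      (isCompact_Icc.image (hV1 1).continuous))).union
      (((isCompact_innerSet _ _).union isCompact_U).union
        ((isCompact_Icc.prod isCompact_U).image (by fun_prop))))
    (by
      rintro a ((h | (⟨s, -, rfl⟩ | ⟨s, -, rfl⟩)) | ((h | h) | ⟨x, hx, rfl⟩))
      · exact innerSet_unitary _ _ _ h
      · exact hV2 0 s
      · exact hV2 1 s
      · exact innerSet_unitary _ _ _ h
      · exact h.1
      · exact mul_mem (mul_mem (Unitary.star_mem (hSu _)) hx.2.1) (hSu _)) hε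
  have hvp' := hvp.isUPath
  have hup' := hup.isUPath
  have hone : ∀ i : Fin 2, (fun _ => 1 : Fin 2 → A) i ∈ unitary A := fun _ => one_mem _
  have hk1 : IsUPath fun _ : ℝ => (1 : A) := IsUPath.const (one_mem _)
  have hQ := isUPath_transport (α := gen β) hone hV hk1
  have hP := isUPath_transport (α := gen α) uu hV hup'
  have hQP := hQ.star.mul hP
  have hw := hvp'.mul hQP
  have hvw : ∀ i, V i 1 * u i ∈ unitary A := fun i => mul_mem (hV2 i 1) (uu i)
  have m1 := D₁.winding_sub_mem T hq vu hvp' hv0 hv1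
    (fun i a ha => (hvin i a (Or.inr (Or.inl ha))).trans hε1)
    (fun s hs a ha => (hvc s hs a (Or.inr (Or.inr ha))).trans (by linarith))
  have m2 := D₂.winding_sub_mem T hq uu hup' hu0 hu1
    (fun i a ha => (huin i a (Or.inr (Or.inl (Or.inl ha)))).trans hε2)
    (fun s hs a ha => (huc s hs a (Or.inr (Or.inl (Or.inr ha)))).trans (by linarith))
  -- The pair v_i u_i serves for γ and α with error 2ε ≤ δ₀/7.
  have m := D.winding_sub_mem T hq hvw hw (by
      simp only [hv0, transport_zero hone hV3, transport_zero uu hV3, hu0, star_one, mul_one])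
    (by
      simp only [hv1, transport_one uu hu1, transport_one (α := gen β) hone (Z := V)
        (k := fun _ => 1) (by simp [obstruction]), mul_one, hV4]
      rw [← mul_assoc, (Unitary.mem_iff.1 (obstruction_mem vu)).2, one_mul])
    (fun i a ha => by
      have k1 := hvin i a (Or.inl (Or.inl ha))
      have k2 := huin i a (Or.inl (Or.inl ha))
      have e : gen γ i a - V i 1 * u i * gen α i a * star (V i 1 * u i) =
          (gen γ i a - v i * gen β i a * star (v i)) +
            v i * (gen β i a - u i * gen α i a * star (u i)) * star (v i) := by
        rw [hV4]
        simp only [star_mul, mul_sub, sub_mul, mul_assoc]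
        abel
      rw [e]
      have := norm_conj_unitary_le (vu i) (gen β i a - u i * gen α i a * star (u i))
      exact (norm_add_le _ _).trans (by linarith))
    (fun s hs a ha => by
      -- The path for v contributes ε, the conjugated path for u another ε, and the sandwich error
      -- 2ε counts twice. The total 6ε is below 1/100.
      refine (norm_comm_mul_le (norm_le_one_of_unitary (hvp'.mem s hs))
        (norm_le_one_of_unitary (hQP.mem s hs)) a).trans ?_
      have k1 := hvc s hs a (Or.inl (Or.inr ha))
      have b0 := huin 0 (V 1 s) (Or.inl (Or.inr (Or.inr ⟨s, hs, rfl⟩)))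
      have b1 := huin 1 (V 0 s) (Or.inl (Or.inr (Or.inl ⟨s, hs, rfl⟩)))
      have k2 := norm_sandwich_sub_le (hV2 0 s) (hV2 1 s) (map_mem_unitary (gen β 0) (hV2 1 s))
        (map_mem_unitary (gen β 1) (hV2 0 s))
        ((isUPath_conj_map (α := gen α) uu hV 1 0).mem s hs) (hup'.mem s hs) b0 b1
      have e : star (transport (gen β) (fun _ => 1) V (fun _ => 1) s) =
          V 1 s * gen β 1 (V 0 s) * star (gen β 0 (V 1 s)) * star (V 0 s) := by
        simp only [transport, star_one, mul_one, one_mul, star_mul, star_star, mul_assoc]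
      rw [← e] at k2
      have k3 := norm_comm_sub_le (norm_le_one_of_unitary ha.1)
        (star (transport (gen β) (fun _ => 1) V (fun _ => 1) s) * transport (gen α) u V hu s)
        (V 1 s * gen β 1 (V 0 s) * hu s * star (V 1 s * gen β 1 (V 0 s)))
      have k4 := huc s hs (star (S s) * a * S s) (Or.inr (Or.inr ⟨(s, a), ⟨hs, ha⟩, rfl⟩))
      have k5 : ‖S s * hu s * star (S s) * a - a * (S s * hu s * star (S s))‖ ≤
          ‖hu s * (star (S s) * a * S s) - star (S s) * a * S s * hu s‖ +
            2 * ‖a - S s * (star (S s) * a * S s) * star (S s)‖ :=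
        norm_comm_conj_map_le (StarAlgEquiv.refl ℂ A) (hSu s) (hup'.mem s hs) a _
      rw [conj_star_conj (hSu s), sub_self, norm_zero, mul_zero, add_zero] at k5
      have k7 := k5.trans k4
      simp only [hS] at k7
      unfold transport at k2 k3 ⊢
      linarith)
  have hwind : winding (fun s => hv s * (star (transport (gen β) (fun _ => 1) V (fun _ => 1) s) *
      transport (gen α) u V hu s)) = winding hv + winding hu := by
    rw [winding_mul T hvp'.isPath hQP.isPath hvp'.mem hQP.mem,
      winding_mul T hQ.star.isPath hP.isPath hQ.star.mem hP.mem, winding_star T hQ.isPath hQ.mem,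
      winding_transport T hone hV hk1, winding_transport T uu hV hup', winding_const, neg_zero,
      zero_add]
  rw [hwind] at m
  -- The three choices may use different A₀, but each relative commutant has the same K₀, namely q
  -- K₀(A), so the three relations can be subtracted.
  have := sub_mem (sub_mem m m1) m2
  convert this using 1
  ring

include T in
theorem nonempty_choice {A₀ : StarSubalgebra ℂ A} (hA₀ : IsMatrixSubalgebra q A₀) :
    Nonempty (Choice β α q) := by
  obtain ⟨δ, hδ⟩ : ∃ δ, IsGoodConstant A δ := ⟨_, T.isGoodConstant⟩
  have hδ0 := hδ.1
  have : FiniteDimensional ℂ A₀ := finiteDimensional_of_matrix hA₀.some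
  have hU : IsCompact (U A₀) := isCompact_U
  obtain ⟨k, hk⟩ := T.exists_approx_unitary
    (hU.union ((hU.image (continuous_automorphism (gen β 0).symm)).union
      (hU.image (continuous_automorphism (gen β 1).symm)))) (by
      rintro a (h | (⟨b, hb, rfl⟩ | ⟨b, hb, rfl⟩))
      exacts [h.1, map_mem_unitary _ hb.1, map_mem_unitary _ hb.1]) (ε := δ / 7) (by positivity)
  have hk := hk k le_rfl
  have hfin := finiteDimensional_of_matrix (T.e k)
  obtain ⟨u, h, uu, hp, h0, h1, hin, hc⟩ := exists_approximation T (gen_comm α) (gen_comm β)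
    (K := innerSet (gen β) (T.B k) ∪ U A₀) ((isCompact_innerSet _ _).union hU) (by
      rintro a (h | h)
      exacts [innerSet_unitary _ _ _ h, h.1]) (ε := min (δ / 8) (1 / 4)) (by positivity)
  refine ⟨{ δ₀ := δ
            good := hδ
            A₀ := A₀
            isMatrix := hA₀
            A₁ := T.B k
            finiteDim := hfin
            approx := fun w hw => ?_
            u := fun i => ⟨u i, uu i⟩
            inner_approx := fun i a ha => ?_
            h := h
            isPath := hp
            h_zero := h0
            h_one := h1
            h_comm := fun t ht a ha => ?_ }⟩
  · obtain ⟨a, ha, ha'⟩ := hk w (Or.inl hw)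
    obtain ⟨b, hb, hb'⟩ := hk _ (Or.inr (Or.inl ⟨w, hw, rfl⟩))
    obtain ⟨c, hc, hc'⟩ := hk _ (Or.inr (Or.inr ⟨w, hw, rfl⟩))
    exact ⟨a, ha, b, hb, c, hc, ha', hb', hc'⟩
  · refine ((hin i a (Or.inl ha)).trans (min_le_left _ _)).trans_lt ?_
    linarith
  · exact ((hc t ht a (Or.inr ha)).trans (min_le_right _ _)).trans_lt (by norm_num)

end Cocycle

/-! ### Well-definedness and additivity -/

section RelativeInvariant

variable {A : Type*} [CStarAlgebra A] (T : MatrixTower A) (α β γ : Action A) {p : ℕ}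

include T in
-- A form of the condition free of A₀, so that classes from different choices can be compared.
theorem Choice.represents_iff {α β : Action A} (hp : p ∈ primeSet A) (D : Choice β α (θ A p))
    (c : ZMod (θ A p)) : D.Represents c ↔ ∃ j : ℤ, (j : ZMod (θ A p)) = c ∧
      (winding D.h - j / θ A p) / θ A p ∈ K₀ (⊤ : StarSubalgebra ℂ A) := by
  obtain ⟨e⟩ := D.isMatrix
  have h : winding D.h ∈ K₀ (⊤ : StarSubalgebra ℂ A) :=
    winding_mem_K₀ T (fun i => (D.u i).2) D.isPath.isUPath D.h_zero D.h_one
  simp only [Choice.Represents, h, true_and, T.mem_K₀_centralizer (θ_pos hp) e]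

include T in
theorem Choice.exists_represents {α β : Action A} (hp : p ∈ primeSet A)
    (D : Choice β α (θ A p)) : ∃ c, D.Represents c := by
  obtain ⟨j, hj⟩ := exists_int_sub_mem T hp
    (winding_mem_K₀ T (fun i => (D.u i).2) D.isPath.isUPath D.h_zero D.h_one)
  exact ⟨j, (D.represents_iff T hp _).2 ⟨j, rfl, hj⟩⟩

include T in
theorem nonempty_choice_of_mem (hp : p ∈ primeSet A) : Nonempty (Choice β α (θ A p)) := by
  obtain ⟨k, hk⟩ := (inv_mem_iff T (θ_pos hp)).1 (exists_mul_eq_one hp)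
  obtain ⟨A₀, hA₀⟩ := T.exists_isMatrixSubalgebra hk
  exact nonempty_choice T hA₀

variable {α β γ}

include T in
theorem represents_add (hp : p ∈ primeSet A) {D : Choice γ α (θ A p)} {D₁ : Choice γ β (θ A p)}
    {D₂ : Choice β α (θ A p)} {c c₁ c₂ : ZMod (θ A p)} (h : D.Represents c)
    (h₁ : D₁.Represents c₁) (h₂ : D₂.Represents c₂) : c = c₁ + c₂ := by
  obtain ⟨j, rfl, hj⟩ := (D.represents_iff T hp _).1 h
  obtain ⟨j₁, rfl, hj₁⟩ := (D₁.represents_iff T hp _).1 h₁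
  obtain ⟨j₂, rfl, hj₂⟩ := (D₂.represents_iff T hp _).1 h₂
  have hD := winding_cocycle T (θ_pos hp) D D₁ D₂
  have h3 := sub_mem (sub_mem hj hj₁) hj₂
  have h4 : ((j - (j₁ + j₂) : ℤ) : ℝ) / θ A p / θ A p ∈ K₀ (⊤ : StarSubalgebra ℂ A) := by
    have := sub_mem hD h3
    convert this using 1
    push_cast
    ring
  have h5 := (int_div_mem_iff T hp).1 h4
  rw [← Int.cast_add]
  exact ((ZMod.intCast_eq_intCast_iff_dvd_sub _ _ _).2 h5).symm

include T in
-- Additivity alone suffices: c = c + c₂, with c₂ from any choice for (α, α), forces c₂ = 0, and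
-- then c = c' + c₂ gives c = c'.
theorem represents_unique (hp : p ∈ primeSet A) {D D' : Choice β α (θ A p)}
    {c c' : ZMod (θ A p)} (h : D.Represents c) (h' : D'.Represents c') : c = c' := by
  obtain ⟨D₂⟩ := nonempty_choice_of_mem T α α hp
  obtain ⟨c₂, h₂⟩ := D₂.exists_represents T hp
  have := represents_add T hp h h h₂
  rw [left_eq_add.1 this] at h₂
  have := represents_add T hp h h' h₂
  rwa [add_zero] at this

include T in
theorem exists_represents_relInvariant (α β : Action A) (p : primeSet A) :
    ∃ D : Choice β α (θ A p), D.Represents (relInvariant β α p) := by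
  obtain ⟨D⟩ := nonempty_choice_of_mem T α β p.2
  obtain ⟨c, hc⟩ := D.exists_represents T p.2
  exact Classical.epsilon_spec
    (p := fun c => ∃ D : Choice β α (θ A p), D.Represents c) ⟨c, D, hc⟩

include T in
theorem wellDefined (α β : Action A) : WellDefined β α := fun p => by
  refine ⟨nonempty_choice_of_mem T α β p.2, fun D c => ?_⟩
  obtain ⟨D', h'⟩ := exists_represents_relInvariant T α β p
  obtain ⟨c', hc'⟩ := D.exists_represents T p.2
  refine ⟨fun h => represents_unique T p.2 h h', ?_⟩
  rintro rfl
  rwa [← represents_unique T p.2 hc' h']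

end RelativeInvariant

end ZTwoUHF

end

theorem mainTheorem11 {A : Type*} [CStarAlgebra A] (hA : ZTwoUHF.IsUHF A)
    (α β γ : ZTwoUHF.Action A) :
    (ZTwoUHF.WellDefined γ α ∧ ZTwoUHF.WellDefined γ β ∧ ZTwoUHF.WellDefined β α) ∧
      ZTwoUHF.relInvariant γ α = ZTwoUHF.relInvariant γ β + ZTwoUHF.relInvariant β α := by
  obtain ⟨T⟩ := hA.nonempty_tower
  refine ⟨⟨ZTwoUHF.wellDefined T α γ, ZTwoUHF.wellDefined T β γ, ZTwoUHF.wellDefined T α β⟩, ?_⟩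
  funext p
  obtain ⟨D, h⟩ := ZTwoUHF.exists_represents_relInvariant T α γ p
  obtain ⟨D₁, h₁⟩ := ZTwoUHF.exists_represents_relInvariant T β γ p
  obtain ⟨D₂, h₂⟩ := ZTwoUHF.exists_represents_relInvariant T α β p
  exact ZTwoUHF.represents_add T p.2 h h₁ h₂
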